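/- Let $S=(\mathbf R^2\smallsetminus\mathbf Z^2)/\mathbf Z^2$ be the one-holed torus, with fundamental group free on the horizontal and the vertical loop, and for $p/q\in\mathbf P^1\mathbf Q=\mathbf Q\cup\{\infty\}$ let $\gamma_{p/q}\in\pi_1(S)$ represent the simple closed curve of slope $p/q$. For a representation $\rho:\pi_1(S)\to\mathrm{PSL}_2\mathbf R$ let $\lambda_\rho(\gamma)=\inf_{z\in\mathbb H^2}d(z,\rho(\gamma)z)$ be the translation length of $\rho(\gamma)$, and for a triple $\boldsymbol\rho=(\rho_1,\rho_2,\rho_3)$ put $\boldsymbol\lambda_{\boldsymbol\rho}=(\lambda_{\rho_1},\lambda_{\rho_2},\lambda_{\rho_3})$, with values in the Weyl chamber $\mathbf R^3_{\ge 0}$. The projectivized chamber $\mathbf P(\mathbf R^3_{\ge0})$ is drawn in the Euclidean plane as an equilateral triangle by means of homogeneous barycentric coordinates. For every $\varepsilon>0$ there is $M$ such that the following holds for all $a,b$ with $M\le a<b$. Let $\rho_1,\rho_2,\rho_3$ be holonomy representations of complete hyperbolic structures on $S$ such that $$\boldsymbol\lambda_{\boldsymbol\rho}(\gamma_{0/1})=2(a,b,b),\qquad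 \boldsymbol\lambda_{\boldsymbol\rho}(\gamma_{1/1})=2(b,a,b),\qquad \boldsymbol\lambda_{\boldsymbol\rho}(\gamma_{1/0})=2(b,b,a).$$ Then the map $\mathbf P^1\mathbf Q\to\mathbf P(\mathbf R^3_{\ge0})$, $p/q\mapsto[\boldsymbol\lambda_{\boldsymbol\rho}(\gamma_{p/q})]$, extends to a continuous map on $\mathbf P^1\mathbf R$, whose image is the boundary of a compact strictly convex region $C\subset\mathbf P(\mathbf R^3_{\ge0})$ with nonempty interior. Every $[\boldsymbol\lambda_{\boldsymbol\rho}(\gamma_{p/q})]$ is an angular point of $C$, i.e. $C$ has two different supporting lines there. Moreover, if $T$ denotes the triangle with vertices $[a:b:b]$, $[b:a:b]$, $[b:b:a]$, then the Hausdorff distance between $C$ and $T$ is at most $\varepsilon\,\mathrm{diam}(T)$, and at each vertex $V$ of $T$ the corner of $C$ is nearly as pointy as that of $T$: for all $x,y\in C\smallsetminus\{V\}$, the angle $\angle xVy$ is at most the angle of $T$ at $V$ plus $\varepsilon$. -/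

import Mathlib

open scoped UpperHalfPlane MatrixGroups

/-- The group `PSL₂(ℝ)`. -/
abbrev PSL2R : Type := Matrix.ProjectiveSpecialLinearGroup (Fin 2) ℝ

/-- Central elements of `SL₂(ℝ)` act trivially on the hyperbolic plane. -/
theorem center_le_ker_toPermHom :
    Subgroup.center SL(2, ℝ) ≤ (MulAction.toPermHom SL(2, ℝ) ℍ).ker := by
  intro A hA
  have h0 := Matrix.SpecialLinearGroup.scalar_eq_self_of_mem_center hA 0
  have h00 : A 0 0 = A 1 1 := by
    have := congrFun (congrFun h0 1) 1
    simpa using this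
  have h01 : A 0 1 = 0 := by
    have := congrFun (congrFun h0 0) 1
    simpa using this.symm
  have h10 : A 1 0 = 0 := by
    have := congrFun (congrFun h0 1) 0
    simpa using this.symm
  have hdet := A.det_coe
  rw [Matrix.det_fin_two, h01, h10, h00] at hdet
  have hne : (A 1 1 : ℂ) ≠ 0 := by
    intro h
    have h' : A 1 1 = 0 := by exact_mod_cast h
    simp [h'] at hdet
  rw [MonoidHom.mem_ker]
  ext z
  simp [MulAction.toPermHom_apply, UpperHalfPlane.coe_specialLinearGroup_apply, h01, h10, h00,
    mul_div_cancel_left₀ _ hne]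

/-- The action of `PSL₂(ℝ)` on the hyperbolic plane by Möbius transformations. -/
noncomputable def mobius : PSL2R →* Equiv.Perm ℍ :=
  QuotientGroup.lift (Subgroup.center SL(2, ℝ)) (MulAction.toPermHom SL(2, ℝ) ℍ)
    center_le_ker_toPermHom

/-- The translation length of an element of `PSL₂(ℝ)` on the hyperbolic plane. -/
noncomputable def translationLength (g : PSL2R) : ℝ :=
  ⨅ z : ℍ, dist z (mobius g z)

/-- The plane `ℝ²` punctured at the points of `ℤ²`. The model of the one-holed torus is
`S = (ℝ² ∖ ℤ²) / ℤ²`. -/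
abbrev PuncturedPlane : Type :=
  {p : ℝ × ℝ // ¬ ∃ m n : ℤ, p = ((m : ℝ), (n : ℝ))}

/-- The fundamental group of the one-holed torus `S = (ℝ² ∖ ℤ²) / ℤ²`, free on the generators
`FreeGroup.of 0` (the horizontal loop, with homology class `(1, 0)`) and `FreeGroup.of 1`
(the vertical loop, with homology class `(0, 1)`). A loop in `S` is spelled as a word by recording
its successive crossings with the vertical arc (letter `of 0`) and with the horizontal arc
(letter `of 1`) that join the puncture to itself. -/
abbrev TorusGroup : Type := FreeGroup (Fin 2)

/-- `ρ` is the holonomy representation of a complete hyperbolic structure on the one-holed torus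
`S = (ℝ² ∖ ℤ²) / ℤ²`: there is a universal covering `f` of `ℝ² ∖ ℤ²` (which is the homology cover
of `S`) by the hyperbolic plane such that the composition `ℍ → ℝ² ∖ ℤ² → S` has the
`ρ`-orbits as its fibres, i.e. induces a homeomorphism from the quotient of `ℍ` by the image of `ρ`
to `S`, and such that this homeomorphism is compatible with the markings, i.e. the deck
transformations given by the two generators of the fundamental group lift the translations of
`ℝ²` by their homology classes. -/
def IsHolonomy (ρ : TorusGroup →* PSL2R) : Prop :=
  Function.Injective ρ ∧
  ∃ f : ℍ → PuncturedPlane, IsCoveringMap f ∧ Function.Surjective f ∧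
    (∀ z, (f (mobius (ρ (FreeGroup.of 0)) z)).1 = (f z).1 + (1, 0)) ∧
    (∀ z, (f (mobius (ρ (FreeGroup.of 1)) z)).1 = (f z).1 + (0, 1)) ∧
    (∀ z w, (∃ m n : ℤ, (f w).1 = (f z).1 + ((m : ℝ), (n : ℝ))) ↔
      ∃ g : TorusGroup, w = mobius (ρ g) z)

/-- The simple closed curve of slope `p/q ∈ ℚ ∪ {∞}` in `S = (ℝ² ∖ ℤ²) / ℤ²`. The curve of slope
`∞` is the vertical loop. For a finite slope `r = p/q` with `q ≥ 1`, the curve is the image of the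
straight line `y = r x + δ` (small `δ > 0`) over a period `0 ≤ x < q`, read through its crossings:
for each `k = 0, …, q - 1` it crosses the vertical arc at `x = k`, then, between `x = k` and
`x = k + 1`, it crosses the horizontal arc `⌊(k + 1) r⌋ - ⌊k r⌋` times (counted with sign). -/
def slopeCurve (s : OnePoint ℚ) : TorusGroup :=
  s.elim (FreeGroup.of 1) fun r =>
    ((List.range r.den).map fun k : ℕ =>
      FreeGroup.of 0 * FreeGroup.of 1 ^ (⌊((k : ℚ) + 1) * r⌋ - ⌊(k : ℚ) * r⌋)).prod

/-- The Jordan projection of `g` under a triple of representations, i.e. the triple of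
translation lengths, a vector of the Weyl chamber `ℝ³_{≥ 0}`. -/
noncomputable def jordan (ρ : Fin 3 → TorusGroup →* PSL2R) (g : TorusGroup) : Fin 3 → ℝ :=
  fun i => translationLength (ρ i g)

/-- The Euclidean plane, in which the projectivized Weyl chamber is drawn. -/
abbrev Plane : Type := EuclideanSpace ℝ (Fin 2)

/-- The vertices of an equilateral triangle in the Euclidean plane. -/
noncomputable def corner : Fin 3 → Plane :=
  ![!₂[1, 0], !₂[-1 / 2, √3 / 2], !₂[-1 / 2, -√3 / 2]]

/-- The point `[v 0 : v 1 : v 2]` of the projectivized Weyl chamber (for a nonzero vector `v` with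
nonnegative coordinates), seen in the affine chart of the projective plane in which
`v 0, v 1, v 2` are homogeneous barycentric coordinates with respect to an equilateral triangle. -/
noncomputable def projPoint (v : Fin 3 → ℝ) : Plane :=
  (∑ i, v i)⁻¹ • ∑ i, v i • corner i

/-- The projectivized Weyl chamber `P(ℝ³_{≥ 0})`. -/
def projChamber : Set Plane :=
  {x | ∃ v : Fin 3 → ℝ, (∀ i, 0 ≤ v i) ∧ v ≠ 0 ∧ x = projPoint v}

/-- `x` is an angular point of the convex set `C` of the plane: a point of `C` through which there
pass two different supporting lines. -/
def IsAngularPoint (C : Set Plane) (x : Plane) : Prop :=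
  x ∈ C ∧ ∃ f g : Plane →L[ℝ] ℝ, LinearIndependent ℝ ![f, g] ∧
    ∀ y ∈ C, f y ≤ f x ∧ g y ≤ g x

/-- The vector with `k`-th coordinate `a` and the two others equal to `b`. -/
def sideLengths (a b : ℝ) (k : Fin 3) : Fin 3 → ℝ := fun i => if i = k then a else b

/-!
Each holonomy representation is lifted to `SL₂(ℝ)` with positive traces on the two generators; the
translation length then determines the trace up to sign (`translationLength_eq_two_mul`,
`tr_sq_eq_of_translationLength`). The trace of the product of the generators is positive as well. If
it were less than `-2`, then a ping-pong argument, as for a pair of pants, would show that the axes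
of the two generators have disjoint projections to the surface; but the images of these axes in
`ℝ² ∖ ℤ²` are invariant under a horizontal and a vertical translation, so that they intersect
(`neg_two_le_trace_mul_of_isHolonomy`, `exists_eq_of_translates`). Hence all traces of simple closed
curves follow from the three given ones by the relation
`tr (g h) + tr (g h⁻¹) = tr g * tr h` along the Farey graph (`slopeWord_add`,
`isMarkov_slopeTrace`).

By the symmetry of order three (`rotVec`, `Arc.rot`) it suffices to understand the slopes in
`[0, 1]`. They form a tree, in which two neighbours `u`, `w` produce the mediant `u + w`. Half the
translation length is almost additive: the defect `x + y - z` of a triple of half lengths is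
positive, exponentially small (`FareyTriple.sinh_defect_le`), decreasing in the lengths, and
Lipschitz with a small constant (`FareyTriple.defect_anti`, `FareyTriple.defect_lipschitz`). The
errors are summable along the tree, and so the vector of the three half lengths, in barycentric
coordinates for the triangle, lies just outside of a side of the triangle (`Arc.near_coord`); this
gives the estimates of the Hausdorff distance and of the angles. It also makes the half length,
divided by the denominator, a Lipschitz function of the slope, whence the continuous extension
(`Arc.abs_sub_le`, `Arc.exists_curve`).

For the convexity one considers all neighbours `v + k s` of a slope `s`. Their traces are solutions
of a linear recursion, so that their vectors of half lengths, minus `k` times the vector at `s`,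
converge on both sides of `s`. The sum of the two limits, up to a multiple of the vector at `s`, has
the coordinates `log (1 + κ / sinh² (x i))`, where `2 - 4 * κ` is the common trace of the boundary
curve and `x i` are the half lengths at `s` (`ArcTrace.fan`, `Arc.exists_limits`). These
coordinates are positive, and the smallest one belongs to the largest half length. Therefore the two
limit directions at `s` differ, and the curve has two supporting lines there
(`Arc.exists_support`). Since the defects are monotonic, the same inequalities hold already for
three successive vertices, which are thus in convex position (`Arc.det3_pos_of_edges`). Local
convexity along all chains of neighbours implies convexity (`pos_of_transGen`), and a closed curve
in convex position bounds a strictly convex region (`convexHull_range_of_curve`).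
-/

/-! ### Translation lengths and traces -/

/-- The quadratic form of the fixed points of `g`, evaluated at `z` and divided by the height of
`z`. The axis of a hyperbolic element is the set of its zeros. -/
noncomputable def axisForm (g : SL(2, ℝ)) (z : ℍ) : ℝ :=
  (g 1 0 * (z.re ^ 2 + z.im ^ 2) + (g 1 1 - g 0 0) * z.re - g 0 1) / z.im

theorem mobius_mk (g : SL(2, ℝ)) (z : ℍ) : mobius (QuotientGroup.mk g) z = g • z := rfl

/-- The displacement formula: the displacement of a point is determined by the trace and by the
distance to the axis, which enters through `axisForm`. -/
theorem two_mul_sinh_half_displacement_sq (g : SL(2, ℝ)) (z : ℍ) :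
    (2 * Real.sinh (dist z (g • z) / 2)) ^ 2 =
      (g 0 0 + g 1 1) ^ 2 - 4 + axisForm g z ^ 2 := by
  have hdet := g.det_coe
  rw [Matrix.det_fin_two] at hdet
  have hz := z.im_pos
  have hact : ((g • z : ℍ) : ℂ) =
      ((g 0 0 : ℂ) * z + g 0 1) / ((g 1 0 : ℂ) * z + g 1 1) := by
    rw [UpperHalfPlane.coe_specialLinearGroup_apply]
    rfl
  have hc : (g • z : ℍ).im = z.im / Complex.normSq ((g 1 0 : ℂ) * z + g 1 1) := by
    rw [← UpperHalfPlane.coe_im, hact, Complex.div_im, ← sub_div]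
    congr 1
    simp
    linear_combination (z.im) * hdet
  have hn : (g 1 0 : ℂ) * z + g 1 1 ≠ 0 := by
    intro h0
    have h1 := congrArg Complex.im h0
    have h2 := congrArg Complex.re h0
    simp at h1 h2
    rcases h1 with h1 | h1
    · simp [h1] at h2
      simp [h1, h2] at hdet
    · exact hz.ne' h1
  have hnpos : 0 < Complex.normSq ((g 1 0 : ℂ) * z + g 1 1) := Complex.normSq_pos.2 hn
  rw [UpperHalfPlane.sinh_half_dist, mul_pow, div_pow, mul_pow, Real.sq_sqrt (by positivity), hc,
    Complex.dist_eq, Complex.sq_norm]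
  have hd : (z : ℂ) - ((g • z : ℍ) : ℂ) =
      ((g 1 0 : ℂ) * z ^ 2 + (g 1 1 - g 0 0) * z - g 0 1) / ((g 1 0 : ℂ) * z + g 1 1) := by
    rw [hact, eq_div_iff hn, sub_mul, div_mul_cancel₀ _ hn]
    ring
  rw [hd, Complex.normSq_div]
  unfold axisForm
  have : Complex.normSq ((g 1 0 : ℂ) * z ^ 2 + (g 1 1 - g 0 0) * z - g 0 1) =
      (g 1 0 * (z.re ^ 2 - z.im ^ 2) + (g 1 1 - g 0 0) * z.re - g 0 1) ^ 2 +
        (2 * g 1 0 * z.re * z.im + (g 1 1 - g 0 0) * z.im) ^ 2 := by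
    rw [Complex.normSq_apply]
    simp [pow_two]
    ring
  rw [this]
  field_simp
  linear_combination (-4 * z.im ^ 2) * hdet

theorem tr_sq_le_of_displacement (g : SL(2, ℝ)) (z : ℍ) :
    (g 0 0 + g 1 1) ^ 2 ≤ (2 * Real.cosh (dist z (g • z) / 2)) ^ 2 := by
  have h := two_mul_sinh_half_displacement_sq g z
  have h2 := Real.cosh_sq (dist z (g • z) / 2)
  nlinarith [sq_nonneg (axisForm g z)]

/-- An element that is not hyperbolic moves some points by arbitrarily little; by the displacement
formula, this is a statement about `axisForm`. -/
theorem exists_axisForm_sq_le (g : SL(2, ℝ)) (htr : (g 0 0 + g 1 1) ^ 2 ≤ 4) {δ : ℝ}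
    (hδ : 0 < δ) : ∃ z : ℍ, (g 0 0 + g 1 1) ^ 2 - 4 + axisForm g z ^ 2 ≤ δ ^ 2 := by
  have hdet := g.det_coe
  rw [Matrix.det_fin_two] at hdet
  by_cases hc : g 1 0 = 0
  -- a parabolic element that fixes `∞`: the displacement is small at large height
  · have h1 : g 0 0 = g 1 1 := by
      rw [hc] at hdet
      nlinarith [sq_nonneg (g 0 0 - g 1 1)]
    refine ⟨⟨⟨0, (|g 0 1| + 1) / δ⟩, by positivity⟩, ?_⟩
    have h2 : axisForm g ⟨⟨0, (|g 0 1| + 1) / δ⟩, by positivity⟩ = -g 0 1 / ((|g 0 1| + 1) / δ) := by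
      simp [axisForm, hc, h1, UpperHalfPlane.im, UpperHalfPlane.re]
    rw [h2]
    have h3 : (-g 0 1 / ((|g 0 1| + 1) / δ)) ^ 2 ≤ δ ^ 2 := by
      rw [sq_le_sq, abs_div, abs_neg, abs_of_pos (by positivity : 0 < (|g 0 1| + 1) / δ),
        abs_of_pos hδ, div_le_iff₀ (by positivity), mul_div_cancel₀ _ hδ.ne']
      linarith
    linarith
  · set e := 4 - (g 0 0 + g 1 1) ^ 2 with he
    have hform : ∀ y (hy : 0 < y), axisForm g ⟨⟨(g 0 0 - g 1 1) / (2 * g 1 0), y⟩, hy⟩ =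
        g 1 0 * y + e / (4 * g 1 0 * y) := by
      intro y hy
      simp only [axisForm, UpperHalfPlane.im, UpperHalfPlane.re]
      field_simp
      linear_combination 16 * hdet
    -- a parabolic element near its fixed point (`e = 0`), or an elliptic one at its fixed point
    rcases (show 0 ≤ e by linarith).eq_or_lt with h0 | h0
    · refine ⟨_, (congrArg _ (congrArg (· ^ 2)
        (hform (δ / |g 1 0|) (by positivity)))).le.trans ?_⟩
      rw [← h0, zero_div, add_zero, mul_pow, div_pow, sq_abs, mul_div_cancel₀ _ (by positivity)]
      linarith
    · refine ⟨_, (congrArg _ (congrArg (· ^ 2)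
        (hform (√e / (2 * |g 1 0|)) (by positivity)))).le.trans ?_⟩
      have h1 : (g 1 0 * (√e / (2 * |g 1 0|)) + e / (4 * g 1 0 * (√e / (2 * |g 1 0|)))) ^ 2 = e := by
        have hs := Real.sq_sqrt h0.le
        have hs0 : 0 < √e := Real.sqrt_pos.2 h0
        have ha := sq_abs (g 1 0)
        have ha0 : 0 < |g 1 0| := abs_pos.2 hc
        generalize √e = r at *
        generalize |g 1 0| = k at *
        rw [← hs]
        field_simp
        rw [← ha]
        ring
      rw [h1]
      nlinarith [sq_nonneg δ]

theorem exists_axisForm_eq_zero (g : SL(2, ℝ)) (htr : 4 < (g 0 0 + g 1 1) ^ 2) :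
    ∃ z : ℍ, axisForm g z = 0 := by
  have hdet := g.det_coe
  rw [Matrix.det_fin_two] at hdet
  by_cases hc : g 1 0 = 0
  · have h1 : g 1 1 - g 0 0 ≠ 0 := by
      intro h
      rw [hc] at hdet
      nlinarith
    refine ⟨⟨⟨g 0 1 / (g 1 1 - g 0 0), 1⟩, one_pos⟩, ?_⟩
    simp only [axisForm, UpperHalfPlane.im, UpperHalfPlane.re, hc]
    field_simp
    ring
  · set e := (g 0 0 + g 1 1) ^ 2 - 4 with he
    have he0 : 0 < e := by linarith
    refine ⟨⟨⟨(g 0 0 - g 1 1) / (2 * g 1 0), √e / (2 * |g 1 0|)⟩,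
      div_pos (Real.sqrt_pos.2 he0) (by positivity)⟩, ?_⟩
    simp only [axisForm, UpperHalfPlane.im, UpperHalfPlane.re, div_pow, mul_pow, sq_abs,
      Real.sq_sqrt he0.le]
    rw [div_eq_zero_iff]
    left
    rw [he]
    field_simp
    linear_combination 4 * hdet

theorem translationLength_eq_two_mul (g : SL(2, ℝ)) {h : ℝ} (hh : 0 < h)
    (htr : (g 0 0 + g 1 1) ^ 2 = (2 * Real.cosh h) ^ 2) :
    translationLength (QuotientGroup.mk g) = 2 * h := by
  have hlow : ∀ z : ℍ, 2 * h ≤ dist z (g • z) := by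
    intro z
    have h1 := tr_sq_le_of_displacement g z
    rw [htr, sq_le_sq, abs_of_pos (by positivity), abs_of_pos (by positivity)] at h1
    have h2 : Real.cosh h ≤ Real.cosh (dist z (g • z) / 2) := by linarith
    rw [Real.cosh_le_cosh, abs_of_pos hh, abs_of_nonneg (by positivity)] at h2
    linarith
  have h1 := Real.one_lt_cosh.2 hh.ne'
  obtain ⟨z, hz⟩ := exists_axisForm_eq_zero g (by rw [htr]; nlinarith)
  refine le_antisymm ?_ (le_ciInf hlow)
  refine (ciInf_le ⟨0, ?_⟩ z).trans ?_
  · rintro _ ⟨w, rfl⟩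
    exact dist_nonneg
  · rw [mobius_mk]
    have h2 := two_mul_sinh_half_displacement_sq g z
    rw [hz, htr] at h2
    have h3 := Real.cosh_sq h
    have h4 : Real.sinh (dist z (g • z) / 2) ^ 2 = Real.sinh h ^ 2 := by nlinarith
    rw [sq_eq_sq₀ (Real.sinh_nonneg_iff.2 (by positivity)) (Real.sinh_nonneg_iff.2 hh.le),
      Real.sinh_inj] at h4
    linarith

/-- The converse of `translationLength_eq_two_mul`: an element of positive translation length is
hyperbolic. -/
theorem tr_sq_eq_of_translationLength (g : SL(2, ℝ)) {h : ℝ} (hh : 0 < h)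
    (hl : translationLength (QuotientGroup.mk g) = 2 * h) :
    (g 0 0 + g 1 1) ^ 2 = (2 * Real.cosh h) ^ 2 := by
  have hlow : ∀ z : ℍ, 2 * h ≤ dist z (g • z) := by
    intro z
    rw [← hl]
    refine ciInf_le (f := fun z : ℍ => dist z (mobius (QuotientGroup.mk g) z)) ⟨0, ?_⟩ z
    rintro _ ⟨w, rfl⟩
    exact dist_nonneg
  rcases le_or_gt ((g 0 0 + g 1 1) ^ 2) 4 with h4 | h4
  · obtain ⟨z, hz⟩ := exists_axisForm_sq_le g h4 (Real.sinh_pos_iff.2 hh)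
    rw [← two_mul_sinh_half_displacement_sq] at hz
    have h1 : Real.sinh h ≤ Real.sinh (dist z (g • z) / 2) :=
      Real.sinh_le_sinh.2 (by linarith [hlow z])
    have h2 := Real.sinh_pos_iff.2 hh
    nlinarith
  · set k := Real.arcosh (|g 0 0 + g 1 1| / 2) with hk
    have h2 : 2 < |g 0 0 + g 1 1| := by
      rw [← abs_two, ← sq_lt_sq]; linarith
    have hc : Real.cosh k = |g 0 0 + g 1 1| / 2 := Real.cosh_arcosh (by linarith)
    have hk0 : 0 < k := Real.arcosh_pos (by linarith)
    have h3 : (g 0 0 + g 1 1) ^ 2 = (2 * Real.cosh k) ^ 2 := by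
      rw [hc, mul_div_cancel₀ _ two_ne_zero, sq_abs]
    have h4 := translationLength_eq_two_mul g hk0 h3
    rw [h3, show h = k by linarith]

/-! ### Curves in the plane with transverse periods -/

/-- A continuous periodic function is bounded. -/
theorem Function.Periodic.exists_norm_le_of_continuous {E : Type*} [NormedAddCommGroup E]
    {u : ℝ → E} (hu : Continuous u) (hp : Function.Periodic u 1) : ∃ C : ℝ, ∀ s, ‖u s‖ ≤ C := by
  obtain ⟨C, hC⟩ := isCompact_Icc.exists_bound_of_continuousOn (s := Set.Icc (0 : ℝ) 1)
    hu.continuousOn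
  refine ⟨C, fun s => ?_⟩
  obtain ⟨y, hy, hsy⟩ := hp.exists_mem_Ico₀ one_pos s
  rw [hsy]
  exact hC y ⟨hy.1, hy.2.le⟩

/-- A continuous nonvanishing function on the plane cannot stay at bounded distance from
`(s, t) ↦ s - i t`: it would have a continuous logarithm, and so would a rotation of a large
circle. -/
theorem exists_zero_of_bounded_sub {F : ℝ × ℝ → ℂ} (hF : Continuous F) {C : ℝ}
    (hC : ∀ p : ℝ × ℝ, ‖F p - (p.1 - Complex.I * p.2)‖ ≤ C) : ∃ p, F p = 0 := by
  by_contra! hne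
  obtain ⟨l, hl⟩ : ∃ l : C(ℝ × ℝ, ℂ), ∀ p, Complex.exp (l p) = F p := by
    obtain ⟨l, ⟨-, hl⟩, -⟩ := Complex.isCoveringMap_exp.existsUnique_continuousMap_lifts
      (⟨fun p => ⟨F p, hne p⟩, by fun_prop⟩ : C(ℝ × ℝ, {z : ℂ // z ≠ 0})) (a₀ := (0, 0))
      (e₀ := Complex.log (F (0, 0))) (by simp [Complex.exp_log (hne _)])
    refine ⟨l, fun p => ?_⟩
    have := congrFun hl p
    simpa using congrArg Subtype.val this
  -- on the circle of radius `N`, the quotient of `F` by `w` stays in the right half plane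
  set N : ℝ := C + 1 with hN
  have hC0 : 0 ≤ C := (norm_nonneg _).trans (hC (0, 0))
  have hNpos : 0 < N := by positivity
  set c : ℝ → ℝ × ℝ := fun θ => (N * Real.cos θ, N * Real.sin θ) with hc
  set w : ℝ → ℂ := fun θ => Complex.exp (Real.log N - Complex.I * θ) with hw
  have hwc : ∀ θ, ((c θ).1 : ℂ) - Complex.I * (c θ).2 = w θ := by
    intro θ
    have : Complex.exp (Real.log N - Complex.I * θ) =
        N * (Complex.cos θ - Complex.sin θ * Complex.I) := by
      rw [Complex.exp_sub, ← Complex.ofReal_exp, Real.exp_log hNpos, mul_comm Complex.I,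
        Complex.exp_mul_I, div_eq_iff]
      · linear_combination (-(N : ℂ)) * Complex.cos_sq_add_sin_sq (θ : ℂ) +
          (N : ℂ) * (Complex.sin θ) ^ 2 * Complex.I_sq
      · rw [← Complex.exp_mul_I]; exact Complex.exp_ne_zero _
    simp only [hw, hc, this]
    push_cast
    ring
  have hwn : ∀ θ, ‖w θ‖ = N := by
    intro θ
    simp [hw, Complex.norm_exp, Real.exp_log hNpos]
  have hw0 : ∀ θ, w θ ≠ 0 := fun θ => Complex.exp_ne_zero _
  have hslit : ∀ θ, F (c θ) / w θ ∈ Complex.slitPlane := by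
    intro θ
    have h1 : ‖F (c θ) / w θ - 1‖ < 1 := by
      rw [div_sub_one (hw0 θ), norm_div, hwn, div_lt_one hNpos, ← hwc]
      exact (hC _).trans_lt (by linarith)
    left
    have h2 := (Complex.abs_re_le_norm (F (c θ) / w θ - 1)).trans_lt h1
    rw [abs_lt] at h2
    simp at h2
    linarith [h2.1]
  have hcc : Continuous c := by fun_prop
  set ψ : ℝ → ℂ := fun θ =>
    l (c θ) - Complex.log (F (c θ) / w θ) - (Real.log N - Complex.I * θ) with hψ
  have hψc : Continuous ψ := by
    have hwcont : Continuous w := by fun_prop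
    have : Continuous fun θ => Complex.log (F (c θ) / w θ) :=
      ((hF.comp hcc).div hwcont hw0).clog hslit
    fun_prop
  have hψe : ∀ θ, ∃ n : ℤ, ψ θ = n * (2 * Real.pi * Complex.I) := by
    intro θ
    rw [← Complex.exp_eq_one_iff, hψ]
    simp only
    rw [Complex.exp_sub, Complex.exp_sub, hl, Complex.exp_log (div_ne_zero (hne _) (hw0 θ))]
    change F (c θ) / (F (c θ) / w θ) / w θ = 1
    have := hw0 θ; have := hne (c θ)
    field_simp
  -- `ψ` takes discrete values, but the logarithm of `w` jumps by `2 π i` along the circle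
  have hjump : ψ (2 * Real.pi) = ψ 0 + 2 * Real.pi * Complex.I := by
    have h1 : c (2 * Real.pi) = c 0 := by simp [hc]
    have h2 : w (2 * Real.pi) = w 0 := by rw [← hwc, ← hwc, h1]
    simp only [hψ, h1, h2]
    push_cast
    ring
  have hpi := Real.pi_pos
  have hr : Continuous fun θ => (ψ θ).im / (2 * Real.pi) := by fun_prop
  have hint : ∀ θ, ∃ n : ℤ, (ψ θ).im / (2 * Real.pi) = n := by
    intro θ
    obtain ⟨n, hn⟩ := hψe θ
    refine ⟨n, ?_⟩
    rw [hn]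
    simp
  obtain ⟨n, hn⟩ := hint 0
  have hn' : (ψ (2 * Real.pi)).im / (2 * Real.pi) = n + 1 := by
    rw [hjump, ← hn]
    simp
    field_simp
  have := intermediate_value_Icc (by positivity : (0 : ℝ) ≤ 2 * Real.pi) hr.continuousOn
  simp only [hn, hn'] at this
  obtain ⟨θ, -, hθ⟩ := this (show (n + 1 / 2 : ℝ) ∈ Set.Icc (n : ℝ) (n + 1) by
    constructor <;> linarith)
  obtain ⟨k, hk⟩ := hint θ
  have h3 : (k : ℝ) = n + 1 / 2 := by rw [← hk]; exact hθ
  have h4 : (2 * k : ℤ) = 2 * n + 1 := by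
    have : (2 * k : ℝ) = 2 * n + 1 := by rw [h3]; ring
    exact_mod_cast this
  omega

/-- Two curves in the plane, one invariant under the horizontal and one under the vertical unit
translation, meet: their difference is a bounded perturbation of `(s, t) ↦ (s, -t)`. -/
theorem exists_eq_of_translates {α β : ℝ → ℝ × ℝ} (hα : Continuous α) (hβ : Continuous β)
    (h1 : ∀ s, α (s + 1) = α s + (1, 0)) (h2 : ∀ t, β (t + 1) = β t + (0, 1)) :
    ∃ s t, α s = β t := by
  obtain ⟨C₁, hC₁⟩ := Function.Periodic.exists_norm_le_of_continuous
    (u := fun s => α s - (s, 0)) (by fun_prop) (by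
      intro s; simp only [h1]; ext <;> simp)
  obtain ⟨C₂, hC₂⟩ := Function.Periodic.exists_norm_le_of_continuous
    (u := fun t => β t - (0, t)) (by fun_prop) (by
      intro s; simp only [h2]; ext <;> simp)
  obtain ⟨p, hp⟩ := exists_zero_of_bounded_sub
    (F := fun p => ((α p.1 - β p.2).1 : ℂ) + Complex.I * (α p.1 - β p.2).2) (by fun_prop)
    (C := 2 * (C₁ + C₂)) (by
      intro p
      set x := α p.1 - (p.1, 0) with hx
      set y := β p.2 - (0, p.2) with hy
      have e : ((α p.1 - β p.2).1 : ℂ) + Complex.I * (α p.1 - β p.2).2 -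
          (p.1 - Complex.I * p.2) = (x - y).1 + Complex.I * (x - y).2 := by
        simp [hx, hy]; ring
      rw [e]
      have hxy : ‖x - y‖ ≤ C₁ + C₂ := (norm_sub_le _ _).trans (add_le_add (hC₁ _) (hC₂ _))
      refine (norm_add_le _ _).trans ?_
      have ha := (norm_fst_le (x - y)).trans hxy
      have hb := (norm_snd_le (x - y)).trans hxy
      simp only [norm_mul, Complex.norm_I, one_mul, Complex.norm_real]
      linarith)
  refine ⟨p.1, p.2, ?_⟩
  have hre := congrArg Complex.re hp
  have him := congrArg Complex.im hp
  simp at hre him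
  ext <;> linarith

/-! ### Hyperbolic elements, their axes, and ping-pong -/

/-- The element of `SL₂(ℝ)` with given entries. -/
def sl2 (a b c d : ℝ) (h : a * d - b * c = 1) : SL(2, ℝ) :=
  ⟨!![a, b; c, d], by rw [Matrix.det_fin_two_of, h]⟩

section Entries

variable {a b c d : ℝ} (h : a * d - b * c = 1)

@[simp] theorem sl2_apply_zero_zero : sl2 a b c d h 0 0 = a := rfl
@[simp] theorem sl2_apply_zero_one : sl2 a b c d h 0 1 = b := rfl
@[simp] theorem sl2_apply_one_zero : sl2 a b c d h 1 0 = c := rfl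
@[simp] theorem sl2_apply_one_one : sl2 a b c d h 1 1 = d := rfl

end Entries

theorem SL2_ext {g h : SL(2, ℝ)} (h00 : g 0 0 = h 0 0) (h01 : g 0 1 = h 0 1)
    (h10 : g 1 0 = h 1 0) (h11 : g 1 1 = h 1 1) : g = h := by
  apply Matrix.SpecialLinearGroup.ext
  intro i j
  fin_cases i <;> fin_cases j <;> assumption

theorem SL2_mul_apply (g h : SL(2, ℝ)) (i j : Fin 2) :
    (g * h) i j = g i 0 * h 0 j + g i 1 * h 1 j := by
  rw [Matrix.SpecialLinearGroup.coe_mul, Matrix.mul_apply, Fin.sum_univ_two]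

theorem SL2_det (g : SL(2, ℝ)) : g 0 0 * g 1 1 - g 0 1 * g 1 0 = 1 := by
  have := g.det_coe
  rwa [Matrix.det_fin_two] at this

theorem SL2_trace_conj (g h : SL(2, ℝ)) :
    (g * h * g⁻¹) 0 0 + (g * h * g⁻¹) 1 1 = h 0 0 + h 1 1 := by
  have := Matrix.trace_mul_cycle (g : Matrix (Fin 2) (Fin 2) ℝ)
    (h : Matrix (Fin 2) (Fin 2) ℝ) ((g⁻¹ : SL(2, ℝ)) : Matrix (Fin 2) (Fin 2) ℝ)
  rw [← Matrix.SpecialLinearGroup.coe_mul, ← Matrix.SpecialLinearGroup.coe_mul,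
    ← Matrix.SpecialLinearGroup.coe_mul, ← Matrix.SpecialLinearGroup.coe_mul,
    inv_mul_cancel, one_mul, Matrix.trace_fin_two, Matrix.trace_fin_two] at this
  exact this

/-- The diagonal matrix with entries `μ` and `μ⁻¹`. -/
noncomputable def dilation (μ : ℝ) (hμ : μ ≠ 0) : SL(2, ℝ) :=
  sl2 μ 0 0 μ⁻¹ (by simp [hμ])

theorem coe_dilation_smul (μ : ℝ) (hμ : μ ≠ 0) (z : ℍ) :
    ((dilation μ hμ • z : ℍ) : ℂ) = (μ : ℂ) ^ 2 * z := by
  rw [UpperHalfPlane.coe_specialLinearGroup_apply]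
  have : (μ : ℂ) ≠ 0 := by exact_mod_cast hμ
  simp [dilation]
  field_simp

/-- An element of trace larger than `2` is diagonalizable. -/
theorem exists_conj_dilation (M : SL(2, ℝ)) (htr : 2 < M 0 0 + M 1 1) :
    ∃ (g : SL(2, ℝ)) (μ : ℝ) (hμ : 1 < μ), M = g * dilation μ (by positivity) * g⁻¹ := by
  have hdet := SL2_det M
  -- it suffices to find eigenvectors
  suffices h : ∃ (g : SL(2, ℝ)) (μ : ℝ) (hμ : 1 < μ), M * g = g * dilation μ (by positivity) by
    obtain ⟨g, μ, hμ, h⟩ := h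
    exact ⟨g, μ, hμ, by rw [← h, mul_inv_cancel_right]⟩
  by_cases hc : M 1 0 = 0
  · rw [hc, mul_zero, sub_zero] at hdet
    have hne : M 1 1 - M 0 0 ≠ 0 := by
      intro h
      nlinarith
    have h0 : 0 < M 0 0 := by nlinarith
    have h1 : M 1 1 = (M 0 0)⁻¹ := eq_inv_of_mul_eq_one_right hdet
    rcases le_or_gt (M 0 0) 1 with hle | hlt
    · have h2 : 1 < M 1 1 := by linarith
      have h0' : M 0 0 = (M 1 1)⁻¹ := eq_inv_of_mul_eq_one_left hdet
      refine ⟨sl2 (M 0 1 / (M 1 1 - M 0 0)) (-1) 1 0 (by ring), M 1 1, h2, ?_⟩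
      apply SL2_ext <;> rw [SL2_mul_apply, SL2_mul_apply] <;> simp [dilation, hc, ← h0']
      field_simp
      ring
    · refine ⟨sl2 1 (M 0 1 / (M 1 1 - M 0 0)) 0 1 (by ring), M 0 0, hlt, ?_⟩
      apply SL2_ext <;> rw [SL2_mul_apply, SL2_mul_apply] <;> simp [dilation, hc, ← h1]
      field_simp
      ring
  · set s := M 0 0 + M 1 1 with hs
    set r := √(s ^ 2 - 4) with hr
    have hr2 : r ^ 2 = s ^ 2 - 4 := Real.sq_sqrt (by nlinarith)
    have hr0 : 0 < r := Real.sqrt_pos.2 (by nlinarith)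
    set μ := (s + r) / 2 with hμdef
    have hμ : 1 < μ := by rw [hμdef]; linarith
    have hμi : μ⁻¹ = (s - r) / 2 := by
      refine inv_eq_of_mul_eq_one_right ?_
      rw [hμdef]
      linear_combination (-1 / 4) * hr2
    refine ⟨sl2 (μ - M 1 1) (((s - r) / 2 - M 1 1) / (M 1 0 * r)) (M 1 0) (1 / r) ?_,
      μ, hμ, ?_⟩
    · field_simp
      rw [hμdef]
      ring
    · apply SL2_ext <;> rw [SL2_mul_apply, SL2_mul_apply] <;> simp [dilation, hμi]
      · rw [hμdef]
        linear_combination (-1) * hdet - (1 / 4) * hr2 + (-(1 / 2) * s - (1 / 2) * r + M 1 1) * hs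
      · field_simp
        linear_combination (-4) * hdet - hr2
      · ring
      · field_simp
        ring

/-- In particular, a hyperbolic element preserves its axis. -/
theorem sq_axisForm_smul_self (M : SL(2, ℝ)) (z : ℍ) :
    axisForm M (M • z) ^ 2 = axisForm M z ^ 2 := by
  have h1 := two_mul_sinh_half_displacement_sq M z
  have h2 := two_mul_sinh_half_displacement_sq M (M • z)
  rw [dist_smul] at h2
  linarith

/-- A parametrized axis of a hyperbolic element. -/
theorem exists_axis (M : SL(2, ℝ)) (htr : 2 < M 0 0 + M 1 1) :
    ∃ β : ℝ → ℍ, Continuous β ∧ (∀ t, β (t + 1) = M • β t) ∧ ∀ t, axisForm M (β t) = 0 := by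
  obtain ⟨g, μ, hμ, rfl⟩ := exists_conj_dilation M htr
  have hμ0 : 0 < μ := by positivity
  set δ : ℝ → ℍ := fun t => ⟨⟨0, μ ^ (2 * t)⟩, by positivity⟩ with hδ
  have hδc : Continuous δ := by
    rw [UpperHalfPlane.isEmbedding_coe.continuous_iff]
    have : (UpperHalfPlane.coe ∘ δ) = fun t => ((μ ^ (2 * t) : ℝ) : ℂ) * Complex.I := by
      funext t
      apply Complex.ext <;> simp [hδ]
    rw [this]
    have : Continuous fun t : ℝ => μ ^ (2 * t) :=
      Continuous.rpow continuous_const (by fun_prop) (fun _ => Or.inl hμ0.ne')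
    fun_prop
  have hδ1 : ∀ t, δ (t + 1) = dilation μ hμ0.ne' • δ t := by
    intro t
    apply UpperHalfPlane.ext
    rw [coe_dilation_smul, ← Complex.ofReal_pow]
    apply Complex.ext
    · rw [Complex.re_ofReal_mul]; simp [hδ]
    · rw [Complex.im_ofReal_mul]
      simp only [hδ]
      rw [mul_add, Real.rpow_add hμ0, mul_comm]
      norm_num
  refine ⟨fun t => g • δ t, (continuous_const_smul g).comp hδc, fun t => ?_, fun t => ?_⟩
  · change g • δ (t + 1) = _
    rw [hδ1, mul_smul, mul_smul, inv_smul_smul]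
  · have h1 := two_mul_sinh_half_displacement_sq (g * dilation μ hμ0.ne' * g⁻¹) (g • δ t)
    have h2 := two_mul_sinh_half_displacement_sq (dilation μ hμ0.ne') (δ t)
    have h3 : (g * dilation μ hμ0.ne' * g⁻¹) • g • δ t = g • dilation μ hμ0.ne' • δ t := by
      rw [mul_smul, mul_smul, inv_smul_smul]
    rw [h3, dist_smul, h2] at h1
    have h4 : axisForm (dilation μ hμ0.ne') (δ t) = 0 := by
      simp [axisForm, dilation, hδ, UpperHalfPlane.re]
    rw [h4, SL2_trace_conj] at h1
    exact pow_eq_zero_iff two_ne_zero |>.1 (by linarith)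

section PingPong

variable {G X : Type*} [Group G] [MulAction G X] (φ : FreeGroup (Fin 2) →* G)

/-- Ping-pong: if the attracting sets `U` of the letters are disjoint, `HA` is invariant under the
first generator and avoids the attracting sets of the second one, and vice versa for `HB`, then
no translate of `HA` meets `HB`. -/
theorem smul_notMem_of_pingpong (U : Fin 2 × Bool → Set X) (HA HB : Set X)
    (hU : ∀ i b x, x ∉ U (i, !b) → φ (FreeGroup.mk [(i, b)]) • x ∈ U (i, b))
    (hdisj : ∀ a a', a ≠ a' → Disjoint (U a) (U a'))
    (hA : ∀ b, ∀ x ∈ HA, φ (FreeGroup.mk [(0, b)]) • x ∈ HA)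
    (hB : ∀ b, ∀ x ∈ HB, φ (FreeGroup.mk [(1, b)]) • x ∈ HB)
    (hAU : ∀ b, Disjoint HA (U (1, b))) (hBU : ∀ b, Disjoint HB (U (0, b)))
    (hAB : Disjoint HA HB) (g : FreeGroup (Fin 2)) {x : X} (hx : x ∈ HA) : φ g • x ∉ HB := by
  have hcons : ∀ (a : Fin 2 × Bool) (L : List (Fin 2 × Bool)),
      φ (FreeGroup.mk (a :: L)) • x = φ (FreeGroup.mk [a]) • φ (FreeGroup.mk L) • x := by
    intro a L
    rw [← mul_smul, ← map_mul, FreeGroup.mul_mk, List.singleton_append]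
  -- a reduced word moves `HA` into the attracting set of its first letter, unless all its letters
  -- belong to the first generator
  have key : ∀ L : List (Fin 2 × Bool), FreeGroup.IsReduced L →
      φ (FreeGroup.mk L) • x ∈ HA ∨
        ∃ a L', L = a :: L' ∧ φ (FreeGroup.mk L) • x ∈ U a := by
    intro L
    induction L with
    | nil =>
      intro _
      left
      rw [← FreeGroup.one_eq_mk, map_one, one_smul]
      exact hx
    | cons a L ih =>
      intro hL
      rw [hcons]
      rcases ih (hL.infix ⟨[a], [], by simp⟩) with h | ⟨a', L', rfl, h⟩
      · obtain ⟨i, b⟩ := a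
        fin_cases i
        · exact Or.inl (hA b _ h)
        · exact Or.inr ⟨_, _, rfl, hU 1 b _ fun h' => (hAU _).notMem_of_mem_left h h'⟩
      · obtain ⟨i, b⟩ := a
        refine Or.inr ⟨_, _, rfl, hU i b _ fun h' => ?_⟩
        refine (hdisj a' (i, !b) ?_).notMem_of_mem_left h h'
        rintro rfl
        have := (FreeGroup.isReduced_cons_cons.1 hL).1 rfl
        cases b <;> simp at this
  -- leading letters of the second generator may be cancelled, since they preserve `HB`
  have main : ∀ L : List (Fin 2 × Bool), FreeGroup.IsReduced L →
      φ (FreeGroup.mk L) • x ∉ HB := by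
    intro L
    induction L with
    | nil =>
      intro _
      rw [← FreeGroup.one_eq_mk, map_one, one_smul]
      exact hAB.notMem_of_mem_left hx
    | cons a L ih =>
      intro hL h
      obtain ⟨i, b⟩ := a
      fin_cases i
      · rcases key _ hL with h' | ⟨a', L', h1, h'⟩
        · exact hAB.notMem_of_mem_left h' h
        · obtain ⟨rfl, rfl⟩ := List.cons.inj h1
          exact (hBU b).notMem_of_mem_left h h'
      · refine ih (hL.infix ⟨[(1, b)], [], by simp⟩) ?_
        have h2 := hB (!b) _ h
        rw [hcons, ← mul_smul, ← map_mul] at h2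
        change φ (FreeGroup.mk [((1 : Fin 2), !b)] * FreeGroup.mk [(1, b)])  • _ ∈ HB at h2
        have h3 : FreeGroup.mk [((1 : Fin 2), !b)] * FreeGroup.mk [(1, b)] = 1 := by
          rw [← FreeGroup.inv_mk.trans (by simp [FreeGroup.invRev] :
            FreeGroup.mk (FreeGroup.invRev [((1 : Fin 2), b)]) = FreeGroup.mk [(1, !b)]),
            inv_mul_cancel]
        rwa [h3, map_one, one_smul] at h2
  simpa [FreeGroup.mk_toWord] using main g.toWord FreeGroup.isReduced_toWord

end PingPong

/-! ### The sign of the trace of the product of the generators -/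

/-- If `A`, `B` have traces larger than `2` and `A * B` has trace less than `-2`, as for the
holonomy of a pair of pants, then after a conjugation the axis of `A` is the imaginary axis and the
unit circle is a common perpendicular of the two axes, so that the off-diagonal entries of `B` are
opposite to each other. -/
theorem exists_pants_normal_form (A B : SL(2, ℝ)) (hA : 2 < A 0 0 + A 1 1)
    (hB : 2 < B 0 0 + B 1 1) (hAB : (A * B) 0 0 + (A * B) 1 1 < -2) :
    ∃ (g : SL(2, ℝ)) (l : ℝ) (hl : 1 < l) (p q t : ℝ) (h : p * t - q * -q = 1),
      A = g * dilation l (by positivity) * g⁻¹ ∧ B = g * sl2 p q (-q) t h * g⁻¹ ∧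
      p < 0 ∧ 0 < t ∧ 2 < p + t ∧ l * p + t / l < -2 := by
  obtain ⟨g, l, hl, rfl⟩ := exists_conj_dilation A hA
  have hl0 : 0 < l := by positivity
  obtain ⟨B', rfl⟩ : ∃ B', B = g * B' * g⁻¹ := ⟨g⁻¹ * B * g, by group⟩
  have h1 : g * dilation l hl0.ne' * g⁻¹ * (g * B' * g⁻¹) =
      g * (dilation l hl0.ne' * B') * g⁻¹ := by group
  rw [h1, SL2_trace_conj, SL2_mul_apply, SL2_mul_apply] at hAB
  rw [SL2_trace_conj] at hB
  simp only [dilation, sl2_apply_zero_zero, sl2_apply_zero_one, sl2_apply_one_zero,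
    sl2_apply_one_one, zero_mul, add_zero, zero_add] at hAB
  have hdet := SL2_det B'
  have hli : l⁻¹ * l = 1 := inv_mul_cancel₀ hl0.ne'
  have hlip : 0 < l⁻¹ := by positivity
  have hli1 : l⁻¹ < 1 := inv_lt_one_of_one_lt₀ hl
  have hp : B' 0 0 < 0 := by
    by_contra! hp
    nlinarith [mul_nonneg hp (sub_pos.2 (hli1.trans hl)).le]
  have ht : 0 < B' 1 1 := by linarith
  have hqr : B' 0 1 * B' 1 0 < 0 := by nlinarith
  have hr0 : B' 1 0 ≠ 0 := by rintro h; simp [h] at hqr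
  have hx : 0 < -B' 0 1 / B' 1 0 := by
    rw [neg_div, neg_pos, div_neg_iff]
    rcases mul_neg_iff.1 hqr with h | h
    · exact Or.inl h
    · exact Or.inr h
  -- conjugation by the dilation of parameter `k` multiplies and divides the off-diagonal entries by
  -- `k ^ 2`; the choice of `k` makes them opposite
  set m := √(-B' 0 1 / B' 1 0) with hm
  have hm0 : 0 < m := Real.sqrt_pos.2 hx
  have hm2 : m ^ 2 * B' 1 0 = -B' 0 1 := by
    rw [hm, Real.sq_sqrt hx.le]
    field_simp
  set k := √m with hk
  have hk0 : 0 < k := Real.sqrt_pos.2 hm0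
  have hk2 : k ^ 2 = m := Real.sq_sqrt hm0.le
  have e : k * k * B' 1 0 = -(B' 0 1 / (k * k)) := by
    rw [← pow_two, hk2]
    field_simp
    exact hm2
  have hdet' : B' 0 0 * B' 1 1 - B' 0 1 / (k * k) * -(B' 0 1 / (k * k)) = 1 := by
    rw [← e]
    refine Eq.trans ?_ hdet
    field_simp
  refine ⟨g * dilation k hk0.ne', l, hl, B' 0 0, B' 0 1 / (k * k), B' 1 1, hdet', ?_, ?_, hp, ht,
    hB, by rw [div_eq_inv_mul]; exact hAB⟩
  · have h2 : dilation k hk0.ne' * dilation l hl0.ne' =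
        dilation l hl0.ne' * dilation k hk0.ne' := by
      apply SL2_ext <;> rw [SL2_mul_apply, SL2_mul_apply] <;> simp [dilation, mul_comm]
    rw [mul_inv_rev, mul_assoc g (dilation k _), h2]
    group
  · have h2 : dilation k hk0.ne' * sl2 _ _ _ _ hdet' = B' * dilation k hk0.ne' := by
      apply SL2_ext <;> rw [SL2_mul_apply, SL2_mul_apply] <;> simp [dilation]
      · ring
      · field_simp
      · have := e
        field_simp at this ⊢
        linear_combination -this
      · ring
    rw [mul_inv_rev, mul_assoc g (dilation k _), h2]
    group

theorem coe_sl2_smul {a b c d : ℝ} (h : a * d - b * c = 1) (z : ℍ) :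
    ((sl2 a b c d h • z : ℍ) : ℂ) = ((a : ℂ) * z + b) / (c * z + d) := by
  rw [UpperHalfPlane.coe_specialLinearGroup_apply]
  rfl

set_option maxHeartbeats 1000000 in
/-- In the normal form of a pair of pants, no translate of the axis of the first generator meets
the axis of the second one. The attracting sets for the ping-pong are the half planes bounded by
the images of the unit circle, a common perpendicular of the two axes, under the square roots of
the generators and of their inverses. -/
theorem axes_disjoint_of_normal_form {l p q t : ℝ} (hl : 1 < l) (h : p * t - q * -q = 1)
    (hp : p < 0) (ht : 0 < t) (hpt : 2 < p + t) (hlpt : l * p + t / l < -2)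
    (φ : FreeGroup (Fin 2) →* SL(2, ℝ))
    (h0 : φ (FreeGroup.of 0) = dilation l (by positivity))
    (h1 : φ (FreeGroup.of 1) = sl2 p q (-q) t h) (g : FreeGroup (Fin 2)) {z : ℍ}
    (hz : axisForm (φ (FreeGroup.of 0)) z = 0) :
    axisForm (φ (FreeGroup.of 1)) (φ g • z) ≠ 0 := by
  have hl0 : 0 < l := by positivity
  have hlt : t < -(l * l * p) - 2 * l := by
    have := mul_lt_mul_of_pos_left hlpt hl0
    rw [mul_add, mul_div_cancel₀ _ hl0.ne'] at this
    linarith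
  have hq2 : q ^ 2 = 1 - p * t := by linarith
  set n : ℍ → ℝ := fun z => √(Complex.normSq z) with hn
  have hn0 : ∀ z, 0 < n z := fun z => Real.sqrt_pos.2 (Complex.normSq_pos.2 z.ne_zero)
  have hn2 : ∀ z, n z ^ 2 = Complex.normSq z := fun z => Real.sq_sqrt (Complex.normSq_nonneg _)
  have hxn : ∀ z : ℍ, z.re ^ 2 ≤ n z ^ 2 := by
    intro z
    rw [hn2, Complex.normSq_apply, UpperHalfPlane.coe_re]
    nlinarith [mul_self_nonneg (z : ℂ).im]
  have hlp : 2 < l * -p := by nlinarith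
  -- the functions whose nonpositivity defines the attracting sets of the second generator
  let f₁ : ℍ → ℝ := fun z => -p * n z ^ 2 - 2 * q * z.re + t
  let f₂ : ℍ → ℝ := fun z => t * n z ^ 2 - 2 * q * z.re - p
  -- they lie in the annulus `l⁻¹ < |z| < l`, one outside and one inside of the unit circle
  have hf₁ : ∀ z, f₁ z ≤ 0 → 1 < n z ∧ n z < l := by
    intro z hz
    have h1 : -p * n z ^ 2 + t ≤ 2 * q * z.re := by simp only [f₁] at hz; linarith
    have h2 : (-p * n z ^ 2 - t) ^ 2 ≤ (2 * n z) ^ 2 := by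
      have h3 : (-p * n z ^ 2 + t) ^ 2 ≤ (2 * q * z.re) ^ 2 :=
        pow_le_pow_left₀ (by nlinarith [sq_nonneg (n z)]) h1 2
      have h4 : q ^ 2 * z.re ^ 2 ≤ q ^ 2 * n z ^ 2 := mul_le_mul_of_nonneg_left (hxn z) (sq_nonneg q)
      rw [hq2] at h4
      nlinarith
    have h3 := abs_le_of_sq_le_sq' h2 (by linarith [hn0 z])
    have := hn0 z
    constructor
    · by_contra! hc
      have h4 : n z ^ 2 ≤ 1 := by nlinarith
      nlinarith
    · by_contra! hc
      have h4 : 2 ≤ -p * (n z + l) := by nlinarith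
      nlinarith [mul_nonneg (sub_nonneg.2 hc) (sub_nonneg.2 h4)]
  have hf₂ : ∀ z, f₂ z ≤ 0 → n z < 1 ∧ 1 < l * n z := by
    intro z hz
    have h1 : t * n z ^ 2 - p ≤ 2 * q * z.re := by simp only [f₂] at hz; linarith
    have h2 : (t * n z ^ 2 + p) ^ 2 ≤ (2 * n z) ^ 2 := by
      have h3 : (t * n z ^ 2 - p) ^ 2 ≤ (2 * q * z.re) ^ 2 :=
        pow_le_pow_left₀ (by nlinarith [sq_nonneg (n z)]) h1 2
      have h4 : q ^ 2 * z.re ^ 2 ≤ q ^ 2 * n z ^ 2 := mul_le_mul_of_nonneg_left (hxn z) (sq_nonneg q)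
      rw [hq2] at h4
      nlinarith
    have h3 := abs_le_of_sq_le_sq' h2 (by linarith [hn0 z])
    have := hn0 z
    constructor
    · by_contra! hc
      have h4 : 2 ≤ t * (n z + 1) := by nlinarith
      nlinarith [mul_nonneg (sub_nonneg.2 hc) (sub_nonneg.2 h4)]
    · by_contra! hc
      have h5 : (l * n z) ^ 2 ≤ 1 := by nlinarith [mul_pos hl0 this]
      have h6 : l * (l * n z) ≤ l := by nlinarith
      nlinarith
  have hA : ∀ z, n (φ (FreeGroup.of 0) • z) = l ^ 2 * n z := by
    intro z
    simp only [hn]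
    rw [h0, coe_dilation_smul, map_mul, ← Complex.ofReal_pow, Complex.normSq_ofReal,
      Real.sqrt_mul (mul_self_nonneg _), Real.sqrt_mul_self (by positivity)]
  -- the second generator maps the complement of `{f₁ ≤ 0}` into `{f₂ ≤ 0}`
  have hB : ∀ z, ∃ k > 0, f₂ (φ (FreeGroup.of 1) • z) * k = -f₁ z := by
    intro z
    have hden : (-q * z + t : ℂ) ≠ 0 := by
      intro h3
      have him := congrArg Complex.im h3
      have hre := congrArg Complex.re h3
      simp at him hre
      rcases him with him | him
      · simp [him] at hre; exact ht.ne' hre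
      · exact z.im_pos.ne' him
    have hk : 0 < Complex.normSq (-q * z + t : ℂ) := Complex.normSq_pos.2 hden
    refine ⟨_, hk, ?_⟩
    have hre : (φ (FreeGroup.of 1) • z).re * Complex.normSq (-q * z + t : ℂ) =
        -(p * q) * Complex.normSq z + (p * t - q ^ 2) * z.re + q * t := by
      rw [← UpperHalfPlane.coe_re, h1, coe_sl2_smul, Complex.div_re]
      push_cast
      rw [← add_div, div_mul_cancel₀ _ hk.ne', Complex.normSq_apply]
      simp
      ring
    have hnn : n (φ (FreeGroup.of 1) • z) ^ 2 * Complex.normSq (-q * z + t : ℂ) =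
        p ^ 2 * Complex.normSq z + 2 * p * q * z.re + q ^ 2 := by
      rw [hn2, h1, coe_sl2_smul, Complex.normSq_div]
      push_cast
      rw [div_mul_cancel₀ _ hk.ne', Complex.normSq_apply, Complex.normSq_apply]
      simp
      ring
    have hk2 : Complex.normSq (-q * z + t : ℂ) =
        q ^ 2 * Complex.normSq z - 2 * q * t * z.re + t ^ 2 := by
      rw [Complex.normSq_apply, Complex.normSq_apply]
      simp
      ring
    simp only [f₁, f₂]
    rw [hn2 z]
    have : (t * n (φ (FreeGroup.of 1) • z) ^ 2 - 2 * q * (φ (FreeGroup.of 1) • z).re - p) *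
        Complex.normSq (-q * z + t : ℂ) =
      t * (n (φ (FreeGroup.of 1) • z) ^ 2 * Complex.normSq (-q * z + t : ℂ)) -
        2 * q * ((φ (FreeGroup.of 1) • z).re * Complex.normSq (-q * z + t : ℂ)) -
        p * Complex.normSq (-q * z + t : ℂ) := by ring
    rw [this, hnn, hre, hk2]
    linear_combination (p * Complex.normSq z + 2 * q * z.re - t) * h
  -- the attracting sets of the letters
  let U : Fin 2 × Bool → Set ℍ := fun a =>
    match a with
    | (0, true) => {z | l ≤ n z}
    | (0, false) => {z | l * n z ≤ 1}
    | (1, true) => {z | f₂ z ≤ 0}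
    | (1, false) => {z | f₁ z ≤ 0}
  have hinv : ∀ i, φ (FreeGroup.mk [(i, false)]) = (φ (FreeGroup.of i))⁻¹ := by
    intro i
    rw [← map_inv]
    rfl
  have hinvar : ∀ i b, ∀ z ∈ {z | axisForm (φ (FreeGroup.of i)) z = 0},
      φ (FreeGroup.mk [(i, b)]) • z ∈ {z | axisForm (φ (FreeGroup.of i)) z = 0} := by
    intro i b z hz
    replace hz : axisForm (φ (FreeGroup.of i)) z = 0 := hz
    cases b
    · rw [hinv]
      have := sq_axisForm_smul_self (φ (FreeGroup.of i)) ((φ (FreeGroup.of i))⁻¹ • z)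
      rw [smul_inv_smul, hz] at this
      exact pow_eq_zero_iff two_ne_zero |>.1 (by rw [← this]; simp)
    · have := sq_axisForm_smul_self (φ (FreeGroup.of i)) z
      rw [hz] at this
      exact pow_eq_zero_iff two_ne_zero |>.1 (this.trans (by simp))
  have hHA : ∀ z, axisForm (φ (FreeGroup.of 0)) z = 0 → z.re = 0 := by
    intro z hz
    rw [h0] at hz
    simp only [axisForm, dilation, sl2_apply_zero_zero, sl2_apply_zero_one, sl2_apply_one_zero,
      sl2_apply_one_one, div_eq_zero_iff, z.im_pos.ne', or_false] at hz
    have : l⁻¹ < 1 := inv_lt_one_of_one_lt₀ hl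
    rcases mul_eq_zero.1 (show (l⁻¹ - l) * z.re = 0 by linarith) with h3 | h3
    · linarith
    · exact h3
  have hHB : ∀ z, axisForm (φ (FreeGroup.of 1)) z = 0 → q * (n z ^ 2 + 1) = (t - p) * z.re := by
    intro z hz
    rw [h1] at hz
    simp only [axisForm, sl2_apply_zero_zero, sl2_apply_zero_one, sl2_apply_one_zero,
      sl2_apply_one_one, div_eq_zero_iff, z.im_pos.ne', or_false] at hz
    rw [hn2, Complex.normSq_apply, UpperHalfPlane.coe_re, UpperHalfPlane.coe_im]
    linarith
  -- the axis of the second generator lies in the annulus `l⁻¹ < |z| < l`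
  have hHBl : ∀ z, axisForm (φ (FreeGroup.of 1)) z = 0 → (n z - l) * (n z * l - 1) < 0 := by
    intro z hz
    have h2 := hHB z hz
    by_contra! hc
    have h3 : (q * (n z ^ 2 + 1)) ^ 2 ≤ ((t - p) * n z) ^ 2 := by
      rw [h2, mul_pow, mul_pow]
      exact mul_le_mul_of_nonneg_left (hxn z) (sq_nonneg _)
    have h4 : 0 < q ^ 2 * (l ^ 2 + 1) ^ 2 - (t - p) ^ 2 * l ^ 2 := by
      have : q ^ 2 * (l ^ 2 + 1) ^ 2 - (t - p) ^ 2 * l ^ 2 =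
          (l ^ 2 + 1) ^ 2 + (-p * l ^ 2 - t) * (t * l ^ 2 + p) := by rw [hq2]; ring
      rw [this]
      have h5 : 0 < -p * l ^ 2 - t := by nlinarith
      have h6 : 0 < t * l ^ 2 + p := by nlinarith
      positivity
    have h5 : (l ^ 2 + 1) * n z ≤ (n z ^ 2 + 1) * l := by linarith
    have h6 : ((l ^ 2 + 1) * n z) ^ 2 ≤ ((n z ^ 2 + 1) * l) ^ 2 :=
      pow_le_pow_left₀ (by have := hn0 z; positivity) h5 2
    have h7 := mul_le_mul_of_nonneg_left h6 (sq_nonneg q)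
    have h8 := mul_le_mul_of_nonneg_right h3 (sq_nonneg l)
    have h9 := mul_pos h4 (pow_pos (hn0 z) 2)
    nlinarith
  refine smul_notMem_of_pingpong φ U {z | axisForm (φ (FreeGroup.of 0)) z = 0}
    {z | axisForm (φ (FreeGroup.of 1)) z = 0} ?_ ?_ (hinvar 0) (hinvar 1) ?_ ?_ ?_ g hz
  · intro i b z hz
    fin_cases i <;> cases b
    · change ¬ l ≤ n z at hz
      change l * n (φ (FreeGroup.mk [(0, false)]) • z) ≤ 1
      rw [hinv]
      have := hA ((φ (FreeGroup.of 0))⁻¹ • z)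
      rw [smul_inv_smul] at this
      nlinarith
    · change ¬ l * n z ≤ 1 at hz
      change l ≤ n (φ (FreeGroup.of 0) • z)
      rw [hA]
      nlinarith
    · change ¬ f₂ z ≤ 0 at hz
      change f₁ (φ (FreeGroup.mk [(1, false)]) • z) ≤ 0
      rw [hinv]
      obtain ⟨k, hk, h3⟩ := hB ((φ (FreeGroup.of 1))⁻¹ • z)
      rw [smul_inv_smul] at h3
      nlinarith
    · change ¬ f₁ z ≤ 0 at hz
      change f₂ (φ (FreeGroup.of 1) • z) ≤ 0
      obtain ⟨k, hk, h3⟩ := hB z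
      by_contra! h4
      nlinarith
  · have k00 : ∀ z, z ∈ U (0, false) → l * n z ≤ 1 ∧ n z < 1 := fun z hz => by
      replace hz : l * n z ≤ 1 := hz
      exact ⟨hz, by nlinarith [hn0 z]⟩
    have k01 : ∀ z, z ∈ U (0, true) → l ≤ n z ∧ 1 < n z := fun z hz => ⟨hz, hl.trans_le hz⟩
    have key : ∀ z, ∀ a a', z ∈ U a → z ∈ U a' → a = a' := by
      rintro z ⟨i, b⟩ ⟨i', b'⟩ ha ha'
      have h00 := k00 z
      have h01 := k01 z
      have h10 := hf₁ z
      have h11 := hf₂ z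
      by_contra hne
      fin_cases i <;> cases b <;> fin_cases i' <;> cases b' <;>
        first
        | exact hne rfl
        | (have e := h00 ha; clear h00; first
            | linarith [h01 ha'] | linarith [h10 ha'] | linarith [h11 ha'])
        | (have e := h01 ha; clear h01; first
            | linarith [h00 ha'] | linarith [h10 ha'] | linarith [h11 ha'])
        | (have e := h10 ha; clear h10; first
            | linarith [h00 ha'] | linarith [h01 ha'] | linarith [h11 ha'])
        | (have e := h11 ha; clear h11; first
            | linarith [h00 ha'] | linarith [h01 ha'] | linarith [h10 ha'])
    intro a a' hne
    rw [Set.disjoint_left]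
    exact fun z hz hz' => hne (key z a a' hz hz')
  · intro b
    rw [Set.disjoint_left]
    intro z hz hz'
    have hre := hHA z hz
    cases b
    · change -p * n z ^ 2 - 2 * q * z.re + t ≤ 0 at hz'
      rw [hre, mul_zero, sub_zero] at hz'
      nlinarith [mul_pos (neg_pos.2 hp) (pow_pos (hn0 z) 2)]
    · change t * n z ^ 2 - 2 * q * z.re - p ≤ 0 at hz'
      rw [hre, mul_zero, sub_zero] at hz'
      nlinarith [mul_pos ht (pow_pos (hn0 z) 2)]
  · intro b
    rw [Set.disjoint_left]
    intro z hz hz'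
    have h3 := hHBl z hz
    have := hn0 z
    cases b
    · change l * n z ≤ 1 at hz'
      have h4 : n z ≤ l := by nlinarith
      exact h3.not_ge (mul_nonneg_of_nonpos_of_nonpos (by linarith) (by linarith))
    · change l ≤ n z at hz'
      have h4 : 1 ≤ n z * l := by nlinarith
      exact h3.not_ge (mul_nonneg (by linarith) (by linarith))
  · rw [Set.disjoint_left]
    intro z hz hz'
    have h3 := hHA z hz
    have h4 := hHB z hz'
    rw [h3, mul_zero] at h4
    rcases mul_eq_zero.1 h4 with h5 | h5
    · rw [h5] at hq2
      nlinarith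
    · nlinarith [sq_nonneg (n z)]

/-- In a lift to `SL₂(ℝ)` of the holonomy of a hyperbolic structure on the one-holed torus, if the
generators have traces larger than `2`, then their product does not have trace less than `-2`:
otherwise the axes of the two generators would have disjoint projections to the quotient surface,
while their images in `ℝ² ∖ ℤ²` are invariant under the horizontal and the vertical unit
translation, and hence meet. -/
theorem neg_two_le_trace_mul_of_isHolonomy {ρ : TorusGroup →* PSL2R} (hρ : IsHolonomy ρ)
    (φ : TorusGroup →* SL(2, ℝ)) (hφ : ∀ g, (QuotientGroup.mk (φ g) : PSL2R) = ρ g)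
    (hA : 2 < φ (FreeGroup.of 0) 0 0 + φ (FreeGroup.of 0) 1 1)
    (hB : 2 < φ (FreeGroup.of 1) 0 0 + φ (FreeGroup.of 1) 1 1) :
    -2 ≤ φ (FreeGroup.of 0 * FreeGroup.of 1) 0 0 + φ (FreeGroup.of 0 * FreeGroup.of 1) 1 1 := by
  by_contra! hlt
  rw [map_mul] at hlt
  obtain ⟨-, f, hf, -, hfA, hfB, hfib⟩ := hρ
  obtain ⟨k, l, hl, p, q, t, h, hAk, hBk, hp, ht, hpt, hlpt⟩ :=
    exists_pants_normal_form _ _ hA hB hlt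
  obtain ⟨α, hαc, hα1, hα⟩ := exists_axis _ hA
  obtain ⟨β, hβc, hβ1, hβ⟩ := exists_axis _ hB
  have hmob : ∀ g z, mobius (ρ g) z = φ g • z := by
    intro g z
    rw [← hφ, mobius_mk]
  obtain ⟨s, u, hsu⟩ := exists_eq_of_translates (α := fun s => (f (α s)).1)
    (β := fun s => (f (β s)).1)
    (continuous_subtype_val.comp (hf.continuous.comp hαc))
    (continuous_subtype_val.comp (hf.continuous.comp hβc))
    (fun s => by rw [hα1, ← hmob, hfA]) (fun s => by rw [hβ1, ← hmob, hfB])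
  obtain ⟨g, hg⟩ := (hfib (α s) (β u)).1 ⟨0, 0, by simp [← hsu]⟩
  rw [hmob] at hg
  -- conjugate everything to the normal form
  have hconj : ∀ M z, axisForm (k⁻¹ * M * k) (k⁻¹ • z) ^ 2 = axisForm M z ^ 2 := by
    intro M z
    have e1 := two_mul_sinh_half_displacement_sq M z
    have e2 := two_mul_sinh_half_displacement_sq (k⁻¹ * M * k) (k⁻¹ • z)
    rw [mul_smul, smul_inv_smul, mul_smul, dist_smul] at e2
    have e3 := SL2_trace_conj k⁻¹ M
    rw [inv_inv] at e3
    rw [e3] at e2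
    linarith
  let ψ : FreeGroup (Fin 2) →* SL(2, ℝ) := (MulAut.conj k⁻¹).toMonoidHom.comp φ
  have hψ : ∀ g, ψ g = k⁻¹ * φ g * k := by
    intro g
    simp [ψ]
  refine axes_disjoint_of_normal_form hl h hp ht hpt hlpt ψ ?_ ?_ g (z := k⁻¹ • α s) ?_ ?_
  · rw [hψ, hAk]; group
  · rw [hψ, hBk]; group
  · rw [hψ]
    have := hconj (φ (FreeGroup.of 0)) (α s)
    rw [hα] at this
    exact pow_eq_zero_iff two_ne_zero |>.1 (this.trans (by simp))
  · rw [hψ, hψ, mul_smul (k⁻¹ * φ g), smul_inv_smul, mul_smul, ← hg]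
    have := hconj (φ (FreeGroup.of 1)) (β u)
    rw [hβ] at this
    exact pow_eq_zero_iff two_ne_zero |>.1 (this.trans (by simp))

/-! ### Words and traces of simple closed curves -/

/-- The word in the generators that spells the crossings of a line of slope `p / q`. -/
def slopeWord (p : ℤ) (q : ℕ) : TorusGroup :=
  ((List.range q).map fun k : ℕ =>
    FreeGroup.of 0 * FreeGroup.of 1 ^ (((k : ℤ) + 1) * p / q - (k : ℤ) * p / q)).prod

theorem slopeCurve_coe (r : ℚ) : slopeCurve (r : OnePoint ℚ) = slopeWord r.num r.den := by
  change ((List.range r.den).map fun k : ℕ =>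
      FreeGroup.of 0 * FreeGroup.of 1 ^ (⌊((k : ℚ) + 1) * r⌋ - ⌊(k : ℚ) * r⌋)).prod = _
  have h : ∀ m : ℤ, ⌊(m : ℚ) * r⌋ = m * r.num / r.den := by
    intro m
    rw [← Rat.floor_intCast_div_natCast]
    congr 1
    push_cast
    rw [mul_div_assoc, Rat.num_div_den]
  rw [slopeWord]
  congr 2
  funext k
  have h1 := h (k + 1)
  have h2 := h k
  push_cast at h1 h2
  rw [h1, h2]

theorem slopeWord_one (p : ℤ) : slopeWord p 1 = FreeGroup.of 0 * FreeGroup.of 1 ^ p := by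
  simp [slopeWord]

/-- The word of the mediant of two Farey neighbours is the product of their words. -/
theorem slopeWord_add {p p' : ℤ} {q q' : ℕ} (hq : 0 < q) (hq' : 0 < q')
    (h : p' * q - p * q' = 1) :
    slopeWord (p + p') (q + q') = slopeWord p q * slopeWord p' q' := by
  have hQ : (0 : ℤ) < q := by exact_mod_cast hq
  have hQ' : (0 : ℤ) < q' := by exact_mod_cast hq'
  -- up to the abscissa `q` the line of the mediant slope and the line of slope `p / q` cross the
  -- same horizontal arcs, and from there on so do the former and a translate of the line of the
  -- other slope
  have e1 : ∀ k : ℤ, 0 ≤ k → k ≤ q → k * (p + p') / ((q + q' : ℕ) : ℤ) = k * p / q := by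
    intro k hk hkq
    have h1 := Int.mul_ediv_add_emod (k * p) q
    have h2 := Int.emod_nonneg (k * p) hQ.ne'
    have h3 := Int.emod_lt_of_pos (k * p) hQ
    generalize k * p / q = y at *
    generalize k * p % q = r at *
    rw [Int.ediv_eq_iff_of_pos (by positivity)]
    have h4 : q * (k * (p + p') - y * (q + q')) = r * (q + q') + k := by
      linear_combination (-(q + q' : ℤ)) * h1 + k * h
    push_cast
    constructor
    · have : 0 ≤ q * (k * (p + p') - y * (q + q')) := by rw [h4]; positivity
      have := nonneg_of_mul_nonneg_right this hQ
      linarith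
    · have : q * (k * (p + p') - y * (q + q')) < q * (q + q') := by
        rw [h4]
        nlinarith
      have := lt_of_mul_lt_mul_left this hQ.le
      linarith
  have e2 : ∀ j : ℤ, 0 ≤ j → j ≤ q' →
      (q + j) * (p + p') / ((q + q' : ℕ) : ℤ) = p + j * p' / q' := by
    intro k hk hkq
    have h1 := Int.mul_ediv_add_emod (k * p') q'
    have h2 := Int.emod_nonneg (k * p') hQ'.ne'
    have h3 := Int.emod_lt_of_pos (k * p') hQ'
    generalize k * p' / q' = y at *
    generalize k * p' % q' = r at *
    rw [Int.ediv_eq_iff_of_pos (by positivity)]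
    have h4 : q' * ((q + k) * (p + p') - (p + y) * (q + q')) = r * (q + q') + (q' - k) := by
      linear_combination (-(q + q' : ℤ)) * h1 + (q' - k) * h
    push_cast
    constructor
    · have : 0 ≤ q' * ((q + k) * (p + p') - (p + y) * (q + q')) := by
        rw [h4]
        have : 0 ≤ (q' : ℤ) - k := by linarith
        positivity
      have := nonneg_of_mul_nonneg_right this hQ'
      linarith
    · have : q' * ((q + k) * (p + p') - (p + y) * (q + q')) < q' * (q + q') := by
        rw [h4]
        nlinarith
      have := lt_of_mul_lt_mul_left this hQ'.le
      linarith
  unfold slopeWord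
  rw [List.range_add, List.map_append, List.prod_append, List.map_map]
  congr 2
  · refine List.map_congr_left fun k hk => ?_
    have hk : k < q := List.mem_range.1 hk
    rw [e1 k (by positivity) (by exact_mod_cast hk.le),
      e1 (k + 1) (by positivity) (by exact_mod_cast hk)]
  · refine List.map_congr_left fun k hk => ?_
    have hk : k < q' := List.mem_range.1 hk
    have h1 := e2 k (by positivity) (by exact_mod_cast hk.le)
    have h2 := e2 (k + 1) (by positivity) (by exact_mod_cast hk)
    simp only [Function.comp_apply]
    rw [← add_assoc] at h2
    rw [Nat.cast_add q k, h1, h2]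
    congr 2
    ring

/-- The trace of an element of `SL₂(ℝ)`. -/
def sltr (g : SL(2, ℝ)) : ℝ := g 0 0 + g 1 1

theorem sltr_conj (g h : SL(2, ℝ)) : sltr (g * h * g⁻¹) = sltr h := SL2_trace_conj g h

theorem sltr_inv (g : SL(2, ℝ)) : sltr g⁻¹ = sltr g := by
  rw [sltr, sltr, Matrix.SpecialLinearGroup.SL2_inv_expl]
  simp [add_comm]

/-- The trace identity from which all trace relations of the simple closed curves follow. -/
theorem sltr_mul_add (g h : SL(2, ℝ)) : sltr (g * h) + sltr (g * h⁻¹) = sltr g * sltr h := by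
  simp only [sltr, SL2_mul_apply]
  rw [Matrix.SpecialLinearGroup.SL2_inv_expl]
  simp
  ring

/-- The trace relations along the Farey graph: slopes are encoded by pairs (denominator,
numerator) up to sign. -/
structure IsMarkov (t : ℤ × ℤ → ℝ) : Prop where
  even : ∀ v, t (-v) = t v
  add_sub : ∀ u w : ℤ × ℤ, u.1 * w.2 - u.2 * w.1 = 1 → t (u + w) + t (u - w) = t u * t w

/-- The slope of a vector (denominator, numerator); it is `∞` if the denominator vanishes. -/
def slopeOf (v : ℤ × ℤ) : OnePoint ℚ :=
  if v.1 = 0 then OnePoint.infty else (((v.2 : ℚ) / v.1 : ℚ) : OnePoint ℚ)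

theorem slopeOf_neg (v : ℤ × ℤ) : slopeOf (-v) = slopeOf v := by
  simp [slopeOf, neg_div_neg_eq]

theorem slopeCurve_infty : slopeCurve OnePoint.infty = FreeGroup.of 1 := rfl

theorem slopeCurve_slopeOf {p : ℤ} {q : ℕ} (hq : 0 < q) (h : IsCoprime p q) :
    slopeCurve (slopeOf ((q : ℤ), p)) = slopeWord p q := by
  have h0 : ((q : ℤ)) ≠ 0 := by exact_mod_cast hq.ne'
  simp only [slopeOf, h0, if_false]
  rw [slopeCurve_coe]
  have hc : p.natAbs.Coprime q := by
    have := Int.isCoprime_iff_gcd_eq_one.1 h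
    simpa [Int.gcd] using this
  have : ((p : ℚ) / ((q : ℤ) : ℚ)) = ⟨p, q, hq.ne', hc⟩ := by
    rw [Rat.mk_eq_divInt, Rat.divInt_eq_div]
  rw [this]

section Trace

variable (φ : TorusGroup →* SL(2, ℝ))

/-- The trace of the simple closed curve of given slope. -/
def slopeTrace (v : ℤ × ℤ) : ℝ := sltr (φ (slopeCurve (slopeOf v)))

theorem slopeTrace_neg (v : ℤ × ℤ) : slopeTrace φ (-v) = slopeTrace φ v := by
  rw [slopeTrace, slopeOf_neg, slopeTrace]

theorem slopeTrace_eq {p q : ℤ} (hq : 0 < q) (h : IsCoprime p q) :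
    slopeTrace φ (q, p) = sltr (φ (slopeWord p q.toNat)) := by
  lift q to ℕ using hq.le
  rw [slopeTrace, slopeCurve_slopeOf (by exact_mod_cast hq) h, Int.toNat_natCast]

theorem slopeTrace_zero {p : ℤ} : slopeTrace φ (0, p) = sltr (φ (FreeGroup.of 1)) := by
  simp [slopeTrace, slopeOf, slopeCurve_infty]

theorem slopeWord_add' {p p' q q' : ℤ} (hq : 0 < q) (hq' : 0 < q') (h : q * p' - p * q' = 1) :
    slopeWord (p + p') (q + q').toNat = slopeWord p q.toNat * slopeWord p' q'.toNat := by
  lift q to ℕ using hq.le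
  lift q' to ℕ using hq'.le
  rw [← Nat.cast_add, Int.toNat_natCast, Int.toNat_natCast, Int.toNat_natCast]
  exact slopeWord_add (by exact_mod_cast hq) (by exact_mod_cast hq') (by linarith)

theorem slopeTrace_add_sub_of_pos {p p' q q' : ℤ} (hq : 0 < q) (hq' : 0 < q')
    (h : q * p' - p * q' = 1) :
    slopeTrace φ (q + q', p + p') + slopeTrace φ (q - q', p - p') =
      slopeTrace φ (q, p) * slopeTrace φ (q', p') := by
  have hc : IsCoprime p q := ⟨-q', p', by linarith⟩
  have hc' : IsCoprime p' q' := ⟨q, -p, by linarith⟩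
  have hs : IsCoprime (p + p') (q + q') := ⟨-q', p', by linarith⟩
  rw [slopeTrace_eq φ hq hc, slopeTrace_eq φ hq' hc', slopeTrace_eq φ (by positivity) hs,
    slopeWord_add' hq hq' h, map_mul, ← sltr_mul_add]
  congr 1
  rcases lt_trichotomy q q' with hlt | rfl | hlt
  · have h1 : slopeTrace φ (q - q', p - p') = slopeTrace φ (q' - q, p' - p) := by
      rw [← slopeTrace_neg]; simp
    rw [h1, slopeTrace_eq φ (by linarith) (⟨q, -p, by linarith⟩ : IsCoprime (p' - p) (q' - q))]
    have h2 := slopeWord_add' hq (sub_pos.2 hlt) (p := p) (p' := p' - p) (by linarith)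
    rw [add_sub_cancel, add_sub_cancel] at h2
    rw [h2, map_mul, mul_inv_rev, ← mul_assoc, sltr_conj, sltr_inv]
  · have h1 : q * (p' - p) = 1 := by linarith
    have h2 : q = 1 := Int.eq_one_of_mul_eq_one_right hq.le h1
    subst h2
    have h3 : p' = p + 1 := by linarith
    rw [sub_self, slopeTrace_zero, h3, Int.toNat_one, slopeWord_one, slopeWord_one]
    have : FreeGroup.of (0 : Fin 2) * FreeGroup.of 1 ^ p * (FreeGroup.of 0 * FreeGroup.of 1 ^ (p + 1))⁻¹ =
        FreeGroup.of 0 * (FreeGroup.of 1)⁻¹ * (FreeGroup.of 0)⁻¹ := by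
      group
    rw [← map_inv, ← map_mul, this, map_mul, map_mul, map_inv, map_inv, sltr_conj, sltr_inv]
  · rw [slopeTrace_eq φ (by linarith) (⟨-q', p', by linarith⟩ : IsCoprime (p - p') (q - q'))]
    have h2 := slopeWord_add' (sub_pos.2 hlt) hq' (p := p - p') (p' := p') (by linarith)
    rw [sub_add_cancel, sub_add_cancel] at h2
    rw [h2, map_mul, mul_inv_cancel_right]

theorem slopeTrace_add_sub_one (n : ℤ) :
    slopeTrace φ (1, n + 1) + slopeTrace φ (1, n - 1) =
      slopeTrace φ (1, n) * slopeTrace φ (0, 1) := by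
  have h : ∀ m, slopeTrace φ (1, m) = sltr (φ (FreeGroup.of 0 * FreeGroup.of 1 ^ m)) := by
    intro m
    rw [slopeTrace_eq φ one_pos isCoprime_one_right, Int.toNat_one, slopeWord_one]
  rw [h, h, h, slopeTrace_zero, ← sltr_mul_add, ← map_mul, ← map_inv, ← map_mul,
    zpow_add_one, zpow_sub_one, mul_assoc, mul_assoc]

theorem slopeTrace_add_sub_of_nonneg {u w : ℤ × ℤ} (hu : 0 ≤ u.1) (hw : 0 ≤ w.1)
    (h : u.1 * w.2 - u.2 * w.1 = 1) :
    slopeTrace φ (u + w) + slopeTrace φ (u - w) = slopeTrace φ u * slopeTrace φ w := by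
  obtain ⟨q, p⟩ := u
  obtain ⟨q', p'⟩ := w
  simp only at hu hw h
  rcases hu.eq_or_lt with rfl | hq
  · have h1 : q' * -p = 1 := by linarith
    obtain rfl : q' = 1 := Int.eq_one_of_mul_eq_one_right hw h1
    obtain rfl : p = -1 := by linarith
    have := slopeTrace_add_sub_one φ p'
    simp only [Prod.mk_add_mk, Prod.mk_sub_mk, slopeTrace_zero, zero_add, zero_sub] at this ⊢
    have e : slopeTrace φ (-1, -1 - p') = slopeTrace φ (1, p' + 1) := by
      rw [← slopeTrace_neg]
      congr 1
      ext <;> simp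
    rw [e, neg_add_eq_sub, add_comm, this, mul_comm]
  · rcases hw.eq_or_lt with rfl | hq'
    · have h1 : q * p' = 1 := by linarith
      obtain rfl : q = 1 := Int.eq_one_of_mul_eq_one_right hq.le h1
      obtain rfl : p' = 1 := by linarith
      simpa using slopeTrace_add_sub_one φ p
    · exact slopeTrace_add_sub_of_pos φ hq hq' h

theorem isMarkov_slopeTrace : IsMarkov (slopeTrace φ) where
  even := slopeTrace_neg φ
  add_sub := by
    intro u w h
    have hneg : ∀ x y : ℤ × ℤ, slopeTrace φ (x - y) = slopeTrace φ (y - x) := by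
      intro x y
      rw [← slopeTrace_neg, neg_sub]
    rcases le_total 0 u.1 with hu | hu <;> rcases le_total 0 w.1 with hw | hw
    · exact slopeTrace_add_sub_of_nonneg φ hu hw h
    · have := slopeTrace_add_sub_of_nonneg φ (u := -w) (w := u) (by simpa using hw) hu
        (by simp; linarith)
      rw [slopeTrace_neg, neg_add_eq_sub] at this
      rw [← slopeTrace_neg φ (-w - u)] at this
      have e : -(-w - u) = u + w := by abel
      rw [e] at this
      linarith
    · have := slopeTrace_add_sub_of_nonneg φ (u := w) (w := -u) hw (by simpa using hu)
        (by simp; linarith)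
      rw [slopeTrace_neg, ← sub_eq_add_neg, sub_neg_eq_add, add_comm w u, hneg] at this
      linarith
    · have := slopeTrace_add_sub_of_nonneg φ (u := -u) (w := -w) (by simpa using hu)
        (by simpa using hw) (by simp; linarith)
      rw [slopeTrace_neg, slopeTrace_neg, ← neg_add, slopeTrace_neg, neg_sub_neg, hneg] at this
      exact this

end Trace

/-! ### The defect of a Farey triple -/

/-- The lengths `x`, `y` and `z` are half the lengths of two simple closed curves that meet once
and of the longer of the two curves obtained by resolving their intersection; the trace of the
boundary curve is `2 - 4 * κ`. The difference `x + y - z` is called the defect of the triple. -/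
structure FareyTriple (κ x y z : ℝ) : Prop where
  one_le_x : 1 ≤ x
  one_le_y : 1 ≤ y
  z_pos : 0 < z
  κ_pos : 0 < κ
  κ_le : 2 * κ ≤ (Real.sinh x * Real.sinh y) ^ 2
  cosh_z : Real.cosh z = Real.cosh x * Real.cosh y + √((Real.sinh x * Real.sinh y) ^ 2 - κ)

theorem Real.cosh_add_sub_cosh_sub (x y : ℝ) :
    Real.cosh (x + y) - Real.cosh (x - y) = 2 * Real.sinh x * Real.sinh y := by
  rw [Real.cosh_add, Real.cosh_sub]; ring

theorem Real.exp_div_four_le_sinh {x : ℝ} (hx : 1 ≤ x) : Real.exp x / 4 ≤ Real.sinh x := by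
  rw [Real.sinh_eq]
  have h1 : Real.exp (-x) ≤ 1 := Real.exp_le_one_iff.2 (by linarith)
  have h2 : 1 + x ≤ Real.exp x := by linarith [Real.add_one_le_exp x]
  linarith

theorem Real.sinh_le_exp_mul_sinh {x y : ℝ} (hx : 1 ≤ x) (hxy : x ≤ y) :
    Real.sinh y ≤ Real.exp (2 * (y - x)) * Real.sinh x := by
  obtain ⟨d, rfl⟩ : ∃ d, y = x + d := ⟨y - x, by ring⟩
  have hd : 0 ≤ d := by linarith
  have h1 : Real.cosh x ≤ 2 * Real.sinh x := by
    have := Real.exp_div_four_le_sinh hx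
    have h3 : Real.exp (-x) ≤ 1 := Real.exp_le_one_iff.2 (by linarith)
    have h2 : 1 + x ≤ Real.exp x := by linarith [Real.add_one_le_exp x]
    have h4 : 2 < Real.exp 1 := by have := Real.exp_one_gt_d9; linarith
    have h5 : Real.exp (-x) ≤ 1 / 2 := by
      have : Real.exp (-x) ≤ Real.exp (-1) := Real.exp_le_exp.2 (by linarith)
      rw [Real.exp_neg 1] at this
      refine this.trans ?_
      rw [inv_le_comm₀ (by positivity) (by norm_num)]
      linarith
    have h6 : 2 < Real.exp x := h4.trans_le (Real.exp_le_exp.2 hx)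
    rw [Real.cosh_eq, Real.sinh_eq]
    linarith
  have h2 : 0 ≤ Real.sinh d := Real.sinh_nonneg_iff.2 hd
  have h3 : 1 ≤ Real.cosh d := Real.one_le_cosh d
  have h4 : 0 < Real.sinh x := Real.sinh_pos_iff.2 (by linarith)
  have h5 : Real.exp (2 * (x + d - x)) = (Real.cosh d + Real.sinh d) ^ 2 := by
    rw [Real.cosh_add_sinh, ← Real.exp_nat_mul]
    congr 1
    push_cast
    ring
  rw [h5, Real.sinh_add]
  have h6 : Real.cosh d + 2 * Real.sinh d ≤ (Real.cosh d + Real.sinh d) ^ 2 := by nlinarith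
  nlinarith [mul_le_mul_of_nonneg_right h6 h4.le]

namespace FareyTriple

variable {κ x y z x' y' z' : ℝ}

/-- The equation of the triple, solved for the defect. The right-hand side is called the gap. -/
theorem two_mul_sinh_mul_sinh (h : FareyTriple κ x y z) :
    2 * Real.sinh ((x + y + z) / 2) * Real.sinh ((x + y - z) / 2) =
      Real.sinh x * Real.sinh y - √((Real.sinh x * Real.sinh y) ^ 2 - κ) := by
  rw [← Real.cosh_add_sub_cosh_sub]
  have e1 : (x + y + z) / 2 + (x + y - z) / 2 = x + y := by ring
  have e2 : (x + y + z) / 2 - (x + y - z) / 2 = z := by ring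
  rw [e1, e2, h.cosh_z, Real.cosh_add]
  ring

theorem gap_mul (h : FareyTriple κ x y z) :
    (Real.sinh x * Real.sinh y - √((Real.sinh x * Real.sinh y) ^ 2 - κ)) *
      (Real.sinh x * Real.sinh y + √((Real.sinh x * Real.sinh y) ^ 2 - κ)) = κ := by
  have h1 := Real.sq_sqrt (show 0 ≤ (Real.sinh x * Real.sinh y) ^ 2 - κ by
    linarith [h.κ_le, h.κ_pos])
  linear_combination (-1) * h1

theorem S_pos (h : FareyTriple κ x y z) : 0 < Real.sinh x * Real.sinh y :=
  mul_pos (Real.sinh_pos_iff.2 (by linarith [h.one_le_x]))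
    (Real.sinh_pos_iff.2 (by linarith [h.one_le_y]))

theorem gap_pos (h : FareyTriple κ x y z) :
    0 < Real.sinh x * Real.sinh y - √((Real.sinh x * Real.sinh y) ^ 2 - κ) := by
  have h1 := h.gap_mul
  have h2 := h.S_pos
  have h3 := Real.sqrt_nonneg ((Real.sinh x * Real.sinh y) ^ 2 - κ)
  by_contra! hc
  have := h.κ_pos
  nlinarith

theorem lt_add (h : FareyTriple κ x y z) : z < x + y := by
  have h1 := h.gap_pos
  rw [← h.two_mul_sinh_mul_sinh] at h1
  have h2 : 0 < Real.sinh ((x + y + z) / 2) :=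
    Real.sinh_pos_iff.2 (by linarith [h.one_le_x, h.one_le_y, h.z_pos])
  have h3 : 0 < Real.sinh ((x + y - z) / 2) := by
    by_contra! hc
    nlinarith
  have := Real.sinh_pos_iff.1 h3
  linarith

theorem gap_anti (h : FareyTriple κ x y z) (h' : FareyTriple κ x' y' z') (hx : x ≤ x')
    (hy : y ≤ y') :
    Real.sinh x' * Real.sinh y' - √((Real.sinh x' * Real.sinh y') ^ 2 - κ) ≤
      Real.sinh x * Real.sinh y - √((Real.sinh x * Real.sinh y) ^ 2 - κ) := by
  have h1 : Real.sinh x * Real.sinh y ≤ Real.sinh x' * Real.sinh y' :=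
    mul_le_mul (Real.sinh_le_sinh.2 hx) (Real.sinh_le_sinh.2 hy)
      (Real.sinh_nonneg_iff.2 (by linarith [h.one_le_y]))
      (Real.sinh_nonneg_iff.2 (by linarith [h'.one_le_x]))
  have hS := h.S_pos
  have h2 : √((Real.sinh x * Real.sinh y) ^ 2 - κ) ≤ √((Real.sinh x' * Real.sinh y') ^ 2 - κ) :=
    Real.sqrt_le_sqrt (by nlinarith)
  have h3 := h.gap_mul
  have h4 := h'.gap_mul
  have h5 := h.gap_pos
  have h6 := Real.sqrt_nonneg ((Real.sinh x * Real.sinh y) ^ 2 - κ)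
  by_contra! hc
  nlinarith

/-- The defect decreases with the lengths. -/
theorem defect_anti (h : FareyTriple κ x y z) (h' : FareyTriple κ x' y' z') (hx : x ≤ x')
    (hy : y ≤ y') : x' + y' - z' ≤ x + y - z := by
  by_contra! hc
  set D := x + y - z with hD
  have hD0 : 0 < D := by have := h.lt_add; linarith
  have hxx := h.one_le_x
  have hyy := h.one_le_y
  have hz := h.z_pos
  have e1 := h.two_mul_sinh_mul_sinh
  have e2 := h'.two_mul_sinh_mul_sinh
  have e3 := h.gap_anti h' hx hy
  rw [← e1, ← e2, ← hD] at e3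
  have e4 : 2 * Real.sinh ((x' + y' + z') / 2) * Real.sinh ((x' + y' - z') / 2) =
      Real.cosh (x' + y') - Real.cosh z' := by
    rw [← Real.cosh_add_sub_cosh_sub]
    congr 2 <;> ring
  have e5 : 2 * Real.sinh (x' + y' - D / 2) * Real.sinh (D / 2) =
      Real.cosh (x' + y') - Real.cosh (x' + y' - D) := by
    rw [← Real.cosh_add_sub_cosh_sub]
    congr 2 <;> ring
  have e6 : Real.cosh z' < Real.cosh (x' + y' - D) := by
    rw [Real.cosh_lt_cosh, abs_of_pos h'.z_pos, abs_of_pos (by linarith)]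
    linarith
  have e7 : Real.sinh ((x + y + z) / 2) ≤ Real.sinh (x' + y' - D / 2) :=
    Real.sinh_le_sinh.2 (by linarith)
  have e8 : 0 < Real.sinh (D / 2) := Real.sinh_pos_iff.2 (by linarith)
  nlinarith

/-- The defect is exponentially small in terms of the lengths. -/
theorem sinh_defect_le (h : FareyTriple κ x y z) :
    Real.sinh ((x + y - z) / 2) ≤ 64 * κ * Real.exp (-(2 * (x + y))) := by
  have hx := h.one_le_x
  have hy := h.one_le_y
  have hz := h.z_pos
  have e1 := h.two_mul_sinh_mul_sinh
  have hE : Real.exp (-(2 * (x + y))) * (Real.exp (x + y) * Real.exp (x + y)) = 1 := by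
    rw [← Real.exp_add, ← Real.exp_add]
    rw [← Real.exp_zero]
    congr 1
    ring
  have hS : Real.exp (x + y) / 16 ≤ Real.sinh x * Real.sinh y := by
    rw [Real.exp_add]
    have := mul_le_mul (Real.exp_div_four_le_sinh hx) (Real.exp_div_four_le_sinh hy)
      (by positivity) (Real.sinh_nonneg_iff.2 (by linarith))
    linarith
  have hgap := h.gap_mul
  have hg0 := h.gap_pos
  have hs := Real.sqrt_nonneg ((Real.sinh x * Real.sinh y) ^ 2 - κ)
  set g := Real.sinh x * Real.sinh y - √((Real.sinh x * Real.sinh y) ^ 2 - κ) with hg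
  have hgS : g * (Real.exp (x + y) / 16) ≤ κ := by
    rw [← hgap]
    exact mul_le_mul_of_nonneg_left (by linarith) hg0.le
  have ha : Real.exp (x + y) / 8 ≤ Real.sinh ((x + y + z) / 2) := by
    have h1 : Real.exp (x + y) / 4 ≤ Real.exp z := by
      have h2 : Real.cosh z ≤ Real.exp z := by
        rw [Real.cosh_eq]
        have : Real.exp (-z) ≤ Real.exp z := Real.exp_le_exp.2 (by linarith)
        linarith
      have h3 : Real.exp x / 2 ≤ Real.cosh x := by
        rw [Real.cosh_eq]; have := Real.exp_pos (-x); linarith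
      have h4 : Real.exp y / 2 ≤ Real.cosh y := by
        rw [Real.cosh_eq]; have := Real.exp_pos (-y); linarith
      have h5 := mul_le_mul h3 h4 (by positivity) (by positivity)
      rw [h.cosh_z] at h2
      rw [Real.exp_add]
      linarith
    have h6 : Real.exp ((x + y + z) / 2) ^ 2 = Real.exp (x + y) * Real.exp z := by
      rw [← Real.exp_nat_mul, ← Real.exp_add]
      congr 1
      push_cast
      ring
    have h7 : Real.exp (x + y) / 2 ≤ Real.exp ((x + y + z) / 2) := by
      refine le_of_sq_le_sq ?_ (by positivity)
      rw [h6]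
      nlinarith [Real.exp_pos (x + y)]
    have := Real.exp_div_four_le_sinh (show 1 ≤ (x + y + z) / 2 by linarith)
    linarith
  set s := Real.sinh ((x + y - z) / 2) with hsdef
  have hs0 : 0 < s := Real.sinh_pos_iff.2 (by linarith [h.lt_add])
  have hexp := Real.exp_pos (x + y)
  have h1 : s * (Real.exp (x + y) * Real.exp (x + y)) ≤ 64 * κ := by
    have h2 : 2 * (Real.exp (x + y) / 8) * s ≤ g := by
      rw [← e1]
      nlinarith
    nlinarith
  calc s = s * (Real.exp (x + y) * Real.exp (x + y)) * Real.exp (-(2 * (x + y))) := by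
        rw [mul_assoc, mul_comm _ (Real.exp (-(2 * (x + y)))), hE, mul_one]
    _ ≤ _ := mul_le_mul_of_nonneg_right h1 (Real.exp_pos _).le

/-- If the product of the hyperbolic sines grows by a factor `l`, the gap decreases at most by a
factor `l ^ 2`. -/
theorem gap_le (h : FareyTriple κ x y z) (h' : FareyTriple κ x' y' z') {l : ℝ}
    (hl : 1 ≤ l) (hS : Real.sinh x' * Real.sinh y' = l * (Real.sinh x * Real.sinh y)) :
    Real.sinh x * Real.sinh y - √((Real.sinh x * Real.sinh y) ^ 2 - κ) ≤
      l ^ 2 * (Real.sinh x' * Real.sinh y' - √((Real.sinh x' * Real.sinh y') ^ 2 - κ)) := by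
  have h1 := h.gap_mul
  have h2 := h'.gap_mul
  have h3 := h.S_pos
  have h4 := h.κ_le
  have h5 := h'.gap_pos
  have hκ := h.κ_pos
  rw [hS] at h2 h5 ⊢
  generalize Real.sinh x * Real.sinh y = S at *
  have hl2 : 1 ≤ l ^ 2 := one_le_pow₀ hl
  have h6 : √((l * S) ^ 2 - κ) ≤ l ^ 2 * √(S ^ 2 - κ) := by
    rw [Real.sqrt_le_left (by positivity), mul_pow, mul_pow, Real.sq_sqrt (by linarith)]
    have h7 : 2 * κ ≤ S ^ 2 := h4
    have h8 : κ * (l ^ 2 + 1) ≤ l ^ 2 * S ^ 2 := by nlinarith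
    nlinarith [mul_nonneg (sub_nonneg.2 hl2) (sub_nonneg.2 h8)]
  have h7 : l * S ≤ l ^ 2 * S := mul_le_mul_of_nonneg_right (by nlinarith) h3.le
  have h8 := Real.sqrt_nonneg (S ^ 2 - κ)
  refine le_of_mul_le_mul_right (a := S + √(S ^ 2 - κ)) ?_ (by linarith)
  rw [h1]
  calc κ = (l * S - √((l * S) ^ 2 - κ)) * (l * S + √((l * S) ^ 2 - κ)) := h2.symm
    _ ≤ (l * S - √((l * S) ^ 2 - κ)) * (l ^ 2 * (S + √(S ^ 2 - κ))) :=
      mul_le_mul_of_nonneg_left (by linarith) h5.le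
    _ = _ := by ring

/-- The defect is a Lipschitz function of the lengths, with a constant comparable to the defect
itself. -/
theorem defect_lipschitz (h : FareyTriple κ x y z) (h' : FareyTriple κ x' y' z') (hx : x ≤ x')
    (hy : y ≤ y') (hs : Real.sinh ((x + y - z) / 2) ≤ 1 / 4) :
    (x + y - z) - (x' + y' - z') ≤
      24 * Real.sinh ((x + y - z) / 2) * ((x' - x) + (y' - y)) := by
  have hD := h.defect_anti h' hx hy
  have hxx := h.one_le_x
  have hyy := h.one_le_y
  have hz := h.z_pos
  have hz' := h'.z_pos
  have hl1 := h.lt_add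
  have hl2 := h'.lt_add
  set δ := (x' - x) + (y' - y) with hδ
  have e1 := h.two_mul_sinh_mul_sinh
  have e2 := h'.two_mul_sinh_mul_sinh
  have hSx : Real.sinh x' * Real.sinh y' ≤ Real.exp (2 * δ) * (Real.sinh x * Real.sinh y) := by
    have := mul_le_mul (Real.sinh_le_exp_mul_sinh hxx hx) (Real.sinh_le_exp_mul_sinh hyy hy)
      (Real.sinh_nonneg_iff.2 (by linarith))
      (mul_nonneg (Real.exp_pos _).le (Real.sinh_nonneg_iff.2 (by linarith)))
    rw [hδ, mul_add, Real.exp_add]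
    linarith
  have hS0 := h.S_pos
  set l := Real.sinh x' * Real.sinh y' / (Real.sinh x * Real.sinh y) with hldef
  have hlS : Real.sinh x' * Real.sinh y' = l * (Real.sinh x * Real.sinh y) := by
    rw [hldef]; field_simp
  have hl : 1 ≤ l := by
    rw [hldef, one_le_div hS0]
    exact mul_le_mul (Real.sinh_le_sinh.2 hx) (Real.sinh_le_sinh.2 hy)
      (Real.sinh_nonneg_iff.2 (by linarith)) (Real.sinh_nonneg_iff.2 (by linarith))
  have hle : l ≤ Real.exp (2 * δ) := by
    rw [hldef, div_le_iff₀ hS0]; exact hSx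
  have hgap := h.gap_le h' hl hlS
  rw [← e1, ← e2] at hgap
  have hl2 : l ^ 2 ≤ Real.exp (4 * δ) := by
    have : Real.exp (4 * δ) = Real.exp (2 * δ) ^ 2 := by
      rw [← Real.exp_nat_mul]; congr 1; push_cast; ring
    rw [this]
    exact pow_le_pow_left₀ (by linarith) hle 2
  have ha : Real.sinh ((x' + y' + z') / 2) ≤
      Real.exp (2 * ((x' + y' + z') / 2 - (x + y + z) / 2)) * Real.sinh ((x + y + z) / 2) :=
    Real.sinh_le_exp_mul_sinh (by linarith) (by linarith)
  set s := Real.sinh ((x + y - z) / 2) with hsd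
  set s' := Real.sinh ((x' + y' - z') / 2) with hsd'
  set A := Real.sinh ((x + y + z) / 2) with hA
  have hA0 : 0 < A := Real.sinh_pos_iff.2 (by linarith)
  have hs0 : 0 < s := Real.sinh_pos_iff.2 (by linarith)
  have hs0' : 0 < s' := Real.sinh_pos_iff.2 (by linarith)
  -- comparing the products `2 * A * s` for the two triples; `δ` controls the growth of both factors
  have hkey : s ≤ Real.exp (6 * δ + ((x + y - z) - (x' + y' - z'))) * s' := by
    have h1 : 2 * A * s ≤ Real.exp (4 * δ) *
        (2 * (Real.exp (2 * ((x' + y' + z') / 2 - (x + y + z) / 2)) * A) * s') := by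
      refine hgap.trans ?_
      refine mul_le_mul hl2 ?_ ?_ (Real.exp_pos _).le
      · exact mul_le_mul_of_nonneg_right (by linarith) hs0'.le
      · have : 0 < Real.sinh ((x' + y' + z') / 2) := Real.sinh_pos_iff.2 (by linarith)
        positivity
    have h2 : Real.exp (6 * δ + ((x + y - z) - (x' + y' - z'))) =
        Real.exp (4 * δ) * Real.exp (2 * ((x' + y' + z') / 2 - (x + y + z) / 2)) := by
      rw [← Real.exp_add]
      congr 1
      rw [hδ]
      ring
    rw [h2]
    have h3 : 2 * A * s ≤ 2 * A * (Real.exp (4 * δ) *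
      Real.exp (2 * ((x' + y' + z') / 2 - (x + y + z) / 2)) * s') := by linarith
    exact le_of_mul_le_mul_left h3 (by positivity)
  set θ := 6 * δ + ((x + y - z) - (x' + y' - z')) with hθ
  have h1 : s * (1 - θ) ≤ s' := by
    have h2 : 1 - θ ≤ Real.exp (-θ) := Real.one_sub_le_exp_neg θ
    have h3 : s * Real.exp (-θ) ≤ s' := by
      rw [Real.exp_neg, ← div_eq_mul_inv, div_le_iff₀ (Real.exp_pos _), mul_comm]
      exact hkey
    nlinarith
  -- the defects differ by at most `2 * (s - s') ≤ 2 * s * θ`; as `s ≤ 1 / 4`, the part of `θ` that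
  -- contains the difference of the defects can be absorbed on the left-hand side
  have h2 : (x + y - z) / 2 - (x' + y' - z') / 2 ≤ s - s' := by
    have : s' - (x' + y' - z') / 2 ≤ s - (x + y - z) / 2 :=
      Real.sinh_sub_id_strictMono.monotone (by linarith)
    linarith
  have h3 : 0 ≤ (x + y - z) - (x' + y' - z') := by linarith
  nlinarith

end FareyTriple

/-! ### The Farey tree and the half lengths of one structure -/

/-- Edges of the Farey tree of the cone spanned by `(1, 0)` and `(1, 1)`, a primitive vector
`(n, m)` standing for the slope `m / n ∈ [0, 1]`. -/
inductive FareyEdge : ℤ × ℤ → ℤ × ℤ → Prop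
  | root : FareyEdge (1, 0) (1, 1)
  | left {u w : ℤ × ℤ} : FareyEdge u w → FareyEdge u (u + w)
  | right {u w : ℤ × ℤ} : FareyEdge u w → FareyEdge (u + w) w

namespace FareyEdge

variable {u w : ℤ × ℤ}

theorem det (h : FareyEdge u w) : u.1 * w.2 - u.2 * w.1 = 1 := by
  induction h with
  | root => simp
  | left _ ih => simp only [Prod.fst_add, Prod.snd_add]; linarith
  | right _ ih => simp only [Prod.fst_add, Prod.snd_add]; linarith

theorem mem_cone (h : FareyEdge u w) :
    (0 < u.1 ∧ 0 ≤ u.2 ∧ u.2 < u.1) ∧ (0 < w.2 ∧ w.2 ≤ w.1) := by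
  induction h with
  | root => simp
  | left _ ih => simp only [Prod.fst_add, Prod.snd_add]; omega
  | right _ ih => simp only [Prod.fst_add, Prod.snd_add]; omega

/-- Any two vectors of the cone that form an oriented basis of `ℤ²` are the ends of an edge: the
smaller one can be subtracted from the larger one until the root is reached. -/
theorem of_det (hu : 0 ≤ u.2 ∧ u.2 ≤ u.1) (hw : 0 ≤ w.2 ∧ w.2 ≤ w.1)
    (hd : u.1 * w.2 - u.2 * w.1 = 1) : FareyEdge u w := by
  obtain ⟨n, hn⟩ : ∃ n : ℕ, u.1 + w.1 ≤ n := ⟨(u.1 + w.1).toNat, Int.self_le_toNat _⟩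
  induction n generalizing u w with
  | zero =>
    exfalso
    have h1 : u.1 = 0 := by push_cast at hn; omega
    have h2 : w.1 = 0 := by push_cast at hn; omega
    simp [h1, h2] at hd
  | succ n ih =>
    obtain ⟨u1, u2⟩ := u
    obtain ⟨w1, w2⟩ := w
    simp only at *
    push_cast at hn
    -- `p`, `q`: the coordinates in the basis `(1, 0)`, `(1, 1)` of the cone
    obtain ⟨p, rfl⟩ : ∃ p, u1 = p + u2 := ⟨u1 - u2, by ring⟩
    obtain ⟨p', rfl⟩ : ∃ p', w1 = p' + w2 := ⟨w1 - w2, by ring⟩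
    have hd' : p * w2 - u2 * p' = 1 := by linarith
    have hp : 0 ≤ p := by omega
    have hp' : 0 ≤ p' := by omega
    rcases le_or_gt p' p with h1 | h1 <;> rcases le_or_gt w2 u2 with h2 | h2
    · have h3 := ih (u := (p + u2 - (p' + w2), u2 - w2)) (w := (p' + w2, w2)) (by simp; omega)
        (by simp; omega) (by simp only; linarith) (by
          simp only
          have : 0 < p' + w2 := by
            by_contra! hc
            have e1 : p' = 0 := by omega
            have e2 : w2 = 0 := by omega
            simp [e1, e2] at hd'
          omega)
      have h4 := h3.right
      simpa using h4
    · rcases eq_or_lt_of_le h1 with h1 | h1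
      · subst h1
        have h3 := ih (u := (p' + u2, u2)) (w := (p' + w2 - (p' + u2), w2 - u2)) (by simp; omega)
          (by simp; omega) (by simp only; linarith) (by
            simp only
            have : 0 < p' + u2 := by
              by_contra! hc
              have e1 : p' = 0 := by omega
              have e2 : u2 = 0 := by omega
              simp [e1, e2] at hd'
            omega)
        have h4 := h3.left
        simpa using h4
      · have h3 : (p' + 1) * (u2 + 1) ≤ p * w2 :=
          mul_le_mul (by omega) (by omega) (by omega) (by omega)
        have e1 : p' = 0 := by nlinarith
        have e2 : u2 = 0 := by nlinarith
        subst e1 e2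
        simp only [mul_zero, sub_zero] at hd'
        have := Int.eq_one_or_neg_one_of_mul_eq_one hd'
        have := Int.eq_one_or_neg_one_of_mul_eq_one' hd'
        obtain ⟨rfl, rfl⟩ : p = 1 ∧ w2 = 1 := by omega
        exact root
    · exfalso
      nlinarith
    · have h3 := ih (u := (p + u2, u2)) (w := (p' + w2 - (p + u2), w2 - u2)) (by simp; omega)
        (by simp; omega) (by simp only; linarith) (by
          simp only
          have : 0 < p + u2 := by
            by_contra! hc
            have e1 : p = 0 := by omega
            have e2 : u2 = 0 := by omega
            simp [e1, e2] at hd'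
          omega)
      have h4 := h3.left
      simpa using h4

end FareyEdge

/-- The trace relation, together with the choice of the larger one of its two solutions `Z`, yields
a triple of half lengths. -/
theorem FareyTriple.of_trace {κ x y Z : ℝ} (hx : 1 ≤ x) (hy : 1 ≤ y) (hκ : 0 < κ)
    (hκ' : 2 * κ ≤ (Real.sinh x * Real.sinh y) ^ 2)
    (hZ : (2 * Real.cosh x) ^ 2 + (2 * Real.cosh y) ^ 2 + Z ^ 2 -
      2 * Real.cosh x * (2 * Real.cosh y) * Z = 4 - 4 * κ)
    (hl : 2 * Real.cosh x * Real.cosh y ≤ Z) :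
    FareyTriple κ x y (Real.arcosh (Z / 2)) ∧ Z = 2 * Real.cosh (Real.arcosh (Z / 2)) := by
  have hcx : 1 < Real.cosh x := Real.one_lt_cosh.2 (by linarith)
  have hcy : 1 < Real.cosh y := Real.one_lt_cosh.2 (by linarith)
  have hZ1 : 1 < Z / 2 := by nlinarith
  have hc := Real.cosh_arcosh hZ1.le
  refine ⟨⟨hx, hy, Real.arcosh_pos hZ1, hκ, hκ', ?_⟩, by rw [hc]; ring⟩
  rw [hc]
  have h1 : (Real.sinh x * Real.sinh y) ^ 2 - κ = (Z / 2 - Real.cosh x * Real.cosh y) ^ 2 := by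
    rw [mul_pow, Real.sinh_sq, Real.sinh_sq]
    linarith
  rw [h1, Real.sqrt_sq (by linarith)]
  ring

/-- Half the length of a closed geodesic, in terms of its trace. -/
noncomputable def halfLength (t : ℤ × ℤ → ℝ) (v : ℤ × ℤ) : ℝ := Real.arcosh (t v / 2)

/-- The small number that controls the deviation from the triangle. The constants are those for
which `defectBound_mul_le` holds. -/
noncomputable def arcError (a : ℝ) : ℝ := 24576 * Real.exp (4 - a)

/-- The bound for the defects at a vertex of the Farey tree with denominator `n`. The constant is
`24 * 128`, with `24` from `FareyTriple.defect_lipschitz` and `128` from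
`FareyTriple.sinh_defect_le` and `boundaryParam_le`. -/
noncomputable def defectBound (a n : ℝ) : ℝ := 3072 * Real.exp (-((n - 1) * a))

theorem arcError_pos (a : ℝ) : 0 < arcError a := by unfold arcError; positivity

theorem defectBound_pos (a n : ℝ) : 0 < defectBound a n := by unfold defectBound; positivity

theorem four_le_of_arcError_le {a : ℝ} (ha : arcError a ≤ 1 / 4) : 4 ≤ a := by
  by_contra! hc
  have := Real.one_le_exp (show 0 ≤ 4 - a by linarith)
  unfold arcError at ha
  linarith

theorem exp_neg_le_of_arcError_le {a : ℝ} (ha : arcError a ≤ 1 / 4) :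
    Real.exp (-a) ≤ 1 / 1024 := by
  have h4 := Real.one_le_exp (show (0 : ℝ) ≤ 4 by norm_num)
  unfold arcError at ha
  rw [sub_eq_add_neg, Real.exp_add] at ha
  have := Real.exp_pos (-a)
  nlinarith

/-- The form in which the defect bound is used: the right-hand sides form a telescoping series, and
the factor `n ^ 2` leaves room for weights that are linear in the denominators. -/
theorem defectBound_mul_le {a n : ℝ} (ha : 4 ≤ a) (hn : 2 ≤ n) :
    4 * n ^ 2 * defectBound a n ≤ arcError a / (n * (n + 1)) := by
  rw [le_div_iff₀ (by positivity)]
  unfold defectBound arcError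
  have h1 : n ≤ Real.exp (n - 1) := by linarith [Real.add_one_le_exp (n - 1)]
  have h2 : n ^ 4 ≤ Real.exp (4 * (n - 1)) := by
    calc n ^ 4 ≤ Real.exp (n - 1) ^ 4 := pow_le_pow_left₀ (by linarith) h1 4
      _ = _ := by rw [← Real.exp_nat_mul]; norm_num
  have h3 : Real.exp (4 * (n - 1)) * Real.exp (-((n - 1) * a)) ≤ Real.exp (4 - a) := by
    rw [← Real.exp_add]
    exact Real.exp_le_exp.2 (by nlinarith)
  have h4 := Real.exp_pos (-((n - 1) * a))
  have h5 : n ^ 2 * (n * (n + 1)) ≤ 2 * n ^ 4 := by nlinarith [pow_pos (show 0 < n by linarith) 3]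
  calc 4 * n ^ 2 * (3072 * Real.exp (-((n - 1) * a))) * (n * (n + 1))
      = 12288 * (n ^ 2 * (n * (n + 1))) * Real.exp (-((n - 1) * a)) := by ring
    _ ≤ 12288 * (2 * Real.exp (4 * (n - 1))) * Real.exp (-((n - 1) * a)) :=
      mul_le_mul_of_nonneg_right (by linarith) h4.le
    _ = 24576 * (Real.exp (4 * (n - 1)) * Real.exp (-((n - 1) * a))) := by ring
    _ ≤ _ := by gcongr

/-- The parameter `κ` of the boundary trace `2 - 4 * κ` of a structure in which the curves of slopes
`0`, `1` and `∞` have half lengths `a`, `b`, `b`, in any order. -/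
noncomputable def boundaryParam (a b : ℝ) : ℝ :=
  2 * Real.cosh a * Real.cosh b ^ 2 - Real.cosh a ^ 2 - 2 * Real.cosh b ^ 2 + 1

theorem boundaryParam_pos {a b : ℝ} (ha : 4 ≤ a) (hab : a < b) : 0 < boundaryParam a b := by
  unfold boundaryParam
  have h1 : Real.cosh a ≤ Real.cosh b := by
    rw [Real.cosh_le_cosh, abs_of_pos (by linarith), abs_of_pos (by linarith)]; exact hab.le
  have h2 : 2 ≤ Real.cosh a := by
    rw [Real.cosh_eq]
    linarith [Real.add_one_le_exp a, Real.exp_pos (-a)]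
  nlinarith

theorem boundaryParam_le (a b : ℝ) (ha : 0 ≤ a) (hb : 0 ≤ b) :
    boundaryParam a b ≤ 2 * Real.exp (a + 2 * b) := by
  have h : ∀ x : ℝ, 0 ≤ x → Real.cosh x ≤ Real.exp x := fun x hx => by
    rw [Real.cosh_eq]
    have : Real.exp (-x) ≤ Real.exp x := Real.exp_le_exp.2 (by linarith)
    linarith
  have h1 := h a ha
  have h2 := h b hb
  have h3 := Real.one_le_cosh a
  have h4 := Real.one_le_cosh b
  have h5 : Real.exp (a + 2 * b) = Real.exp a * Real.exp b ^ 2 := by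
    rw [Real.exp_add, ← Real.exp_nat_mul]; norm_num
  have h6 : Real.cosh a * Real.cosh b ^ 2 ≤ Real.exp a * Real.exp b ^ 2 := by gcongr
  unfold boundaryParam
  rw [h5]
  nlinarith

/-- The traces `t` of one hyperbolic structure, as needed on the arc of slopes in `[0, 1]`: the half
lengths are `x` at slope `0` and `y` at slope `1`. The curve of slope `∞` is the shorter one of the
two curves obtained by resolving the intersection of those of slopes `0` and `1`, which makes the
lengths increase along the tree. -/
structure ArcTrace (a b x y : ℝ) (t : ℤ × ℤ → ℝ) : Prop where
  markov : IsMarkov t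
  err : arcError a ≤ 1 / 4
  lt : a < b
  le_x : a ≤ x
  le_y : a ≤ y
  le_add : a + b ≤ x + y
  zero : t (1, 0) = 2 * Real.cosh x
  one : t (1, 1) = 2 * Real.cosh y
  infty : t (0, 1) ≤ 2 * Real.cosh x * Real.cosh y
  boundary : t (1, 0) ^ 2 + t (1, 1) ^ 2 + t (0, 1) ^ 2 - t (1, 0) * t (1, 1) * t (0, 1) =
    4 - 4 * boundaryParam a b

namespace ArcTrace

variable {a b x y : ℝ} {t : ℤ × ℤ → ℝ} {u w : ℤ × ℤ}

/-- A lower bound for the half lengths, up to an error of at most `1` per step in the tree. -/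
theorem lin_le_aux (h : ArcTrace a b x y t) (hu : 0 < u.1 ∧ 0 ≤ u.2 ∧ u.2 ≤ u.1)
    (hl : (u.1 - u.2) * x + u.2 * y - (u.1 - 1) ≤ halfLength t u) : 1 ≤ halfLength t u := by
  have h4 := four_le_of_arcError_le h.err
  have h1 : (1 : ℝ) ≤ u.1 := by exact_mod_cast hu.1
  have h2 : (0 : ℝ) ≤ u.2 := by exact_mod_cast hu.2.1
  have h3 : (u.2 : ℝ) ≤ u.1 := by exact_mod_cast hu.2.2
  have := mul_le_mul_of_nonneg_left h.le_x (sub_nonneg.2 h3)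
  have := mul_le_mul_of_nonneg_left h.le_y h2
  nlinarith

/-- The step from an edge to its mediant, under the assertions of `edge_aux` for that edge: the half
lengths form a triple with a small defect. -/
theorem triple_aux (h : ArcTrace a b x y t) (hE : FareyEdge u w)
    (hu : t u = 2 * Real.cosh (halfLength t u)) (hw : t w = 2 * Real.cosh (halfLength t w))
    (hlu : (u.1 - u.2) * x + u.2 * y - (u.1 - 1) ≤ halfLength t u)
    (hlw : (w.1 - w.2) * x + w.2 * y - (w.1 - 1) ≤ halfLength t w)
    (hroot : t (u - w) ≤ t (u + w))
    (hK : t u ^ 2 + t w ^ 2 + t (u + w) ^ 2 - t u * t w * t (u + w) =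
      4 - 4 * boundaryParam a b) :
    (FareyTriple (boundaryParam a b) (halfLength t u) (halfLength t w) (halfLength t (u + w)) ∧
      t (u + w) = 2 * Real.cosh (halfLength t (u + w))) ∧
      Real.sinh ((halfLength t u + halfLength t w - halfLength t (u + w)) / 2) ≤
        128 * Real.exp (-((((u + w).1 : ℤ) - 1) * a)) := by
  have h4 := four_le_of_arcError_le h.err
  have hexp := exp_neg_le_of_arcError_le h.err
  have hb := h.lt
  have hκ := boundaryParam_pos h4 hb
  have hκ' := boundaryParam_le a b (by linarith) (by linarith)
  obtain ⟨⟨c1, c2, c3⟩, c4, c5⟩ := hE.mem_cone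
  have hx1 := h.lin_le_aux ⟨c1, c2, c3.le⟩ hlu
  have hy1 := h.lin_le_aux ⟨by omega, c4.le, c5⟩ hlw
  set p := halfLength t u with hp
  set q := halfLength t w with hq
  -- the sum of the two half lengths exceeds `(a + 2 b + (n - 1) a) / 2`
  have hsum : a + 2 * b + ((((u + w).1 : ℤ) : ℝ) - 1) * a ≤ 2 * (p + q) := by
    have d1 : (1 : ℝ) ≤ (u.1 - u.2) + (w.1 - w.2) := by
      have : (1 : ℤ) ≤ (u.1 - u.2) + (w.1 - w.2) := by omega
      exact_mod_cast this
    have d2 : (1 : ℝ) ≤ u.2 + w.2 := by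
      have : (1 : ℤ) ≤ u.2 + w.2 := by omega
      exact_mod_cast this
    simp only [Prod.fst_add, Int.cast_add]
    have d3 := mul_le_mul_of_nonneg_left h.le_x (sub_nonneg.2 d1)
    have d4 := mul_le_mul_of_nonneg_left h.le_y (sub_nonneg.2 d2)
    have d5 := h.le_add
    nlinarith
  have hκ2 : 2 * boundaryParam a b ≤ (Real.sinh p * Real.sinh q) ^ 2 := by
    have e1 : Real.exp (p + q) / 16 ≤ Real.sinh p * Real.sinh q := by
      rw [Real.exp_add]
      have := mul_le_mul (Real.exp_div_four_le_sinh hx1) (Real.exp_div_four_le_sinh hy1)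
        (by positivity) (Real.sinh_nonneg_iff.2 (by linarith))
      linarith
    have e2 : (Real.exp (p + q) / 16) ^ 2 = Real.exp (2 * (p + q)) / 256 := by
      rw [div_pow, ← Real.exp_nat_mul]; norm_num
    have e3 := pow_le_pow_left₀ (by positivity) e1 2
    rw [e2] at e3
    have e4 : Real.exp (a + 2 * b) = Real.exp (a + 2 * b + a) * Real.exp (-a) := by
      rw [← Real.exp_add]; congr 1; ring
    have e5 : Real.exp (a + 2 * b + a) ≤ Real.exp (2 * (p + q)) := by
      refine Real.exp_le_exp.2 (le_trans ?_ hsum)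
      have : (2 : ℝ) ≤ ((u + w).1 : ℤ) := by
        have : (2 : ℤ) ≤ (u + w).1 := by simp only [Prod.fst_add]; omega
        exact_mod_cast this
      nlinarith
    have e6 := Real.exp_pos (a + 2 * b + a)
    nlinarith
  have hms := h.markov.add_sub u w hE.det
  have hT := FareyTriple.of_trace (Z := t (u + w)) hx1 hy1 hκ hκ2 (by rw [← hu, ← hw]; exact hK)
    (by rw [hu, hw] at hms; linarith)
  refine ⟨hT, ?_⟩
  refine (hT.1.sinh_defect_le).trans ?_
  have e1 : Real.exp (a + 2 * b) * Real.exp (-(2 * (p + q))) ≤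
      Real.exp (-((((u + w).1 : ℤ) - 1) * a)) := by
    rw [← Real.exp_add]
    exact Real.exp_le_exp.2 (by linarith)
  have e2 := Real.exp_pos (-(2 * (p + q)))
  nlinarith [mul_le_mul_of_nonneg_right hκ' e2.le]

/-- By induction along the tree: the traces are those of hyperbolic elements, the half lengths have
linear lower bounds, traces increase, and the trace relation of the boundary is preserved. -/
theorem edge_aux (h : ArcTrace a b x y t) (hE : FareyEdge u w) :
    (t u = 2 * Real.cosh (halfLength t u) ∧ t w = 2 * Real.cosh (halfLength t w)) ∧
    ((u.1 - u.2) * x + u.2 * y - (u.1 - 1) ≤ halfLength t u ∧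
    (w.1 - w.2) * x + w.2 * y - (w.1 - 1) ≤ halfLength t w) ∧
    t (u - w) ≤ t (u + w) ∧
    t u ^ 2 + t w ^ 2 + t (u + w) ^ 2 - t u * t w * t (u + w) = 4 - 4 * boundaryParam a b := by
  have h4 := four_le_of_arcError_le h.err
  have hexp := exp_neg_le_of_arcError_le h.err
  have hstep : ∀ {u w : ℤ × ℤ}, FareyEdge u w →
      ((t u = 2 * Real.cosh (halfLength t u) ∧ t w = 2 * Real.cosh (halfLength t w)) ∧
      ((u.1 - u.2) * x + u.2 * y - (u.1 - 1) ≤ halfLength t u ∧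
      (w.1 - w.2) * x + w.2 * y - (w.1 - 1) ≤ halfLength t w) ∧
      t (u - w) ≤ t (u + w) ∧
      t u ^ 2 + t w ^ 2 + t (u + w) ^ 2 - t u * t w * t (u + w) = 4 - 4 * boundaryParam a b) →
      (t (u + w) = 2 * Real.cosh (halfLength t (u + w)) ∧
      ((u + w).1 - (u + w).2) * x + (u + w).2 * y - ((u + w).1 - 1) ≤ halfLength t (u + w)) ∧
      (2 ≤ t u ∧ 2 ≤ t w ∧ t u ≤ t (u + w) ∧ t w ≤ t (u + w)) := by
    rintro u w hE ⟨⟨hu, hw⟩, ⟨hlu, hlw⟩, hroot, hK⟩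
    obtain ⟨⟨hT, hc⟩, hs⟩ := h.triple_aux hE hu hw hlu hlw hroot hK
    have hD : 2 * ((halfLength t u + halfLength t w - halfLength t (u + w)) / 2) ≤
        2 * (128 * Real.exp (-((((u + w).1 : ℤ) - 1) * a))) := by
      have := Real.self_le_sinh_iff.2
        (show 0 ≤ (halfLength t u + halfLength t w - halfLength t (u + w)) / 2 by
          linarith [hT.lt_add])
      linarith
    have hn : (2 : ℝ) ≤ ((u + w).1 : ℤ) := by
      have := hE.mem_cone
      have : (2 : ℤ) ≤ (u + w).1 := by simp only [Prod.fst_add]; omega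
      exact_mod_cast this
    have he : Real.exp (-((((u + w).1 : ℤ) - 1) * a)) ≤ 1 / 1024 :=
      (Real.exp_le_exp.2 (by nlinarith)).trans hexp
    have hms := h.markov.add_sub u w hE.det
    have h1 := Real.one_le_cosh (halfLength t u)
    have h2 := Real.one_le_cosh (halfLength t w)
    refine ⟨⟨hc, ?_⟩, by linarith, by linarith, by nlinarith, by nlinarith⟩
    simp only [Prod.fst_add, Prod.snd_add, Int.cast_add]
    linarith
  induction hE with
  | root =>
    have hx : halfLength t (1, 0) = x := by
      rw [halfLength, h.zero, mul_div_cancel_left₀ _ two_ne_zero,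
        Real.arcosh_cosh (by linarith [h.le_x])]
    have hy : halfLength t (1, 1) = y := by
      rw [halfLength, h.one, mul_div_cancel_left₀ _ two_ne_zero,
        Real.arcosh_cosh (by linarith [h.le_y])]
    have hms := h.markov.add_sub (1, 0) (1, 1) (by simp)
    have hev := h.markov.even (0, 1)
    have e : ((1, 0) : ℤ × ℤ) - (1, 1) = -(0, 1) := by simp
    have e' : t ((1, 0) - (1, 1)) = t (0, 1) := by rw [e, hev]
    rw [e'] at hms ⊢
    refine ⟨⟨by rw [hx, h.zero], by rw [hy, h.one]⟩, ⟨by simp [hx], by simp [hy]⟩, ?_, ?_⟩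
    · have := h.infty
      rw [h.zero, h.one] at hms
      linarith
    · have := h.boundary
      rw [← this, ← sub_eq_zero, eq_sub_of_add_eq hms]
      ring
  | @left u w hE ih =>
    have hs := hstep hE ih
    have hms := h.markov.add_sub u (u + w) (by
      have := hE.det; simp only [Prod.fst_add, Prod.snd_add]; linarith)
    have e : t (u - (u + w)) = t w := by
      rw [← h.markov.even w]; congr 1; abel
    rw [e] at hms ⊢
    refine ⟨⟨ih.1.1, hs.1.1⟩, ⟨ih.2.1.1, by exact_mod_cast hs.1.2⟩, ?_, ?_⟩
    · nlinarith
    · rw [← ih.2.2.2, eq_sub_of_add_eq hms]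
      ring
  | @right u w hE ih =>
    have hs := hstep hE ih
    have hms := h.markov.add_sub (u + w) w (by
      have := hE.det; simp only [Prod.fst_add, Prod.snd_add]; linarith)
    have e : t (u + w - w) = t u := by rw [add_sub_cancel_right]
    rw [e] at hms ⊢
    refine ⟨⟨hs.1.1, ih.1.2⟩, ⟨by exact_mod_cast hs.1.2, ih.2.1.2⟩, ?_, ?_⟩
    · nlinarith
    · rw [← ih.2.2.2, eq_sub_of_add_eq hms]
      ring

theorem triple (h : ArcTrace a b x y t) (hE : FareyEdge u w) :
    FareyTriple (boundaryParam a b) (halfLength t u) (halfLength t w) (halfLength t (u + w)) :=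
  have h1 := h.edge_aux hE
  (h.triple_aux hE h1.1.1 h1.1.2 h1.2.1.1 h1.2.1.2 h1.2.2.1 h1.2.2.2).1.1

theorem sinh_defect_le (h : ArcTrace a b x y t) (hE : FareyEdge u w) :
    24 * Real.sinh ((halfLength t u + halfLength t w - halfLength t (u + w)) / 2) ≤
      defectBound a (u + w).1 := by
  have h1 := h.edge_aux hE
  have := (h.triple_aux hE h1.1.1 h1.1.2 h1.2.1.1 h1.2.1.2 h1.2.2.1 h1.2.2.2).2
  unfold defectBound
  linarith

theorem eq_cosh_left (h : ArcTrace a b x y t) (hE : FareyEdge u w) :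
    t u = 2 * Real.cosh (halfLength t u) := (h.edge_aux hE).1.1

theorem eq_cosh_right (h : ArcTrace a b x y t) (hE : FareyEdge u w) :
    t w = 2 * Real.cosh (halfLength t w) := (h.edge_aux hE).1.2

theorem boundary_edge (h : ArcTrace a b x y t) (hE : FareyEdge u w) :
    t u ^ 2 + t w ^ 2 + t (u + w) ^ 2 - t u * t w * t (u + w) = 4 - 4 * boundaryParam a b :=
  (h.edge_aux hE).2.2.2

end ArcTrace

/-! ### Almost additive functions on the Farey tree -/

/-- Three functions on the Farey tree that are additive along the edges, up to errors at most `δ n`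
at denominator `n`, relatively to the size for `P` and `Q`. They are modelled on the half lengths
of three hyperbolic structures: `H` is the third half length, and `P` and `Q` are its differences
with the other two, divided by `b - a`. The first two are superadditive, the third one is
subadditive. -/
structure ArcRec (b ε : ℝ) (δ : ℝ → ℝ) (P Q H : ℤ × ℤ → ℝ) : Prop where
  b_ge : 1 ≤ b
  ε_pos : 0 < ε
  ε_le : ε ≤ 1 / 4
  δ_pos : ∀ n, 0 < δ n
  δ_le : ∀ n, 2 ≤ n → 4 * n ^ 2 * δ n ≤ ε / (n * (n + 1))
  P_zero : P (1, 0) = 1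
  Q_zero : Q (1, 0) = 0
  H_zero : H (1, 0) = b
  P_one : P (1, 1) = 0
  Q_one : Q (1, 1) = 1
  H_one : H (1, 1) = b
  P_add : ∀ {u w}, FareyEdge u w → 0 ≤ P u → 0 ≤ P w → P u + P w ≤ P (u + w) ∧
    P (u + w) ≤ P u + P w + δ (u + w).1 * (P u + P w)
  Q_add : ∀ {u w}, FareyEdge u w → 0 ≤ Q u → 0 ≤ Q w → Q u + Q w ≤ Q (u + w) ∧
    Q (u + w) ≤ Q u + Q w + δ (u + w).1 * (Q u + Q w)
  H_add : ∀ {u w}, FareyEdge u w → H (u + w) ≤ H u + H w ∧ H u + H w - δ (u + w).1 ≤ H (u + w)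
  H_nonneg : ∀ {u w}, FareyEdge u w → 0 ≤ H u ∧ 0 ≤ H w

/-- One step of an induction over the denominators, in which the errors `ε / (n (n + 1))` add up to
less than `ε`. -/
theorem abs_add_sub_le_of_step {n n' ε E X c : ℝ} (hε : 0 ≤ ε) (hn : 2 ≤ n) (hn' : n + 1 ≤ n')
    (hE : |E| ≤ ε / (n * (n + 1))) (hX : |X - c| ≤ ε * (1 - 1 / n)) :
    |X + E - c| ≤ ε * (1 - 1 / n') := by
  have h1 : |X + E - c| ≤ |X - c| + |E| := by
    rw [show X + E - c = (X - c) + E by ring]; exact abs_add_le _ _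
  have h2 : 1 / n' ≤ 1 / (n + 1) := one_div_le_one_div_of_le (by linarith) hn'
  have h3 : ε * (1 - 1 / n) + ε / (n * (n + 1)) = ε * (1 - 1 / (n + 1)) := by
    field_simp
    ring
  nlinarith

namespace ArcRec

variable {b ε : ℝ} {δ : ℝ → ℝ} {P Q H : ℤ × ℤ → ℝ} {u w : ℤ × ℤ}

/-- The bounds at a single vertex of the tree: linear bounds for the three functions, and the bound
of `b * (P + Q) - H`, which vanishes at the root and measures the distance to a side of the
triangle, by multiples of `P` and of `Q`. -/
structure VertexBound (b ε : ℝ) (P Q H : ℤ × ℤ → ℝ) (u : ℤ × ℤ) : Prop where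
  one_le : (1 : ℝ) ≤ u.1
  le_P : ((u.1 : ℝ) - u.2) ≤ P u
  P_le : P u ≤ 2 * u.1 - 1
  le_Q : (u.2 : ℝ) ≤ Q u
  Q_le : Q u ≤ 2 * u.1 - 1
  H_le : H u ≤ b * u.1
  F_nonneg : H u ≤ b * (P u + Q u)
  F_le_Q : b * (P u + Q u) - H u ≤ ε * b * Q u * (1 - 1 / u.1)
  F_le_P : b * (P u + Q u) - H u ≤ ε * b * P u * (1 - 1 / u.1)
  nonneg : (0 : ℝ) ≤ u.2 ∧ (u.2 : ℝ) ≤ u.1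

theorem VertexBound.P_nonneg (h : VertexBound b ε P Q H u) : 0 ≤ P u := by
  linarith [h.le_P, h.nonneg.2]

theorem VertexBound.Q_nonneg (h : VertexBound b ε P Q H u) : 0 ≤ Q u := by
  linarith [h.le_Q, h.nonneg.1]

/-- The bookkeeping of the errors at a mediant of vertices with denominators `p` and `q`: the
factors `1 - 1 / n` make room for the new error `c / (n (n + 1))`. -/
theorem weighted_error_le {c p q n A B C : ℝ} (hc : 0 ≤ c) (hp : 1 ≤ p) (hq : 1 ≤ q)
    (hnpq : n = p + q) (hn : 2 ≤ n) (hA : 0 ≤ A) (hB : 0 ≤ B) (hAB : 1 ≤ A + B) (hC : A + B ≤ C) :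
    c * A * (1 - 1 / p) + c * B * (1 - 1 / q) + c / (n * (n + 1)) ≤ c * C * (1 - 1 / n) := by
  have i1 : 1 / (n - 1) ≤ 1 / p := one_div_le_one_div_of_le (by linarith) (by linarith)
  have i2 : 1 / (n - 1) ≤ 1 / q := one_div_le_one_div_of_le (by linarith) (by linarith)
  have i3 : 1 / (n * (n + 1)) ≤ 1 / (n - 1) - 1 / n := by
    have : 1 / (n - 1) - 1 / n = 1 / (n * (n - 1)) := by
      have : n - 1 ≠ 0 := by linarith
      field_simp
      ring
    rw [this]
    refine one_div_le_one_div_of_le (by nlinarith) (by nlinarith)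
  have i4 : 0 ≤ 1 - 1 / n := by
    rw [sub_nonneg, div_le_one (by linarith)]; linarith
  have i5 : A * (1 - 1 / p) + B * (1 - 1 / q) + 1 / (n * (n + 1)) ≤ C * (1 - 1 / n) := by
    have := mul_le_mul_of_nonneg_left i1 hA
    have := mul_le_mul_of_nonneg_left i2 hB
    have j1 : 0 ≤ 1 / (n - 1) - 1 / n := le_trans (by positivity) i3
    have := mul_le_mul_of_nonneg_right hC i4
    nlinarith
  calc _ = c * (A * (1 - 1 / p) + B * (1 - 1 / q) + 1 / (n * (n + 1))) := by ring
    _ ≤ c * (C * (1 - 1 / n)) := mul_le_mul_of_nonneg_left i5 hc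
    _ = _ := by ring

set_option maxHeartbeats 1000000 in
theorem VertexBound.add (h : ArcRec b ε δ P Q H) (hE : FareyEdge u w)
    (hu : VertexBound b ε P Q H u) (hw : VertexBound b ε P Q H w) :
    VertexBound b ε P Q H (u + w) := by
  obtain ⟨p1, p2⟩ := h.P_add hE hu.P_nonneg hw.P_nonneg
  obtain ⟨q1, q2⟩ := h.Q_add hE hu.Q_nonneg hw.Q_nonneg
  obtain ⟨r1, r2⟩ := h.H_add hE
  have hb := h.b_ge
  have hε := h.ε_pos
  have hε' := h.ε_le
  have hun := hu.one_le
  have hwn := hw.one_le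
  have en : (((u + w).1 : ℤ) : ℝ) = u.1 + w.1 := by simp
  have em : (((u + w).2 : ℤ) : ℝ) = u.2 + w.2 := by simp
  have hn : (2 : ℝ) ≤ ((u + w).1 : ℤ) := by rw [en]; linarith
  have hδ := h.δ_le _ hn
  have hδ0 := h.δ_pos ((u + w).1 : ℤ)
  have hpu := hu.P_le
  have hpw := hw.P_le
  have hqu := hu.Q_le
  have hqw := hw.Q_le
  have hP1 : 1 ≤ P u + P w := by
    have := hu.le_P
    have := hw.P_nonneg
    have : (1 : ℝ) ≤ (u.1 : ℝ) - u.2 := by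
      have := hE.mem_cone
      have : (1 : ℤ) ≤ u.1 - u.2 := by omega
      exact_mod_cast this
    linarith
  have hQ1 : 1 ≤ Q u + Q w := by
    have := hw.le_Q
    have := hu.Q_nonneg
    have : (1 : ℝ) ≤ (w.2 : ℝ) := by
      have := hE.mem_cone
      have : (1 : ℤ) ≤ w.2 := by omega
      exact_mod_cast this
    linarith
  set n : ℝ := (((u + w).1 : ℤ) : ℝ) with hndef
  set d := δ n with hd
  have hδ1 : 4 * n ^ 2 * d ≤ ε := hδ.trans (div_le_self hε.le (by nlinarith))
  have hPn : d * (P u + P w) ≤ d * (2 * n) := mul_le_mul_of_nonneg_left (by linarith) hδ0.le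
  have hQn : d * (Q u + Q w) ≤ d * (2 * n) := mul_le_mul_of_nonneg_left (by linarith) hδ0.le
  have hnd : d * (2 * n) ≤ 1 := by nlinarith
  -- the error committed in one step
  have herr : b * (P (u + w) + Q (u + w)) - H (u + w) ≤
      (b * (P u + Q u) - H u) + (b * (P w + Q w) - H w) + ε * b / (n * (n + 1)) := by
    have e1 : b * (P (u + w) + Q (u + w)) - H (u + w) ≤
      (b * (P u + Q u) - H u) + (b * (P w + Q w) - H w) + b * (d * (2 * n) + d * (2 * n)) + d := by
      have := mul_le_mul_of_nonneg_left
        (show P (u + w) + Q (u + w) ≤ (P u + P w + Q u + Q w) + (d * (2 * n) + d * (2 * n)) by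
          linarith) (by linarith : (0 : ℝ) ≤ b)
      linarith
    have e2 : b * (d * (2 * n) + d * (2 * n)) + d ≤ b * (4 * n ^ 2 * d) := by
      have : d ≤ b * d := by nlinarith
      have : 4 * n + 1 ≤ 4 * n ^ 2 := by nlinarith
      have := mul_le_mul_of_nonneg_left this (by positivity : 0 ≤ b * d)
      linarith
    have e3 : b * (4 * n ^ 2 * d) ≤ ε * b / (n * (n + 1)) := by
      calc b * (4 * n ^ 2 * d) ≤ b * (ε / (n * (n + 1))) :=
            mul_le_mul_of_nonneg_left hδ (by linarith)
        _ = _ := by ring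
    linarith
  have hfrac : ∀ {A B C : ℝ}, 0 ≤ A → 0 ≤ B → 1 ≤ A + B → A + B ≤ C →
      ε * b * A * (1 - 1 / u.1) + ε * b * B * (1 - 1 / w.1) + ε * b / (n * (n + 1)) ≤
        ε * b * C * (1 - 1 / n) := fun hA hB hAB hC =>
    weighted_error_le (by positivity) hun hwn en hn hA hB hAB hC
  refine ⟨by linarith, ?_, by rw [en] at *; linarith, ?_, by rw [en] at *; linarith, ?_, ?_, ?_, ?_,
    ?_, ?_⟩
  · rw [← hndef, en, em]; linarith [hu.le_P, hw.le_P]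
  · rw [em]; linarith [hu.le_Q, hw.le_Q]
  · rw [← hndef, en]; linarith [hu.H_le, hw.H_le]
  · have := mul_le_mul_of_nonneg_left (add_le_add p1 q1) (by linarith : (0 : ℝ) ≤ b)
    linarith [hu.F_nonneg, hw.F_nonneg]
  · have := hfrac hu.Q_nonneg hw.Q_nonneg hQ1 q1
    linarith [hu.F_le_Q, hw.F_le_Q]
  · have := hfrac hu.P_nonneg hw.P_nonneg hP1 p1
    linarith [hu.F_le_P, hw.F_le_P]
  · rw [em]; linarith [hu.nonneg.1, hw.nonneg.1]
  · rw [← hndef, en, em]; linarith [hu.nonneg.2, hw.nonneg.2]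

theorem vertexBound (h : ArcRec b ε δ P Q H) (hE : FareyEdge u w) :
    VertexBound b ε P Q H u ∧ VertexBound b ε P Q H w := by
  induction hE with
  | root =>
    have := h.b_ge
    have := h.ε_pos
    constructor
    · constructor <;> simp [h.P_zero, h.Q_zero, h.H_zero]
      norm_num
    · constructor <;> simp [h.P_one, h.Q_one, h.H_one]
      norm_num
  | left hE ih => exact ⟨ih.1, VertexBound.add h hE ih.1 ih.2⟩
  | right hE ih => exact ⟨VertexBound.add h hE ih.1 ih.2, ih.2⟩

/-- The three minors of an edge of the tree stay close to their values at the root. -/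
structure EdgeBound (b ε : ℝ) (P Q H : ℤ × ℤ → ℝ) (u w : ℤ × ℤ) : Prop where
  PQ : |P u * Q w - Q u * P w - 1| ≤ ε * (1 - 1 / (u.1 + w.1))
  HQ : |H u * Q w - Q u * H w - b| ≤ ε * b * (1 - 1 / (u.1 + w.1))
  PH : |P u * H w - H u * P w - b| ≤ ε * b * (1 - 1 / (u.1 + w.1))

set_option maxHeartbeats 1000000 in
/-- The deviations from additivity along an edge, weighed by the values at a vertex `v` of that
edge, are small. -/
theorem exists_step (h : ArcRec b ε δ P Q H) (hE : FareyEdge u w) {v : ℤ × ℤ}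
    (hv : v = u ∨ v = w) : ∃ eP eQ eH : ℝ,
      (P (u + w) = P u + P w + eP ∧ Q (u + w) = Q u + Q w + eQ ∧ H (u + w) = H u + H w - eH) ∧
      |P v * eQ - Q v * eP| ≤ ε / ((u.1 + w.1) * (u.1 + w.1 + 1)) ∧
      |H v * eQ + Q v * eH| ≤ ε * b / ((u.1 + w.1) * (u.1 + w.1 + 1)) ∧
      |P v * eH + H v * eP| ≤ ε * b / ((u.1 + w.1) * (u.1 + w.1 + 1)) := by
  have hb := h.b_ge
  have hε := h.ε_pos
  obtain ⟨hu, hw⟩ := h.vertexBound hE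
  obtain ⟨p1, p2⟩ := h.P_add hE hu.P_nonneg hw.P_nonneg
  obtain ⟨q1, q2⟩ := h.Q_add hE hu.Q_nonneg hw.Q_nonneg
  obtain ⟨r1, r2⟩ := h.H_add hE
  have hun := hu.one_le
  have hwn := hw.one_le
  have hvb : VertexBound b ε P Q H v := by rcases hv with rfl | rfl <;> assumption
  have s1 : 0 ≤ H v := by
    have := h.H_nonneg hE
    rcases hv with rfl | rfl
    exacts [this.1, this.2]
  have hvn : (v.1 : ℝ) ≤ u.1 + w.1 := by rcases hv with rfl | rfl <;> linarith
  have en : (((u + w).1 : ℤ) : ℝ) = u.1 + w.1 := by simp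
  have hn : (2 : ℝ) ≤ u.1 + w.1 := by linarith
  rw [en] at p2 q2 r2
  set n : ℝ := u.1 + w.1 with hndef
  have hδ := h.δ_le _ hn
  have hδ0 := h.δ_pos n
  set d := δ n with hd
  have hPn : d * (P u + P w) ≤ d * (2 * n) :=
    mul_le_mul_of_nonneg_left (by linarith [hu.P_le, hw.P_le]) hδ0.le
  have hQn : d * (Q u + Q w) ≤ d * (2 * n) :=
    mul_le_mul_of_nonneg_left (by linarith [hu.Q_le, hw.Q_le]) hδ0.le
  obtain ⟨eP, hP⟩ : ∃ e, P (u + w) = P u + P w + e := ⟨P (u + w) - (P u + P w), by ring⟩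
  obtain ⟨eQ, hQ⟩ : ∃ e, Q (u + w) = Q u + Q w + e := ⟨Q (u + w) - (Q u + Q w), by ring⟩
  obtain ⟨eH, hH⟩ : ∃ e, H (u + w) = H u + H w - e := ⟨H u + H w - H (u + w), by ring⟩
  have hP0 := hvb.P_nonneg
  have hQ0 := hvb.Q_nonneg
  have hPu : P v ≤ 2 * n := by linarith [hvb.P_le]
  have hQu : Q v ≤ 2 * n := by linarith [hvb.Q_le]
  have hHu : H v ≤ b * n := hvb.H_le.trans (mul_le_mul_of_nonneg_left hvn (by linarith))
  rw [hP] at p1 p2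
  rw [hQ] at q1 q2
  rw [hH] at r1 r2
  have a1 : P v * eQ ≤ (2 * n) * (d * (2 * n)) :=
    mul_le_mul hPu (by linarith) (by linarith) (by linarith)
  have a2 : Q v * eP ≤ (2 * n) * (d * (2 * n)) :=
    mul_le_mul hQu (by linarith) (by linarith) (by linarith)
  have a3 : H v * eQ ≤ (b * n) * (d * (2 * n)) :=
    mul_le_mul hHu (by linarith) (by linarith) (by positivity)
  have a4 : H v * eP ≤ (b * n) * (d * (2 * n)) :=
    mul_le_mul hHu (by linarith) (by linarith) (by positivity)
  have a5 : Q v * eH ≤ (2 * n) * d := mul_le_mul hQu (by linarith) (by linarith) (by linarith)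
  have a6 : P v * eH ≤ (2 * n) * d := mul_le_mul hPu (by linarith) (by linarith) (by linarith)
  have b1 : 0 ≤ P v * eQ := mul_nonneg hP0 (by linarith)
  have b2 : 0 ≤ Q v * eP := mul_nonneg hQ0 (by linarith)
  have b3 : 0 ≤ H v * eQ := mul_nonneg s1 (by linarith)
  have b4 : 0 ≤ H v * eP := mul_nonneg s1 (by linarith)
  have b5 : 0 ≤ Q v * eH := mul_nonneg hQ0 (by linarith)
  have b6 : 0 ≤ P v * eH := mul_nonneg hP0 (by linarith)
  have c1 : b * (4 * n ^ 2 * d) ≤ ε * b / (n * (n + 1)) := by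
    calc b * (4 * n ^ 2 * d) ≤ b * (ε / (n * (n + 1))) :=
          mul_le_mul_of_nonneg_left hδ (by linarith)
      _ = _ := by ring
  have c2 : (b * n) * (d * (2 * n)) + (2 * n) * d ≤ b * (4 * n ^ 2 * d) := by
    have e1 : d ≤ b * d := by nlinarith
    have e2 : n ≤ n ^ 2 := by nlinarith
    have e3 : n * d ≤ n * (b * d) := mul_le_mul_of_nonneg_left e1 (by linarith)
    have e4 := mul_le_mul_of_nonneg_right e2 (by positivity : 0 ≤ b * d)
    linarith
  refine ⟨eP, eQ, eH, ⟨hP, hQ, hH⟩, ?_, ?_, ?_⟩ <;> rw [abs_le] <;> constructor <;> linarith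

theorem edgeBound (h : ArcRec b ε δ P Q H) (hE : FareyEdge u w) : EdgeBound b ε P Q H u w := by
  have hb := h.b_ge
  have hε := h.ε_pos
  have hεb : 0 ≤ ε * b := by positivity
  induction hE with
  | root =>
    constructor <;>
    simp only [h.P_zero, h.Q_zero, h.H_zero, h.P_one, h.Q_one, h.H_one] <;>
    norm_num <;> positivity
  | @left u w hE ih =>
    obtain ⟨hu, hw⟩ := h.vertexBound hE
    obtain ⟨eP, eQ, eH, ⟨hP, hQ, hH⟩, h1, h2, h3⟩ := h.exists_step hE (v := u) (.inl rfl)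
    have hn : (2 : ℝ) ≤ u.1 + w.1 := by linarith [hu.one_le, hw.one_le]
    have hnn : (u.1 + w.1 : ℝ) + 1 ≤ (u.1 : ℝ) + (((u + w).1 : ℤ) : ℝ) := by
      rw [Prod.fst_add]; push_cast; linarith [hu.one_le]
    constructor
    · convert abs_add_sub_le_of_step hε.le hn hnn h1 ih.PQ using 2
      rw [hP, hQ]; ring
    · convert abs_add_sub_le_of_step hεb hn hnn h2 ih.HQ using 2
      rw [hH, hQ]; ring
    · convert abs_add_sub_le_of_step hεb hn hnn (by rwa [abs_neg]) ih.PH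
        (E := -(P u * eH + H u * eP)) using 2
      rw [hH, hP]; ring
  | @right u w hE ih =>
    obtain ⟨hu, hw⟩ := h.vertexBound hE
    obtain ⟨eP, eQ, eH, ⟨hP, hQ, hH⟩, h1, h2, h3⟩ := h.exists_step hE (v := w) (.inr rfl)
    have hn : (2 : ℝ) ≤ u.1 + w.1 := by linarith [hu.one_le, hw.one_le]
    have hnn : (u.1 + w.1 : ℝ) + 1 ≤ (((u + w).1 : ℤ) : ℝ) + (w.1 : ℝ) := by
      rw [Prod.fst_add]; push_cast; linarith [hw.one_le]
    constructor
    · convert abs_add_sub_le_of_step hε.le hn hnn (by rwa [abs_neg]) ih.PQ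
        (E := -(P w * eQ - Q w * eP)) using 2
      rw [hP, hQ]; ring
    · convert abs_add_sub_le_of_step hεb hn hnn (by rwa [abs_neg]) ih.HQ
        (E := -(H w * eQ + Q w * eH)) using 2
      rw [hH, hQ]; ring
    · convert abs_add_sub_le_of_step hεb hn hnn h3 ih.PH using 2
      rw [hH, hP]; ring

end ArcRec

/-! ### Limits along the neighbours of a slope -/

open Filter Topology in
/-- The traces along the neighbours of a fixed slope satisfy a linear recursion, which is solved
explicitly; the product of the two coefficients is determined by the boundary trace. -/
theorem exists_fan_limits {T : ℤ → ℝ} {L κ : ℝ} (hL : 0 < L) (hκ : 0 < κ)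
    (hT : ∀ j, T (j + 1) + T (j - 1) = 2 * Real.cosh L * T j) (h0 : 0 < T 0)
    (hK : T 0 ^ 2 + (2 * Real.cosh L) ^ 2 + T 1 ^ 2 - T 0 * (2 * Real.cosh L) * T 1 = 4 - 4 * κ) :
    ∃ α β : ℝ, 0 < α ∧ 0 < β ∧
      (∀ j, T j = α * Real.exp L ^ j + β * Real.exp L ^ (-j)) ∧
      α * β = 1 + κ / Real.sinh L ^ 2 := by
  have hs : 0 < Real.sinh L := Real.sinh_pos_iff.2 hL
  have hc : Real.cosh L ^ 2 = Real.sinh L ^ 2 + 1 := by rw [Real.cosh_sq]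
  have he : Real.exp L = Real.cosh L + Real.sinh L := (Real.cosh_add_sinh L).symm
  have he' : (Real.exp L)⁻¹ = Real.cosh L - Real.sinh L := by
    rw [← Real.exp_neg, Real.cosh_sub_sinh]
  have hepos := Real.exp_pos L
  set α := (T 1 - T 0 * (Real.exp L)⁻¹) / (2 * Real.sinh L) with hα
  set β := (T 0 * Real.exp L - T 1) / (2 * Real.sinh L) with hβ
  have hab : α + β = T 0 := by
    rw [hα, hβ, he', he]; field_simp; ring
  have hab1 : α * Real.exp L + β * (Real.exp L)⁻¹ = T 1 := by
    rw [hα, hβ, he', he]; field_simp; ring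
  have hprod : α * β = 1 + κ / Real.sinh L ^ 2 := by
    rw [hα, hβ, he', he]; field_simp
    linear_combination (4 - T 0 ^ 2) * hc - hK
  have hpos : 0 < α * β := by rw [hprod]; positivity
  have hαβ : 0 < α ∧ 0 < β := by
    rcases pos_and_pos_or_neg_and_neg_of_mul_pos hpos with h | h
    · exact h
    · linarith [h.1, h.2]
  refine ⟨α, β, hαβ.1, hαβ.2, ?_, hprod⟩
  have hrec : ∀ j : ℤ, α * Real.exp L ^ (j + 1) + β * Real.exp L ^ (-(j + 1)) +
      (α * Real.exp L ^ (j - 1) + β * Real.exp L ^ (-(j - 1))) =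
      2 * Real.cosh L * (α * Real.exp L ^ j + β * Real.exp L ^ (-j)) := by
    intro j
    have e1 : Real.exp L ^ (j + 1) = Real.exp L ^ j * Real.exp L := zpow_add_one₀ hepos.ne' j
    have e2 : Real.exp L ^ (j - 1) = Real.exp L ^ j * (Real.exp L)⁻¹ := zpow_sub_one₀ hepos.ne' j
    have e3 : Real.exp L ^ (-(j + 1)) = Real.exp L ^ (-j) * (Real.exp L)⁻¹ := by
      rw [neg_add, ← sub_eq_add_neg, zpow_sub_one₀ hepos.ne']
    have e4 : Real.exp L ^ (-(j - 1)) = Real.exp L ^ (-j) * Real.exp L := by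
      rw [neg_sub, sub_eq_neg_add, zpow_add_one₀ hepos.ne']
    rw [e1, e2, e3, e4, he', he]
    ring
  have key : ∀ j : ℤ, T j = α * Real.exp L ^ j + β * Real.exp L ^ (-j) ∧
      T (j + 1) = α * Real.exp L ^ (j + 1) + β * Real.exp L ^ (-(j + 1)) := by
    intro j
    induction j using Int.induction_on with
    | zero => simp [hab, hab1]
    | succ n ih =>
      refine ⟨ih.2, ?_⟩
      have h1 := hT (n + 1)
      have h2 := hrec (n + 1)
      rw [show (n : ℤ) + 1 - 1 = n by ring] at h1 h2
      rw [ih.1, ih.2] at h1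
      linarith
    | pred n ih =>
      have h1 := hT (-n)
      have h2 := hrec (-n)
      rw [ih.1, ih.2] at h1
      refine ⟨by linarith, ?_⟩
      rw [sub_add_cancel]
      exact ih.1
  exact fun j => (key j).1

open Filter Topology in
/-- If the traces are sums of exponentials, the half lengths grow linearly, up to a convergent error
given by the leading coefficient. -/
theorem tendsto_sub_of_exp_sum {h : ℕ → ℝ} {L α β : ℝ} (hL : 0 < L) (hα : 0 < α) (n : ℤ)
    (hpos : ∀ k, 0 ≤ h k)
    (hT : ∀ k : ℕ, 2 * Real.cosh (h k) =
      α * Real.exp L ^ ((k : ℤ) + n) + β * Real.exp L ^ (-((k : ℤ) + n))) :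
    Tendsto (fun k : ℕ => h k - k * L) atTop (𝓝 (Real.log α + n * L)) := by
  have hepos := Real.exp_pos L
  have hz : ∀ m : ℤ, Real.exp L ^ m = Real.exp (m * L) := fun m => by
    rw [← Real.rpow_intCast, ← Real.exp_mul, mul_comm]
  have e1 : ∀ k : ℕ, Real.exp (h k - k * L) = α * Real.exp (n * L) +
      β * Real.exp (-(n * L)) * Real.exp (-(2 * L)) ^ k - Real.exp (-h k) * Real.exp (-L) ^ k := by
    intro k
    have h1 := hT k
    rw [Real.cosh_eq, hz, hz] at h1
    have h2 : Real.exp (h k) = α * Real.exp (((k + n : ℤ) : ℝ) * L) +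
        β * Real.exp (((-(k + n) : ℤ) : ℝ) * L) - Real.exp (-h k) := by linarith
    have h3 : Real.exp (h k - k * L) = Real.exp (h k) * Real.exp (-(k * L)) := by
      rw [← Real.exp_add]; rfl
    have h4 : Real.exp (((k + n : ℤ) : ℝ) * L) * Real.exp (-(k * L)) = Real.exp (n * L) := by
      rw [← Real.exp_add]; congr 1; push_cast; ring
    have h5 : Real.exp (((-(k + n) : ℤ) : ℝ) * L) * Real.exp (-(k * L)) =
        Real.exp (-(n * L)) * Real.exp (-(2 * L)) ^ k := by
      rw [← Real.exp_nat_mul, ← Real.exp_add, ← Real.exp_add]; congr 1; push_cast; ring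
    have h6 : Real.exp (-(k * L)) = Real.exp (-L) ^ k := by
      rw [← Real.exp_nat_mul]; congr 1; ring
    rw [h3, h2, sub_mul, add_mul, mul_assoc, mul_assoc, h4, h5, h6]
    ring
  have e2 : Tendsto (fun k : ℕ => Real.exp (-(2 * L)) ^ k) atTop (𝓝 0) :=
    tendsto_pow_atTop_nhds_zero_of_lt_one (Real.exp_pos _).le (Real.exp_lt_one_iff.2 (by linarith))
  have e3 : Tendsto (fun k : ℕ => Real.exp (-h k) * Real.exp (-L) ^ k) atTop (𝓝 0) := by
    have e4 : Tendsto (fun k : ℕ => Real.exp (-L) ^ k) atTop (𝓝 0) :=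
      tendsto_pow_atTop_nhds_zero_of_lt_one (Real.exp_pos _).le (Real.exp_lt_one_iff.2 (by linarith))
    refine squeeze_zero (fun k => by positivity) (fun k => ?_) e4
    exact mul_le_of_le_one_left (by positivity) (Real.exp_le_one_iff.2 (by linarith [hpos k]))
  have e5 : Tendsto (fun k : ℕ => Real.exp (h k - k * L)) atTop (𝓝 (α * Real.exp (n * L))) := by
    have := ((e2.const_mul (β * Real.exp (-(n * L)))).const_add (α * Real.exp (n * L))).sub e3
    simp only [mul_zero, add_zero, sub_zero] at this
    exact this.congr fun k => (e1 k).symm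
  have hne : α * Real.exp (n * L) ≠ 0 := by positivity
  have e6 := (Real.continuousAt_log hne).tendsto.comp e5
  rw [Real.log_mul hα.ne' (Real.exp_pos _).ne', Real.log_exp] at e6
  exact e6.congr fun k => Real.log_exp _

theorem FareyEdge.add_nsmul_left {u w : ℤ × ℤ} (h : FareyEdge u w) (k : ℕ) :
    FareyEdge u (w + k • u) := by
  induction k with
  | zero => simpa using h
  | succ k ih =>
    have := ih.left
    rwa [show u + (w + k • u) = w + (k + 1) • u by rw [succ_nsmul]; abel] at this

theorem FareyEdge.add_nsmul_right {u w : ℤ × ℤ} (h : FareyEdge u w) (k : ℕ) :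
    FareyEdge (u + k • w) w := by
  induction k with
  | zero => simpa using h
  | succ k ih =>
    have := ih.right
    rwa [show u + k • w + w = u + (k + 1) • w by rw [succ_nsmul]; abel] at this

/-- The neighbours of `s` differ by multiples of `s`, up to sign. -/
theorem FareyEdge.add_eq {r s t : ℤ × ℤ} (h1 : FareyEdge r s) (h2 : FareyEdge s t) :
    r + t = (r.1 * t.2 - r.2 * t.1) • s := by
  have d1 := h1.det
  have d2 := h2.det
  ext
  · simp only [Prod.fst_add, Prod.smul_fst, smul_eq_mul]
    linear_combination (-t.1) * d1 - r.1 * d2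
  · simp only [Prod.snd_add, Prod.smul_snd, smul_eq_mul]
    linear_combination (-t.2) * d1 - r.2 * d2

namespace ArcTrace

variable {a b x y : ℝ} {t : ℤ × ℤ → ℝ} {u w : ℤ × ℤ}

theorem one_le_left (h : ArcTrace a b x y t) (hE : FareyEdge u w) : 1 ≤ halfLength t u :=
  (h.triple hE).one_le_x

theorem one_le_right (h : ArcTrace a b x y t) (hE : FareyEdge u w) : 1 ≤ halfLength t w :=
  (h.triple hE).one_le_y

theorem defect_nonneg (h : ArcTrace a b x y t) (hE : FareyEdge u w) :
    0 ≤ halfLength t u + halfLength t w - halfLength t (u + w) := by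
  linarith [(h.triple hE).lt_add]

open Filter Topology in
/-- The half lengths of the neighbours `v + k s` and `r + k s` of a slope `s`, on both sides of it,
grow like `k` times the half length at `s`, up to convergent errors. The neighbours on both
sides form a single two-sided sequence up to sign, so that the sum of the limits is determined by
the boundary trace. -/
theorem fan (h : ArcTrace a b x y t) {r s v : ℤ × ℤ} (h1 : FareyEdge r s) (h2 : FareyEdge s v) :
    ∃ α β : ℝ,
      Tendsto (fun k : ℕ => halfLength t (v + k • s) - k * halfLength t s) atTop (𝓝 α) ∧
      Tendsto (fun k : ℕ => halfLength t (r + k • s) - k * halfLength t s) atTop (𝓝 β) ∧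
      α + β - ((r.1 * v.2 - r.2 * v.1 : ℤ) : ℝ) * halfLength t s =
        Real.log (1 + boundaryParam a b / Real.sinh (halfLength t s) ^ 2) := by
  have hL := h.one_le_left h2
  have hκ := boundaryParam_pos (four_le_of_arcError_le h.err) h.lt
  have hc := h.eq_cosh_left h2
  set N : ℤ := r.1 * v.2 - r.2 * v.1 with hN
  have hr : r = N • s - v := by rw [hN, ← h1.add_eq h2]; abel
  obtain ⟨α, β, hα, hβ, hform, hprod⟩ := exists_fan_limits (T := fun j : ℤ => t (v + j • s))
    (L := halfLength t s) (κ := boundaryParam a b) (by linarith) hκ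
    (by
      intro j
      have := h.markov.add_sub s (v + j • s) (by
        have := h2.det
        simp only [Prod.fst_add, Prod.snd_add, Prod.smul_fst, Prod.smul_snd, smul_eq_mul]
        linear_combination this)
      rw [hc.symm]
      have e1 : s + (v + j • s) = v + (j + 1) • s := by rw [add_smul, one_smul]; abel
      have e2 : t (s - (v + j • s)) = t (v + (j - 1) • s) := by
        rw [← h.markov.even (v + (j - 1) • s)]; congr 1; rw [sub_smul, one_smul]; abel
      rw [e1, e2] at this
      exact this)
    (by
      simp only [zero_smul, add_zero]
      rw [h.eq_cosh_right h2]
      linarith [Real.one_le_cosh (halfLength t v)])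
    (by
      have := h.boundary_edge h2
      simp only [zero_smul, add_zero, one_smul]
      rw [← this, hc.symm, add_comm v s]
      ring)
  refine ⟨Real.log α, Real.log β + N * halfLength t s, ?_, ?_, ?_⟩
  · have := tendsto_sub_of_exp_sum (h := fun k => halfLength t (v + k • s)) (β := β)
      (L := halfLength t s)
      (by linarith) hα 0 (fun k => by linarith [h.one_le_right (h2.add_nsmul_left k)])
      (fun k => by
        rw [← h.eq_cosh_right (h2.add_nsmul_left k), add_zero, ← hform, natCast_zsmul])
    simpa using this
  · refine tendsto_sub_of_exp_sum (h := fun k => halfLength t (r + k • s)) (β := α)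
      (L := halfLength t s)
      (by linarith) hβ N (fun k => by linarith [h.one_le_left (h1.add_nsmul_right k)])
      (fun k => ?_)
    rw [← h.eq_cosh_left (h1.add_nsmul_right k)]
    have := hform (-((k : ℤ) + N))
    rw [neg_neg] at this
    rw [add_comm (β * _) (α * _), ← this, ← h.markov.even]
    congr 1
    rw [hr, neg_smul, add_smul, natCast_zsmul]
    abel
  · rw [← hprod, Real.log_mul hα.ne' hβ.ne']
    ring

/-- The defect of the structure with the smaller half lengths is larger, by an amount controlled by
the differences of the half lengths. -/
theorem defect_compare {x' y' : ℝ} {t' : ℤ × ℤ → ℝ} (h : ArcTrace a b x y t)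
    (h' : ArcTrace a b x' y' t') (hE : FareyEdge u w) (hu : halfLength t u ≤ halfLength t' u)
    (hw : halfLength t w ≤ halfLength t' w) :
    halfLength t' u + halfLength t' w - halfLength t' (u + w) ≤
      halfLength t u + halfLength t w - halfLength t (u + w) ∧
    (halfLength t u + halfLength t w - halfLength t (u + w)) -
      (halfLength t' u + halfLength t' w - halfLength t' (u + w)) ≤
      defectBound a (u + w).1 *
        ((halfLength t' u - halfLength t u) + (halfLength t' w - halfLength t w)) := by
  have hs := h.sinh_defect_le hE
  have h4 := four_le_of_arcError_le h.err
  have hn : (2 : ℝ) ≤ ((u + w).1 : ℤ) := by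
    have := hE.mem_cone
    have : (2 : ℤ) ≤ (u + w).1 := by simp only [Prod.fst_add]; omega
    exact_mod_cast this
  have hd := defectBound_mul_le h4 hn
  have hd0 := defectBound_pos a ((u + w).1 : ℤ)
  have hd1 : defectBound a ((u + w).1 : ℤ) ≤ 1 / 4 := by
    have h1 : arcError a / ((((u + w).1 : ℤ) : ℝ) * (((u + w).1 : ℤ) + 1)) ≤ arcError a :=
      div_le_self (arcError_pos a).le (by nlinarith)
    have := h.err
    nlinarith
  refine ⟨(h.triple hE).defect_anti (h'.triple hE) hu hw, ?_⟩
  refine ((h.triple hE).defect_lipschitz (h'.triple hE) hu hw (by linarith)).trans ?_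
  exact mul_le_mul_of_nonneg_right hs (by linarith)

end ArcTrace

/-! ### Three structures and local convexity -/

/-- The determinant of three vectors of `ℝ³`. -/
def det3 (u v w : Fin 3 → ℝ) : ℝ :=
  u 0 * (v 1 * w 2 - v 2 * w 1) - u 1 * (v 0 * w 2 - v 2 * w 0) + u 2 * (v 0 * w 1 - v 1 * w 0)

/-- The coordinates of a vector of `ℝ³` in the basis formed by the three vectors
`sideLengths a b k`. -/
noncomputable def bary (a b : ℝ) (v : Fin 3 → ℝ) : Fin 3 → ℝ :=
  fun i => (b * ((v 0 + v 1 + v 2) / (a + 2 * b)) - v i) / (b - a)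

/-- The traces of three hyperbolic structures with the half lengths prescribed at the slopes `0`,
`1` and `∞`, and `a` so large that the deviations from additivity are small. On the arc of slopes
in `[0, 1]`, the third structure has the largest half lengths. -/
structure Arc (a b : ℝ) (t : Fin 3 → ℤ × ℤ → ℝ) : Prop where
  markov : ∀ i, IsMarkov (t i)
  err : arcError a ≤ 1 / 4
  lt : a < b
  zero : ∀ i, t i (1, 0) = 2 * Real.cosh (sideLengths a b 0 i)
  one : ∀ i, t i (1, 1) = 2 * Real.cosh (sideLengths a b 1 i)
  infty : ∀ i, t i (0, 1) = 2 * Real.cosh (sideLengths a b 2 i)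

/-- The vector of the three half lengths. -/
noncomputable def lengths (t : Fin 3 → ℤ × ℤ → ℝ) (v : ℤ × ℤ) : Fin 3 → ℝ :=
  fun i => halfLength (t i) v

namespace Arc

variable {a b : ℝ} {t : Fin 3 → ℤ × ℤ → ℝ} {u w : ℤ × ℤ}

theorem four_le (h : Arc a b t) : 4 ≤ a := four_le_of_arcError_le h.err

theorem arcTrace (h : Arc a b t) (i : Fin 3) :
    ArcTrace a b (sideLengths a b 0 i) (sideLengths a b 1 i) (t i) := by
  have h4 := h.four_le
  have hab := h.lt
  have ha : 1 ≤ Real.cosh a := Real.one_le_cosh a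
  have hb : 1 ≤ Real.cosh b := Real.one_le_cosh b
  have hle : Real.cosh a ≤ Real.cosh b := by
    rw [Real.cosh_le_cosh, abs_of_pos (by linarith), abs_of_pos (by linarith)]; exact hab.le
  refine ⟨h.markov i, h.err, hab, ?_, ?_, ?_, h.zero i, h.one i, ?_, ?_⟩
  · fin_cases i <;> simp [sideLengths] <;> linarith
  · fin_cases i <;> simp [sideLengths] <;> linarith
  · fin_cases i <;> simp [sideLengths] <;> linarith
  · rw [h.infty]
    fin_cases i <;> simp [sideLengths] <;> nlinarith
  · rw [h.infty, h.zero, h.one]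
    unfold boundaryParam
    fin_cases i <;> simp [sideLengths] <;> ring

theorem lengths_zero (h : Arc a b t) : lengths t (1, 0) = sideLengths a b 0 := by
  funext i
  have := (h.arcTrace i).le_x
  rw [lengths, halfLength, h.zero, mul_div_cancel_left₀ _ two_ne_zero,
    Real.arcosh_cosh (by linarith [h.four_le])]

theorem lengths_one (h : Arc a b t) : lengths t (1, 1) = sideLengths a b 1 := by
  funext i
  have := (h.arcTrace i).le_y
  rw [lengths, halfLength, h.one, mul_div_cancel_left₀ _ two_ne_zero,
    Real.arcosh_cosh (by linarith [h.four_le])]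

theorem two_le_fst (hE : FareyEdge u w) : (2 : ℝ) ≤ ((u + w).1 : ℤ) := by
  have := hE.mem_cone
  have : (2 : ℤ) ≤ (u + w).1 := by simp only [Prod.fst_add]; omega
  exact_mod_cast this

theorem defect_le (h : Arc a b t) (hE : FareyEdge u w) (i : Fin 3) :
    lengths t u i + lengths t w i - lengths t (u + w) i ≤ defectBound a (u + w).1 := by
  have h1 := (h.arcTrace i).sinh_defect_le hE
  have h2 := (h.arcTrace i).defect_nonneg hE
  have h3 := Real.self_le_sinh_iff.2 (show 0 ≤ (halfLength (t i) u + halfLength (t i) w -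
    halfLength (t i) (u + w)) / 2 by linarith)
  simp only [lengths]
  linarith

/-- The increments of the normalised differences of half lengths. -/
theorem diff_add (h : Arc a b t) (hE : FareyEdge u w) (i : Fin 3)
    (hu : 0 ≤ (lengths t u 2 - lengths t u i) / (b - a))
    (hw : 0 ≤ (lengths t w 2 - lengths t w i) / (b - a)) :
    (lengths t u 2 - lengths t u i) / (b - a) + (lengths t w 2 - lengths t w i) / (b - a) ≤
      (lengths t (u + w) 2 - lengths t (u + w) i) / (b - a) ∧
    (lengths t (u + w) 2 - lengths t (u + w) i) / (b - a) ≤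
      (lengths t u 2 - lengths t u i) / (b - a) + (lengths t w 2 - lengths t w i) / (b - a) +
      defectBound a (u + w).1 * ((lengths t u 2 - lengths t u i) / (b - a) +
        (lengths t w 2 - lengths t w i) / (b - a)) := by
  have hη : 0 < b - a := by linarith [h.lt]
  rw [le_div_iff₀ hη, zero_mul] at hu hw
  obtain ⟨h1, h2⟩ := (h.arcTrace i).defect_compare (h.arcTrace 2) hE
    (by simp only [lengths] at hu; linarith) (by simp only [lengths] at hw; linarith)
  rw [← add_div, ← mul_div_assoc, ← add_div]
  simp only [lengths] at *
  constructor
  · exact div_le_div_of_nonneg_right (by linarith) hη.le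
  · exact div_le_div_of_nonneg_right (by linarith) hη.le

/-- The half lengths of the three structures, in the form of `ArcRec`. The differences are
superadditive because the defect decreases with the lengths. -/
theorem arcRec (h : Arc a b t) :
    ArcRec b (arcError a) (defectBound a) (fun v => (lengths t v 2 - lengths t v 0) / (b - a))
      (fun v => (lengths t v 2 - lengths t v 1) / (b - a)) (fun v => lengths t v 2) := by
  have hη : 0 < b - a := by linarith [h.lt]
  have h4 := h.four_le
  constructor
  · linarith [h.lt]
  · exact arcError_pos a
  · exact h.err
  · exact defectBound_pos a
  · exact fun n hn => defectBound_mul_le h4 hn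
  · simp only [h.lengths_zero, sideLengths]; simp [div_self hη.ne']
  · simp only [h.lengths_zero, sideLengths]; simp
  · simp only [h.lengths_zero, sideLengths]; simp
  · simp only [h.lengths_one, sideLengths]; simp
  · simp only [h.lengths_one, sideLengths]; simp [div_self hη.ne']
  · simp only [h.lengths_one, sideLengths]; simp
  · exact fun hE hu hw => h.diff_add hE 0 hu hw
  · exact fun hE hu hw => h.diff_add hE 1 hu hw
  · intro u w hE
    have h1 := h.defect_le hE 2
    have h2 := (h.arcTrace 2).defect_nonneg hE
    simp only [lengths] at *
    constructor <;> linarith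
  · intro u w hE
    have h1 := (h.arcTrace 2).one_le_left hE
    have h2 := (h.arcTrace 2).one_le_right hE
    simp only [lengths]
    constructor <;> linarith

/-- The minors of the vectors of half lengths at the ends of an edge, after the other two
coordinates have been subtracted from the third one. -/
theorem minors (h : Arc a b t) (hE : FareyEdge u w) :
    (b - a) ^ 2 * (3 / 4) ≤ (lengths t u 2 - lengths t u 0) * (lengths t w 2 - lengths t w 1) -
        (lengths t u 2 - lengths t u 1) * (lengths t w 2 - lengths t w 0) ∧
    0 < lengths t u 2 * (lengths t w 2 - lengths t w 1) -
        (lengths t u 2 - lengths t u 1) * lengths t w 2 ∧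
    0 < (lengths t u 2 - lengths t u 0) * lengths t w 2 -
        lengths t u 2 * (lengths t w 2 - lengths t w 0) := by
  have hη : 0 < b - a := by linarith [h.lt]
  have hb : 0 < b := by linarith [h.lt, h.four_le]
  obtain ⟨h1, h2, h3⟩ := h.arcRec.edgeBound hE
  have hn := two_le_fst hE
  rw [Prod.fst_add, Int.cast_add] at hn
  have hε := arcError_pos a
  have hε' := h.err
  have hfac : arcError a * (1 - 1 / (u.1 + w.1 : ℝ)) ≤ 1 / 4 := by
    have : 0 ≤ 1 / (u.1 + w.1 : ℝ) := by positivity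
    nlinarith
  have hfac' : arcError a * b * (1 - 1 / (u.1 + w.1 : ℝ)) ≤ b / 4 := by nlinarith
  have e1 := (abs_le.1 h1).1
  have e2 := (abs_le.1 h2).1
  have e3 := (abs_le.1 h3).1
  refine ⟨?_, ?_, ?_⟩
  · have : (lengths t u 2 - lengths t u 0) * (lengths t w 2 - lengths t w 1) -
        (lengths t u 2 - lengths t u 1) * (lengths t w 2 - lengths t w 0) = (b - a) ^ 2 *
        ((lengths t u 2 - lengths t u 0) / (b - a) * ((lengths t w 2 - lengths t w 1) / (b - a)) -
        (lengths t u 2 - lengths t u 1) / (b - a) * ((lengths t w 2 - lengths t w 0) / (b - a))) := by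
      field_simp
    rw [this]
    exact mul_le_mul_of_nonneg_left (by linarith) (by positivity)
  · have : lengths t u 2 * (lengths t w 2 - lengths t w 1) -
        (lengths t u 2 - lengths t u 1) * lengths t w 2 = (b - a) *
        (lengths t u 2 * ((lengths t w 2 - lengths t w 1) / (b - a)) -
        (lengths t u 2 - lengths t u 1) / (b - a) * lengths t w 2) := by
      field_simp
    rw [this]
    exact mul_pos hη (by linarith)
  · have : (lengths t u 2 - lengths t u 0) * lengths t w 2 -
        lengths t u 2 * (lengths t w 2 - lengths t w 0) = (b - a) *
        ((lengths t u 2 - lengths t u 0) / (b - a) * lengths t w 2 -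
        lengths t u 2 * ((lengths t w 2 - lengths t w 0) / (b - a))) := by
      field_simp
    rw [this]
    exact mul_pos hη (by linarith)

/-- A vector whose last coordinate is positive and not larger than the other ones lies on the
positive side of every edge. -/
theorem minor_le_det3 (h : Arc a b t) (hE : FareyEdge u w) {e : Fin 3 → ℝ} (h0 : e 2 ≤ e 0)
    (h1 : e 2 ≤ e 1) :
    e 2 * ((lengths t u 2 - lengths t u 0) * (lengths t w 2 - lengths t w 1) -
        (lengths t u 2 - lengths t u 1) * (lengths t w 2 - lengths t w 0)) ≤
      det3 e (lengths t u) (lengths t w) := by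
  obtain ⟨-, h4, h5⟩ := h.minors hE
  have e1 := mul_nonneg (sub_nonneg.2 h0) h4.le
  have e2 := mul_nonneg (sub_nonneg.2 h1) h5.le
  unfold det3
  nlinarith

theorem lengths_le (h : Arc a b t) (hE : FareyEdge u w) :
    (lengths t u 0 ≤ lengths t u 2 ∧ lengths t u 1 ≤ lengths t u 2) ∧
    (lengths t w 0 ≤ lengths t w 2 ∧ lengths t w 1 ≤ lengths t w 2) := by
  have hη : 0 < b - a := by linarith [h.lt]
  obtain ⟨h1, h2⟩ := h.arcRec.vertexBound hE
  have a1 := h1.P_nonneg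
  have a2 := h1.Q_nonneg
  have a3 := h2.P_nonneg
  have a4 := h2.Q_nonneg
  rw [le_div_iff₀ hη, zero_mul] at a1 a2 a3 a4
  refine ⟨⟨?_, ?_⟩, ?_, ?_⟩ <;> linarith

open Filter Topology in
/-- The limit directions `α` and `β` of the neighbours of an interior slope `s`, on both sides of it.
Modulo the vector at `s`, their sum is the vector `F` with the coordinates
`log (1 + κ / sinh² (halfLength s))`, which is smallest for the largest half length. -/
theorem exists_limits (h : Arc a b t) {r s v : ℤ × ℤ} (h1 : FareyEdge r s) (h2 : FareyEdge s v) :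
    ∃ α β F : Fin 3 → ℝ,
      Tendsto (fun k : ℕ => lengths t (v + k • s) - (k : ℝ) • lengths t s) atTop (𝓝 α) ∧
      Tendsto (fun k : ℕ => lengths t (r + k • s) - (k : ℝ) • lengths t s) atTop (𝓝 β) ∧
      α + β - ((r.1 * v.2 - r.2 * v.1 : ℤ) : ℝ) • lengths t s = F ∧
      (0 < F 2 ∧ F 2 ≤ F 0 ∧ F 2 ≤ F 1) ∧
      (∀ i, α i - α 2 ≤ lengths t v i - lengths t v 2 ∧
        β i - β 2 ≤ lengths t r i - lengths t r 2) ∧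
      α 2 ≤ lengths t v 2 ∧ β 2 ≤ lengths t r 2 := by
  choose α β hα hβ hF using fun i => (h.arcTrace i).fan h1 h2
  have hκ := boundaryParam_pos h.four_le h.lt
  have hs : ∀ i, 1 ≤ lengths t s i := fun i => (h.arcTrace i).one_le_left h2
  have hle : ∀ i, lengths t s i ≤ lengths t s 2 := by
    intro i
    have := (h.lengths_le h2).1
    fin_cases i
    exacts [this.1, this.2, le_rfl]
  have hlog : ∀ i, Real.log (1 + boundaryParam a b / Real.sinh (halfLength (t 2) s) ^ 2) ≤
      Real.log (1 + boundaryParam a b / Real.sinh (halfLength (t i) s) ^ 2) := by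
    intro i
    have h3 : 0 < Real.sinh (halfLength (t i) s) :=
      Real.sinh_pos_iff.2 (by have := hs i; simp only [lengths] at this; linarith)
    have h4 : Real.sinh (halfLength (t i) s) ≤ Real.sinh (halfLength (t 2) s) :=
      Real.sinh_le_sinh.2 (hle i)
    refine Real.log_le_log (by positivity) ?_
    gcongr
  have hpos : 0 < Real.log (1 + boundaryParam a b / Real.sinh (halfLength (t 2) s) ^ 2) := by
    have h3 : 0 < Real.sinh (halfLength (t 2) s) :=
      Real.sinh_pos_iff.2 (by have := hs 2; simp only [lengths] at this; linarith)
    refine Real.log_pos ?_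
    have : 0 < boundaryParam a b / Real.sinh (halfLength (t 2) s) ^ 2 := by positivity
    linarith
  -- the defects along the fan decrease with the lengths, so that the differences to the third half
  -- length, after subtraction of the linear growth, are monotonic
  have hmono : ∀ i, Antitone (fun k : ℕ =>
      (halfLength (t i) (v + k • s) - k * halfLength (t i) s) -
      (halfLength (t 2) (v + k • s) - k * halfLength (t 2) s)) ∧ Antitone (fun k : ℕ =>
      (halfLength (t i) (r + k • s) - k * halfLength (t i) s) -
      (halfLength (t 2) (r + k • s) - k * halfLength (t 2) s)) := by
    intro i
    constructor
    · refine antitone_nat_of_succ_le fun k => ?_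
      have hE := h2.add_nsmul_left k
      have hw : lengths t (v + k • s) i ≤ lengths t (v + k • s) 2 := by
        have := (h.lengths_le hE).2
        fin_cases i
        exacts [this.1, this.2, le_rfl]
      have := ((h.arcTrace i).defect_compare (h.arcTrace 2) hE (hle i) hw).1
      have e : s + (v + k • s) = v + (k + 1) • s := by rw [succ_nsmul]; abel
      rw [e] at this
      push_cast
      linarith
    · refine antitone_nat_of_succ_le fun k => ?_
      have hE := h1.add_nsmul_right k
      have hw : lengths t (r + k • s) i ≤ lengths t (r + k • s) 2 := by
        have := (h.lengths_le hE).1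
        fin_cases i
        exacts [this.1, this.2, le_rfl]
      have := ((h.arcTrace i).defect_compare (h.arcTrace 2) hE hw (hle i)).1
      have e : r + k • s + s = r + (k + 1) • s := by rw [succ_nsmul]; abel
      rw [e] at this
      push_cast
      linarith
  have hmono2 : Antitone (fun k : ℕ => halfLength (t 2) (v + k • s) - k * halfLength (t 2) s) ∧
      Antitone (fun k : ℕ => halfLength (t 2) (r + k • s) - k * halfLength (t 2) s) := by
    constructor
    · refine antitone_nat_of_succ_le fun k => ?_
      have := (h.arcTrace 2).defect_nonneg (h2.add_nsmul_left k)
      have e : s + (v + k • s) = v + (k + 1) • s := by rw [succ_nsmul]; abel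
      rw [e] at this
      push_cast
      linarith
    · refine antitone_nat_of_succ_le fun k => ?_
      have := (h.arcTrace 2).defect_nonneg (h1.add_nsmul_right k)
      have e : r + k • s + s = r + (k + 1) • s := by rw [succ_nsmul]; abel
      rw [e] at this
      push_cast
      linarith
  refine ⟨α, β, fun i => Real.log (1 + boundaryParam a b / Real.sinh (halfLength (t i) s) ^ 2),
    tendsto_pi_nhds.2 hα, tendsto_pi_nhds.2 hβ, funext hF, ⟨hpos, hlog 0, hlog 1⟩, ?_, ?_, ?_⟩
  · intro i
    constructor
    · simpa [lengths] using (hmono i).1.le_of_tendsto ((hα i).sub (hα 2)) 0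
    · simpa [lengths] using (hmono i).2.le_of_tendsto ((hβ i).sub (hβ 2)) 0
  · simpa [lengths] using hmono2.1.le_of_tendsto (hα 2) 0
  · simpa [lengths] using hmono2.2.le_of_tendsto (hβ 2) 0

/-- The determinant of two vectors and a third one that is their sum up to a correction `s`. -/
theorem det3_eq_of_add {u v w s : Fin 3 → ℝ} (c : ℝ) (h : u + w - c • v = s) :
    det3 u v w = det3 s u v := by
  subst h
  simp only [det3, Pi.sub_apply, Pi.add_apply, Pi.smul_apply, smul_eq_mul]
  ring

/-- Local convexity: three successive neighbours are in convex position. The vectors at `r` and `v`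
add up to a multiple of the vector at `s` and a correction, which by monotonicity along the two fans
satisfies the same inequalities as the sum of the limit directions. -/
theorem det3_pos_of_edges (h : Arc a b t) {r s v : ℤ × ℤ} (h1 : FareyEdge r s)
    (h2 : FareyEdge s v) : 0 < det3 (lengths t r) (lengths t s) (lengths t v) := by
  obtain ⟨α, β, F, -, -, hF, ⟨f1, f2, f3⟩, hi, hα, hβ⟩ := h.exists_limits h1 h2
  rw [det3_eq_of_add ((r.1 * v.2 - r.2 * v.1 : ℤ) : ℝ) rfl]
  have g : ∀ i, F i = α i + β i - ((r.1 * v.2 - r.2 * v.1 : ℤ) : ℝ) * lengths t s i := fun i => by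
    rw [← hF]; simp
  refine lt_of_lt_of_le ?_ (h.minor_le_det3 h1 ?_ ?_)
  · have hη : 0 < b - a := by linarith [h.lt]
    refine mul_pos ?_ (lt_of_lt_of_le (by positivity) (h.minors h1).1)
    have := g 2
    simp only [Pi.add_apply, Pi.sub_apply, Pi.smul_apply, smul_eq_mul]
    linarith
  · have := g 2
    have := g 0
    have := hi 0
    simp only [Pi.add_apply, Pi.sub_apply, Pi.smul_apply, smul_eq_mul]
    linarith
  · have := g 2
    have := g 1
    have := hi 1
    simp only [Pi.add_apply, Pi.sub_apply, Pi.smul_apply, smul_eq_mul]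
    linarith

end Arc

/-! ### Barycentric coordinates -/

/-- The vector with the coordinates `bary a b v` in the basis `sideLengths a b k` is `v`. -/
theorem bary_spec {a b : ℝ} (hab : a ≠ b) (hb : a + 2 * b ≠ 0) (v : Fin 3 → ℝ) :
    v 0 = a * bary a b v 0 + b * bary a b v 1 + b * bary a b v 2 ∧
    v 1 = b * bary a b v 0 + a * bary a b v 1 + b * bary a b v 2 ∧
    v 2 = b * bary a b v 0 + b * bary a b v 1 + a * bary a b v 2 := by
  have : b - a ≠ 0 := sub_ne_zero.2 hab.symm
  have hσ : v 0 + v 1 + v 2 = (v 0 + v 1 + v 2) / (a + 2 * b) * (a + 2 * b) :=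
    (div_mul_cancel₀ _ hb).symm
  unfold bary
  generalize (v 0 + v 1 + v 2) / (a + 2 * b) = σ at *
  refine ⟨?_, ?_, ?_⟩ <;> field_simp <;> linear_combination b * hσ

/-- The normalised differences of the coordinates of a vector. -/
theorem sub_eq_bary {a b : ℝ} (hab : a ≠ b) (hb : a + 2 * b ≠ 0) (v : Fin 3 → ℝ) :
    v 2 - v 0 = (b - a) * (bary a b v 0 - bary a b v 2) ∧
    v 2 - v 1 = (b - a) * (bary a b v 1 - bary a b v 2) := by
  obtain ⟨h0, h1, h2⟩ := bary_spec hab hb v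
  constructor <;> linarith

theorem bary_add (a b : ℝ) (u v : Fin 3 → ℝ) : bary a b (u + v) = bary a b u + bary a b v := by
  funext i
  simp only [bary, Pi.add_apply]
  ring

theorem bary_smul (a b c : ℝ) (v : Fin 3 → ℝ) : bary a b (c • v) = c • bary a b v := by
  funext i
  simp only [bary, Pi.smul_apply, smul_eq_mul]
  ring

theorem continuous_bary (a b : ℝ) : Continuous (bary a b) := by
  unfold bary
  fun_prop

theorem det3_eq_bary {a b : ℝ} (hab : a ≠ b) (hb : a + 2 * b ≠ 0) (u v w : Fin 3 → ℝ) :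
    det3 u v w = (a + 2 * b) * (b - a) ^ 2 * det3 (bary a b u) (bary a b v) (bary a b w) := by
  obtain ⟨u0, u1, u2⟩ := bary_spec hab hb u
  obtain ⟨v0, v1, v2⟩ := bary_spec hab hb v
  obtain ⟨w0, w1, w2⟩ := bary_spec hab hb w
  unfold det3
  rw [u0, u1, u2, v0, v1, v2, w0, w1, w2]
  ring

theorem bary_sideLengths {a b : ℝ} (hab : a ≠ b) (hb : a + 2 * b ≠ 0) (k : Fin 3) :
    bary a b (sideLengths a b k) = Pi.single k 1 := by
  have h1 : b - a ≠ 0 := sub_ne_zero.2 hab.symm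
  have h2 : (sideLengths a b k 0 + sideLengths a b k 1 + sideLengths a b k 2) / (a + 2 * b) =
      1 := by
    rw [div_eq_one_iff_eq hb]
    fin_cases k <;> simp [sideLengths] <;> ring
  funext i
  rw [bary, h2]
  fin_cases k <;> fin_cases i <;> simp [sideLengths, h1]

namespace Arc

variable {a b : ℝ} {t : Fin 3 → ℤ × ℤ → ℝ} {u w : ℤ × ℤ}

theorem ne (h : Arc a b t) : a ≠ b := h.lt.ne

theorem add_ne (h : Arc a b t) : a + 2 * b ≠ 0 := by
  have := h.four_le
  have := h.lt
  linarith

theorem bary_two_eq (h : Arc a b t) (v : Fin 3 → ℝ) :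
    bary a b v 2 = (v 2 - b * ((v 2 - v 0) / (b - a) + (v 2 - v 1) / (b - a))) / (a + 2 * b) ∧
    bary a b v 0 = (v 2 - v 0) / (b - a) + bary a b v 2 ∧
    bary a b v 1 = (v 2 - v 1) / (b - a) + bary a b v 2 := by
  have h1 : b - a ≠ 0 := sub_ne_zero.2 h.ne.symm
  have h2 := h.add_ne
  obtain ⟨e0, e1⟩ := sub_eq_bary h.ne h2 v
  have e2 := (bary_spec h.ne h2 v).2.2
  have d0 : (v 2 - v 0) / (b - a) = bary a b v 0 - bary a b v 2 := by
    rw [e0, mul_div_cancel_left₀ _ h1]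
  have d1 : (v 2 - v 1) / (b - a) = bary a b v 1 - bary a b v 2 := by
    rw [e1, mul_div_cancel_left₀ _ h1]
  rw [d0, d1]
  refine ⟨?_, by ring, by ring⟩
  rw [eq_div_iff h2]
  linarith

/-- The position of a vertex of the tree in barycentric coordinates: just outside of the side of
the triangle that belongs to the arc. -/
structure Near (ε : ℝ) (v : ℤ × ℤ) (x : Fin 3 → ℝ) : Prop where
  two_le : x 2 ≤ 0
  le_zero : -ε * x 0 ≤ x 2
  le_one : -ε * x 1 ≤ x 2
  zero_nonneg : 0 ≤ x 0
  one_nonneg : 0 ≤ x 1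
  zero_pos : v.2 < v.1 → 0 < x 0
  one_pos : 0 < v.2 → 0 < x 1
  one_le_sum : 1 / 2 * (v.1 : ℝ) ≤ x 0 + x 1 + x 2

theorem near_of_vertexBound (h : Arc a b t) (hv : ArcRec.VertexBound b (arcError a)
    (fun v => (lengths t v 2 - lengths t v 0) / (b - a))
      (fun v => (lengths t v 2 - lengths t v 1) / (b - a)) (fun v => lengths t v 2) u) :
    Near (arcError a) u (bary a b (lengths t u)) := by
  have h4 := h.four_le
  have hlt := h.lt
  have hε := arcError_pos a
  have hε' := h.err
  obtain ⟨e2, e0, e1⟩ := h.bary_two_eq (lengths t u)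
  have hP0 := hv.P_nonneg
  have hQ0 := hv.Q_nonneg
  obtain ⟨c1, c2, -, c3, -, -, c4, c5, c6, -⟩ := hv
  set P := (lengths t u 2 - lengths t u 0) / (b - a)
  set Q := (lengths t u 2 - lengths t u 1) / (b - a)
  set H := lengths t u 2
  set x := bary a b (lengths t u)
  have hx2 : x 2 * (a + 2 * b) = H - b * (P + Q) := by
    rw [e2, div_mul_cancel₀ _ h.add_ne]
  have hfrac : 1 - 1 / (u.1 : ℝ) ≤ 1 := by
    have : 0 ≤ 1 / (u.1 : ℝ) := by positivity
    linarith
  have d5 : b * (P + Q) - H ≤ arcError a * b * Q :=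
    c5.trans (mul_le_of_le_one_right (mul_nonneg (mul_nonneg hε.le (by linarith)) (by assumption)) hfrac)
  have d6 : b * (P + Q) - H ≤ arcError a * b * P :=
    c6.trans (mul_le_of_le_one_right (mul_nonneg (mul_nonneg hε.le (by linarith)) (by assumption)) hfrac)
  have g0 : x 2 ≤ 0 := by nlinarith
  have g1 : -(arcError a / 2) * Q ≤ x 2 := by
    by_contra! hc
    have : x 2 * (a + 2 * b) < -(arcError a / 2) * Q * (a + 2 * b) :=
      mul_lt_mul_of_pos_right hc (by linarith)
    have : 0 ≤ arcError a * Q * a := mul_nonneg (mul_nonneg hε.le hQ0) (by linarith)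
    linarith
  have g2 : -(arcError a / 2) * P ≤ x 2 := by
    by_contra! hc
    have : x 2 * (a + 2 * b) < -(arcError a / 2) * P * (a + 2 * b) :=
      mul_lt_mul_of_pos_right hc (by linarith)
    have : 0 ≤ arcError a * P * a := mul_nonneg (mul_nonneg hε.le hP0) (by linarith)
    linarith
  refine ⟨g0, ?_, ?_, ?_, ?_, ?_, ?_, ?_⟩
  · rw [e0]; nlinarith
  · rw [e1]; nlinarith
  · rw [e0]; nlinarith
  · rw [e1]; nlinarith
  · intro hlt'
    have : (1 : ℝ) ≤ u.1 - u.2 := by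
      have : (1 : ℤ) ≤ u.1 - u.2 := by omega
      exact_mod_cast this
    rw [e0]; nlinarith
  · intro hlt'
    have : (1 : ℝ) ≤ u.2 := by exact_mod_cast hlt'
    rw [e1]; nlinarith
  · rw [e0, e1]; nlinarith

theorem near (h : Arc a b t) (hE : FareyEdge u w) :
    Near (arcError a) u (bary a b (lengths t u)) ∧
    Near (arcError a) w (bary a b (lengths t w)) :=
  ⟨h.near_of_vertexBound (h.arcRec.vertexBound hE).1,
    h.near_of_vertexBound (h.arcRec.vertexBound hE).2⟩

/-- The points of the two ends of an edge, as seen from the third vertex of the triangle. -/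
theorem bary_minor_pos (h : Arc a b t) (hE : FareyEdge u w) :
    0 < bary a b (lengths t u) 0 * bary a b (lengths t w) 1 -
      bary a b (lengths t u) 1 * bary a b (lengths t w) 0 := by
  have hη : 0 < b - a := by linarith [h.lt]
  have h4 := h.four_le
  have hc : 0 < a + 2 * b := by linarith
  obtain ⟨m1, m2, m3⟩ := h.minors hE
  have m1' : 0 < (b - a) ^ 2 * (3 / 4) := by positivity
  have key : bary a b (lengths t u) 0 * bary a b (lengths t w) 1 -
      bary a b (lengths t u) 1 * bary a b (lengths t w) 0 =
      (((lengths t u 2 - lengths t u 0) * lengths t w 2 -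
        lengths t u 2 * (lengths t w 2 - lengths t w 0)) * (b - a) +
      (lengths t u 2 * (lengths t w 2 - lengths t w 1) -
        (lengths t u 2 - lengths t u 1) * lengths t w 2) * (b - a) +
      a * ((lengths t u 2 - lengths t u 0) * (lengths t w 2 - lengths t w 1) -
        (lengths t u 2 - lengths t u 1) * (lengths t w 2 - lengths t w 0))) /
      ((a + 2 * b) * (b - a) ^ 2) := by
    rw [eq_div_iff (by positivity)]
    obtain ⟨e0, e1⟩ := sub_eq_bary h.ne hc.ne' (lengths t u)
    obtain ⟨f0, f1⟩ := sub_eq_bary h.ne hc.ne' (lengths t w)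
    rw [e0, e1, f0, f1, (bary_spec h.ne hc.ne' (lengths t u)).2.2,
      (bary_spec h.ne hc.ne' (lengths t w)).2.2]
    ring
  rw [key]
  refine div_pos ?_ (by positivity)
  have := mul_pos m2 hη
  have := mul_pos m3 hη
  have := mul_pos (show 0 < a by linarith) (m1'.trans_le m1)
  linarith

theorem bary_det3_pos (h : Arc a b t) {r s v : ℤ × ℤ} (h1 : FareyEdge r s)
    (h2 : FareyEdge s v) :
    0 < det3 (bary a b (lengths t r)) (bary a b (lengths t s)) (bary a b (lengths t v)) := by
  have h3 := h.det3_pos_of_edges h1 h2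
  rw [det3_eq_bary h.ne h.add_ne] at h3
  have : 0 < b - a := by linarith [h.lt]
  have : 0 < a + 2 * b := by linarith [h.four_le]
  exact pos_of_mul_pos_right h3 (by positivity)

open Filter Topology in
/-- The two limit directions at an interior slope `s` and the point of slope `s` are not on a
line. -/
theorem exists_bary_limits (h : Arc a b t) {r s v : ℤ × ℤ} (h1 : FareyEdge r s)
    (h2 : FareyEdge s v) :
    ∃ α β : Fin 3 → ℝ,
      Tendsto (fun k : ℕ => bary a b (lengths t (v + k • s)) - (k : ℝ) • bary a b (lengths t s))
        atTop (𝓝 α) ∧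
      Tendsto (fun k : ℕ => bary a b (lengths t (r + k • s)) - (k : ℝ) • bary a b (lengths t s))
        atTop (𝓝 β) ∧
      0 < det3 (bary a b (lengths t s)) α β := by
  obtain ⟨α, β, F, hα, hβ, hF, ⟨f1, f2, f3⟩, -⟩ := h.exists_limits h1 h2
  have hη : 0 < b - a := by linarith [h.lt]
  have hc : 0 < a + 2 * b := by linarith [h.four_le]
  have hb : ∀ (u v : Fin 3 → ℝ) (c : ℝ), bary a b (u - c • v) = bary a b u - c • bary a b v := by
    intro u v c
    rw [sub_eq_add_neg, ← neg_smul, bary_add, bary_smul, neg_smul, ← sub_eq_add_neg]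
  refine ⟨bary a b α, bary a b β, ?_, ?_, ?_⟩
  · have := ((continuous_bary a b).tendsto α).comp hα
    exact this.congr fun k => hb _ _ _
  · have := ((continuous_bary a b).tendsto β).comp hβ
    exact this.congr fun k => hb _ _ _
  · have key : F 2 * ((b - a) ^ 2 * (3 / 4)) ≤ det3 F (lengths t s) α := by
      have hcont : Continuous fun z : Fin 3 → ℝ => det3 F (lengths t s) z := by
        unfold det3; fun_prop
      refine ge_of_tendsto' ((hcont.tendsto α).comp hα) fun k => ?_
      have e : det3 F (lengths t s) (lengths t (v + k • s) - (k : ℝ) • lengths t s) =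
          det3 F (lengths t s) (lengths t (v + k • s)) := by
        simp only [det3, Pi.sub_apply, Pi.smul_apply, smul_eq_mul]
        ring
      simp only [Function.comp]
      rw [e]
      refine le_trans ?_ (h.minor_le_det3 (h2.add_nsmul_left k) f2 f3)
      exact mul_le_mul_of_nonneg_left (h.minors (h2.add_nsmul_left k)).1 f1.le
    have e : det3 (lengths t s) α β = det3 F (lengths t s) α := by
      rw [← hF]
      simp only [det3, Pi.sub_apply, Pi.add_apply, Pi.smul_apply, smul_eq_mul]
      ring
    have h3 : 0 < det3 (lengths t s) α β := by
      rw [e]; exact lt_of_lt_of_le (by positivity) key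
    rw [det3_eq_bary h.ne h.add_ne] at h3
    exact pos_of_mul_pos_right h3 (by positivity)

/-- The normalised half lengths are Lipschitz in the slope along the edges of the tree. -/
theorem abs_minor_fst_le (h : Arc a b t) (hE : FareyEdge u w) (i : Fin 3) :
    |lengths t u i * w.1 - u.1 * lengths t w i| ≤ b + 1 := by
  have h4 := h.four_le
  have hε := arcError_pos a
  have hε' := h.err
  suffices hs : |lengths t u i * w.1 - u.1 * lengths t w i| ≤
      b + arcError a * (1 - 1 / (u.1 + w.1)) by
    have hn := two_le_fst hE
    rw [Prod.fst_add, Int.cast_add] at hn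
    have : 0 ≤ 1 / (u.1 + w.1 : ℝ) := by positivity
    nlinarith
  have hlt := h.lt
  have hstep : ∀ {u w : ℤ × ℤ} {m D : ℝ} {z : ℤ}, FareyEdge u w →
      |lengths t u i * w.1 - u.1 * lengths t w i| ≤ b + arcError a * (1 - 1 / (u.1 + w.1)) →
      D = lengths t u i + lengths t w i - lengths t (u + w) i → 1 ≤ z →
      |m| ≤ u.1 + w.1 → ∀ X : ℝ, X = lengths t u i * w.1 - u.1 * lengths t w i + m * D →
      |X| ≤ b + arcError a * (1 - 1 / (((u + w).1 : ℤ) + z)) := by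
    rintro u w m D z hE ih hD hz hm X rfl
    have hn := two_le_fst hE
    have h1 := (h.arcTrace i).defect_nonneg hE
    have h2 := h.defect_le hE i
    have h3 := defectBound_mul_le h4 hn
    have h5 := defectBound_pos a ((u + w).1 : ℤ)
    have e : ((u + w).1 : ℤ) = (u.1 + w.1 : ℝ) := by rw [Prod.fst_add]; push_cast; ring
    rw [e] at hn h2 h3 h5 ⊢
    simp only [lengths] at hD h2
    rw [← hD] at h1 h2
    set n : ℝ := u.1 + w.1
    have h6 : |m * D| ≤ arcError a / (n * (n + 1)) := by
      rw [abs_mul, abs_of_nonneg h1]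
      calc |m| * D ≤ n * defectBound a n := mul_le_mul hm h2 h1 (by linarith)
        _ ≤ 4 * n ^ 2 * defectBound a n := mul_le_mul_of_nonneg_right (by nlinarith) h5.le
        _ ≤ _ := h3
    have h7 : 1 / (n + z) ≤ 1 / (n + 1) := by
      have : (1 : ℝ) ≤ z := by exact_mod_cast hz
      exact one_div_le_one_div_of_le (by linarith) (by linarith)
    have h8 : arcError a * (1 - 1 / n) + arcError a / (n * (n + 1)) =
        arcError a * (1 - 1 / (n + 1)) := by
      field_simp
      ring
    have h9 := abs_add_le (lengths t u i * w.1 - u.1 * lengths t w i) (m * D)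
    nlinarith
  induction hE with
  | root =>
    rw [h.lengths_zero, h.lengths_one]
    have : 0 ≤ arcError a * (1 - 1 / ((1 : ℝ) + 1)) := by norm_num; exact hε.le
    rw [abs_le]
    fin_cases i <;> simp [sideLengths] at * <;> constructor <;> linarith
  | @left u w hE ih =>
    obtain ⟨⟨c1, -, -⟩, c4, c5⟩ := hE.mem_cone
    have d1 : (1 : ℝ) ≤ u.1 := by exact_mod_cast c1
    have d2 : (1 : ℝ) ≤ w.1 := by exact_mod_cast (by omega : (1 : ℤ) ≤ w.1)
    have := hstep (m := u.1) (z := u.1) hE ih rfl c1 (by rw [abs_of_pos] <;> linarith) _ rfl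
    rw [add_comm (((u + w).1 : ℤ) : ℝ)] at this
    convert this using 2
    rw [Prod.fst_add]; push_cast; ring
  | @right u w hE ih =>
    obtain ⟨⟨c1, -, -⟩, c4, c5⟩ := hE.mem_cone
    have d1 : (1 : ℝ) ≤ u.1 := by exact_mod_cast c1
    have d2 : (1 : ℝ) ≤ w.1 := by exact_mod_cast (by omega : (1 : ℤ) ≤ w.1)
    have := hstep (m := -w.1) (z := w.1) hE ih rfl (by omega)
      (by rw [abs_neg, abs_of_pos] <;> linarith) _ rfl
    convert this using 2
    rw [Prod.fst_add]; push_cast; ring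

end Arc

/-! ### Convexity and Lipschitz bounds on an arc -/

section Chain

variable {ι : Type*} {adj : ι → ι → Prop} {f : ι → Fin 3 → ℝ}

/-- In the affine chart `v 1 / (v 0 + v 1)`, `v 2 / (v 0 + v 1)`, a determinant is a multiple of a
signed area. -/
theorem det3_eq_mul {u v w : Fin 3 → ℝ} (hu : 0 < u 0 + u 1) (hv : 0 < v 0 + v 1)
    (hw : 0 < w 0 + w 1) :
    det3 u v w = (u 0 + u 1) * (v 0 + v 1) * (w 0 + w 1) *
      ((v 1 / (v 0 + v 1) - u 1 / (u 0 + u 1)) * (w 2 / (w 0 + w 1) - v 2 / (v 0 + v 1)) -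
        (w 1 / (w 0 + w 1) - v 1 / (v 0 + v 1)) * (v 2 / (v 0 + v 1) - u 2 / (u 0 + u 1))) := by
  unfold det3
  field_simp
  ring

theorem minor_eq_mul {u v : Fin 3 → ℝ} (hu : 0 < u 0 + u 1) (hv : 0 < v 0 + v 1) :
    u 0 * v 1 - u 1 * v 0 = (u 0 + u 1) * (v 0 + v 1) *
      (v 1 / (v 0 + v 1) - u 1 / (u 0 + u 1)) := by
  field_simp
  ring

/-- The slope of a sum lies between the slopes of the summands. -/
theorem slope_add_lt {x₁ x₂ z₁ z₂ : ℝ} (h₁ : 0 < x₁) (h₂ : 0 < x₂) (h : z₁ / x₁ < z₂ / x₂) :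
    z₁ / x₁ < (z₁ + z₂) / (x₁ + x₂) ∧ (z₁ + z₂) / (x₁ + x₂) < z₂ / x₂ := by
  rw [div_lt_div_iff₀ h₁ h₂] at h
  rw [div_lt_div_iff₀ h₁ (by positivity), div_lt_div_iff₀ (by positivity) h₂]
  constructor <;> linarith

/-- A chain of points that is locally monotonic and locally convex is monotonic and convex. The
index set need not be discrete: `adj` may relate the adjacent points of all finite stages of a
refinement, like the edges of the Farey tree. -/
theorem pos_of_transGen (h0 : ∀ {r s}, adj r s → 0 < f r 0 + f r 1 ∧ 0 < f s 0 + f s 1)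
    (h1 : ∀ {r s}, adj r s → 0 < f r 0 * f s 1 - f r 1 * f s 0)
    (h2 : ∀ {r s t}, adj r s → adj s t → 0 < det3 (f r) (f s) (f t)) :
    (∀ {r s}, Relation.TransGen adj r s → 0 < f r 0 * f s 1 - f r 1 * f s 0) ∧
    (∀ {r s t}, Relation.TransGen adj r s → Relation.TransGen adj s t →
      0 < det3 (f r) (f s) (f t)) := by
  -- coordinates of an affine chart, in which the chain is the graph of a function
  set X : ι → ℝ := fun r => f r 1 / (f r 0 + f r 1) with hX
  set Z : ι → ℝ := fun r => f r 2 / (f r 0 + f r 1) with hZ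
  have hadjX : ∀ {r s}, adj r s → 0 < X s - X r := by
    intro r s h
    have := h1 h
    rw [minor_eq_mul (h0 h).1 (h0 h).2] at this
    exact pos_of_mul_pos_right this (mul_pos (h0 h).1 (h0 h).2).le
  have hσ : ∀ {r s}, Relation.TransGen adj r s → 0 < f r 0 + f r 1 ∧ 0 < f s 0 + f s 1 := by
    intro r s h
    constructor
    · obtain ⟨c, hc, -⟩ := Relation.TransGen.head'_iff.1 h
      exact (h0 hc).1
    · obtain ⟨c, -, hc⟩ := Relation.TransGen.tail'_iff.1 h
      exact (h0 hc).2
  have htransX : ∀ {r s}, Relation.TransGen adj r s → 0 < X s - X r := by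
    intro r s h
    induction h with
    | single h => exact hadjX h
    | tail _ h ih => linarith [hadjX h]
  have hlocal : ∀ {r s t}, adj r s → adj s t →
      (Z s - Z r) / (X s - X r) < (Z t - Z s) / (X t - X s) := by
    intro r s t hr hs
    have := h2 hr hs
    rw [det3_eq_mul (h0 hr).1 (h0 hr).2 (h0 hs).2] at this
    have := pos_of_mul_pos_right this
      (mul_pos (mul_pos (h0 hr).1 (h0 hr).2) (h0 hs).2).le
    rw [div_lt_div_iff₀ (hadjX hr) (hadjX hs)]
    simp only [hX, hZ]
    linarith
  -- the secants between distant points are compared with the edges at their ends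
  have hin : ∀ {r s}, Relation.TransGen adj r s → ∃ s', adj s' s ∧
      (Z s - Z r) / (X s - X r) ≤ (Z s - Z s') / (X s - X s') := by
    intro r s h
    induction h with
    | single h => exact ⟨r, h, le_rfl⟩
    | @tail s t hrs hst ih =>
      obtain ⟨s', hs', hle⟩ := ih
      have h3 := (slope_add_lt (htransX hrs) (hadjX hst) (hle.trans_lt (hlocal hs' hst))).2
      rw [show Z s - Z r + (Z t - Z s) = Z t - Z r by ring,
        show X s - X r + (X t - X s) = X t - X r by ring] at h3
      exact ⟨s, hst, h3.le⟩
  have hout : ∀ {r s}, Relation.TransGen adj r s → ∃ r', adj r r' ∧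
      (Z r' - Z r) / (X r' - X r) ≤ (Z s - Z r) / (X s - X r) := by
    intro r s h
    induction h using Relation.TransGen.head_induction_on with
    | single h => exact ⟨s, h, le_rfl⟩
    | @head r q hrq hqs ih =>
      obtain ⟨r', hr', hle⟩ := ih
      have h3 := (slope_add_lt (hadjX hrq) (htransX hqs) ((hlocal hrq hr').trans_le hle)).1
      rw [show Z q - Z r + (Z s - Z q) = Z s - Z r by ring,
        show X q - X r + (X s - X q) = X s - X r by ring] at h3
      exact ⟨q, hrq, h3.le⟩
  refine ⟨fun {r s} h => ?_, fun {r s t} hr ht => ?_⟩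
  · rw [minor_eq_mul (hσ h).1 (hσ h).2]
    exact mul_pos (mul_pos (hσ h).1 (hσ h).2) (htransX h)
  · rw [det3_eq_mul (hσ hr).1 (hσ hr).2 (hσ ht).2]
    refine mul_pos (mul_pos (mul_pos (hσ hr).1 (hσ hr).2) (hσ ht).2) ?_
    obtain ⟨s', hs', hle⟩ := hin hr
    obtain ⟨s'', hs'', hle'⟩ := hout ht
    have h3 := (hle.trans_lt (hlocal hs' hs'')).trans_le hle'
    rw [div_lt_div_iff₀ (htransX hr) (htransX ht)] at h3
    simp only [hX, hZ] at h3
    linarith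

end Chain

/-- Any two primitive vectors of the cone are joined by a path in the Farey tree. -/
theorem transGen_fareyEdge {u w : ℤ × ℤ} (hu : 0 ≤ u.2 ∧ u.2 ≤ u.1) (hw : 0 ≤ w.2 ∧ w.2 ≤ w.1)
    (hcu : IsCoprime u.1 u.2) (hcw : IsCoprime w.1 w.2) (hd : 0 < u.1 * w.2 - u.2 * w.1) :
    Relation.TransGen FareyEdge u w := by
  obtain ⟨D, hD⟩ : ∃ D : ℕ, u.1 * w.2 - u.2 * w.1 = D := ⟨_, (Int.toNat_of_nonneg hd.le).symm⟩
  induction D using Nat.strong_induction_on generalizing u with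
  | _ D ih =>
    rcases eq_or_ne D 1 with rfl | hD1
    · exact .single (.of_det hu hw (by exact_mod_cast hD))
    obtain ⟨x, y, hxy⟩ := hcu
    -- a neighbour `c` of `u` with `0 ≤ det (c, w) < D = det (u, w)`
    set k : ℤ := -((-y * w.2 - x * w.1) / D) with hk
    set c : ℤ × ℤ := (-y + k * u.1, x + k * u.2) with hc
    have hDpos : (0 : ℤ) < D := by rw [← hD]; exact hd
    have h1 : u.1 * c.2 - u.2 * c.1 = 1 := by simp only [hc]; linarith
    have h2 : c.1 * w.2 - c.2 * w.1 = (-y * w.2 - x * w.1) % D := by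
      rw [Int.emod_def, ← hD]
      simp only [hc, hk]
      rw [hD]
      linear_combination (-((-y * w.2 - x * w.1) / D)) * hD
    have h3 := Int.emod_nonneg (-y * w.2 - x * w.1) hDpos.ne'
    have h4 := Int.emod_lt_of_pos (-y * w.2 - x * w.1) hDpos
    rw [← h2] at h3 h4
    -- `D c` is a positive combination of `u` and `w`
    have e1 : D * c.1 = (c.1 * w.2 - c.2 * w.1) * u.1 + w.1 := by
      linear_combination w.1 * h1 - c.1 * hD
    have e2 : D * c.2 = (c.1 * w.2 - c.2 * w.1) * u.2 + w.2 := by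
      linear_combination w.2 * h1 - c.2 * hD
    have hcc : IsCoprime c.1 c.2 := ⟨-u.2, u.1, by linarith⟩
    have h5 : 0 < c.1 * w.2 - c.2 * w.1 := by
      refine lt_of_le_of_ne h3 fun h0 => hD1 ?_
      rw [← h0, zero_mul, zero_add] at e1 e2
      have h6 : IsUnit (D : ℤ) := hcw.isUnit_of_dvd' ⟨_, e1.symm⟩ ⟨_, e2.symm⟩
      have := Int.isUnit_iff.1 h6
      omega
    have hcone : 0 ≤ c.2 ∧ c.2 ≤ c.1 := by
      constructor
      · by_contra! hneg
        have : (D : ℤ) * c.2 < 0 := mul_neg_of_pos_of_neg hDpos hneg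
        have := mul_nonneg h3 hu.1
        linarith [hw.1]
      · by_contra! hneg
        have : (D : ℤ) * (c.1 - c.2) < 0 := mul_neg_of_pos_of_neg hDpos (by linarith)
        have := mul_nonneg h3 (sub_nonneg.2 hu.2)
        linarith [hw.2]
    refine .head (.of_det hu hcone h1) ?_
    refine ih (c.1 * w.2 - c.2 * w.1).toNat (by omega) hcone hcc h5 ?_
    rw [Int.toNat_of_nonneg h3]

/-- Primitive vectors of the cone spanned by `(1, 0)` and `(1, 1)`. -/
def FareyCone : Set (ℤ × ℤ) := {v | (0 ≤ v.2 ∧ v.2 ≤ v.1) ∧ IsCoprime v.1 v.2}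

theorem FareyCone.fst_pos {v : ℤ × ℤ} (hv : v ∈ FareyCone) : 0 < v.1 := by
  obtain ⟨⟨h1, h2⟩, h3⟩ := hv
  rcases lt_or_eq_of_le (h1.trans h2) with h | h
  · exact h
  · have : v.2 = 0 := by omega
    rw [← h, this] at h3
    exact absurd h3 not_isCoprime_zero_zero

theorem FareyCone.one_zero_mem : ((1, 0) : ℤ × ℤ) ∈ FareyCone := ⟨by simp, isCoprime_one_left⟩

theorem FareyCone.one_one_mem : ((1, 1) : ℤ × ℤ) ∈ FareyCone := ⟨by simp, isCoprime_one_left⟩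

/-- A primitive vector of the cone is an end of an edge. -/
theorem FareyCone.exists_edge {v : ℤ × ℤ} (hv : v ∈ FareyCone) :
    (∃ w, FareyEdge v w) ∨ ∃ u, FareyEdge u v := by
  have hpos := FareyCone.fst_pos hv
  rcases eq_or_lt_of_le hv.1.1 with h | h
  · left
    have h3 := hv.2
    rw [← h, isCoprime_zero_right, Int.isUnit_iff] at h3
    obtain ⟨v1, v2⟩ := v
    simp only at *
    obtain rfl : v1 = 1 := by omega
    subst h
    exact ⟨_, .root⟩
  · right
    have := transGen_fareyEdge (u := (1, 0)) (w := v) (by simp) hv.1 isCoprime_one_left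
      hv.2 (by simpa)
    obtain ⟨c, -, hc⟩ := Relation.TransGen.tail'_iff.1 this
    exact ⟨c, hc⟩

namespace Arc

variable {a b : ℝ} {t : Fin 3 → ℤ × ℤ → ℝ} {u w z : ℤ × ℤ}

/-- The barycentric coordinates of the vector of half lengths. -/
noncomputable def coord (a b : ℝ) (t : Fin 3 → ℤ × ℤ → ℝ) (v : ℤ × ℤ) : Fin 3 → ℝ :=
  bary a b (lengths t v)

theorem near_coord (h : Arc a b t) (hu : u ∈ FareyCone) : Near (arcError a) u (coord a b t u) := by
  rcases FareyCone.exists_edge hu with ⟨w, hw⟩ | ⟨w, hw⟩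
  · exact (h.near hw).1
  · exact (h.near hw).2

theorem coord_zero (h : Arc a b t) : coord a b t (1, 0) = Pi.single 0 1 := by
  rw [coord, h.lengths_zero, bary_sideLengths h.ne h.add_ne]

theorem coord_one (h : Arc a b t) : coord a b t (1, 1) = Pi.single 1 1 := by
  rw [coord, h.lengths_one, bary_sideLengths h.ne h.add_ne]

theorem coord_chain (h : Arc a b t) :
    (∀ {u w}, Relation.TransGen FareyEdge u w →
      0 < coord a b t u 0 * coord a b t w 1 - coord a b t u 1 * coord a b t w 0) ∧
    (∀ {u w z}, Relation.TransGen FareyEdge u w → Relation.TransGen FareyEdge w z →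
      0 < det3 (coord a b t u) (coord a b t w) (coord a b t z)) := by
  refine pos_of_transGen ?_ (fun hE => h.bary_minor_pos hE) (fun h1 h2 => h.bary_det3_pos h1 h2)
  intro u w hE
  obtain ⟨hu, hw⟩ := h.near hE
  obtain ⟨⟨c1, c2, c3⟩, c4, c5⟩ := hE.mem_cone
  exact ⟨add_pos_of_pos_of_nonneg (hu.zero_pos c3) hu.one_nonneg,
    add_pos_of_nonneg_of_pos hw.zero_nonneg (hw.one_pos c4)⟩

theorem minor_pos (h : Arc a b t) (hu : u ∈ FareyCone) (hw : w ∈ FareyCone)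
    (hd : 0 < u.1 * w.2 - u.2 * w.1) :
    0 < coord a b t u 0 * coord a b t w 1 - coord a b t u 1 * coord a b t w 0 :=
  h.coord_chain.1 (transGen_fareyEdge hu.1 hw.1 hu.2 hw.2 hd)

theorem det3_pos (h : Arc a b t) (hu : u ∈ FareyCone) (hw : w ∈ FareyCone) (hz : z ∈ FareyCone)
    (hd : 0 < u.1 * w.2 - u.2 * w.1) (hd' : 0 < w.1 * z.2 - w.2 * z.1) :
    0 < det3 (coord a b t u) (coord a b t w) (coord a b t z) :=
  h.coord_chain.2 (transGen_fareyEdge hu.1 hw.1 hu.2 hw.2 hd)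
    (transGen_fareyEdge hw.1 hz.1 hw.2 hz.2 hd')

/-- The normalised half lengths are a Lipschitz function of the slope. -/
theorem abs_sub_le (h : Arc a b t) (hu : u ∈ FareyCone) (hw : w ∈ FareyCone)
    (hd : 0 < u.1 * w.2 - u.2 * w.1) (i : Fin 3) :
    |lengths t w i / w.1 - lengths t u i / u.1| ≤ (b + 1) * ((w.2 : ℝ) / w.1 - (u.2 : ℝ) / u.1) := by
  have hstep : ∀ {u w : ℤ × ℤ}, FareyEdge u w → |lengths t w i / w.1 - lengths t u i / u.1| ≤
      (b + 1) * ((w.2 : ℝ) / w.1 - (u.2 : ℝ) / u.1) := by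
    intro u w hE
    have h1 := h.abs_minor_fst_le hE i
    obtain ⟨⟨c1, -, -⟩, c4, c5⟩ := hE.mem_cone
    have d1 : (0 : ℝ) < u.1 := by exact_mod_cast c1
    have d2 : (0 : ℝ) < w.1 := by exact_mod_cast (by omega : (0 : ℤ) < w.1)
    have hdet : (u.1 : ℝ) * w.2 - u.2 * w.1 = 1 := by exact_mod_cast hE.det
    have e1 : (w.2 : ℝ) / w.1 - (u.2 : ℝ) / u.1 = 1 / (u.1 * w.1) := by
      rw [← hdet]; field_simp
    have e2 : lengths t w i / w.1 - lengths t u i / u.1 =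
        -(lengths t u i * w.1 - u.1 * lengths t w i) / (u.1 * w.1) := by
      field_simp; ring
    rw [e1, e2, abs_div, abs_neg, abs_of_pos (mul_pos d1 d2), mul_one_div]
    exact div_le_div_of_nonneg_right h1 (mul_pos d1 d2).le
  have h1 := transGen_fareyEdge hu.1 hw.1 hu.2 hw.2 hd
  clear hd hw
  induction h1 with
  | single h1 => exact hstep h1
  | @tail v w _ h1 ih =>
    have h2 := hstep h1
    have h3 := abs_add_le (lengths t w i / w.1 - lengths t v i / v.1)
      (lengths t v i / v.1 - lengths t u i / u.1)
    rw [sub_add_sub_cancel] at h3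
    linarith

end Arc

/-! ### The symmetry of order three and convexity for all slopes -/

/-- The rotation of order three on slopes that permutes `0`, `1` and `∞` cyclically. -/
def rotVec (v : ℤ × ℤ) : ℤ × ℤ := (v.1 - v.2, v.1)

/-- The trace functions in the marking changed by the rotation, with the indices of the three
structures shifted accordingly. -/
def rotTrace (t : Fin 3 → ℤ × ℤ → ℝ) : Fin 3 → ℤ × ℤ → ℝ := fun i v => t (i + 1) (rotVec v)

theorem rotVec_neg (v : ℤ × ℤ) : rotVec (-v) = -rotVec v := by
  ext <;> simp [rotVec]
  ring

theorem exists_rotVec_eq (v : ℤ × ℤ) (hv : IsCoprime v.1 v.2) :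
    ∃ u : ℤ × ℤ, IsCoprime u.1 u.2 ∧ rotVec u = v := by
  obtain ⟨x, y, h⟩ := hv
  exact ⟨(v.2, v.2 - v.1), ⟨x + y, -x, by simp only; linarith⟩, by ext <;> simp [rotVec]⟩

/-- The three rotates of the cone cover all primitive vectors up to sign. -/
theorem exists_mem_fareyCone {v : ℤ × ℤ} (hv : IsCoprime v.1 v.2) :
    ∃ c ∈ FareyCone, (v = c ∨ v = rotVec c ∨ v = rotVec (rotVec c)) ∨
      (-v = c ∨ -v = rotVec c ∨ -v = rotVec (rotVec c)) := by
  obtain ⟨x, y⟩ := v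
  have key : ∀ {x y : ℤ}, IsCoprime x y → 0 ≤ x → ∃ c ∈ FareyCone,
      ((x, y) = c ∨ (x, y) = rotVec c ∨ (x, y) = rotVec (rotVec c)) ∨
      (-(x, y) = c ∨ -(x, y) = rotVec c ∨ -(x, y) = rotVec (rotVec c)) := by
    intro x y h hx
    have h' := h
    obtain ⟨p, q, hpq⟩ := h'
    rcases le_or_gt 0 y with hy | hy
    · rcases le_or_gt y x with hxy | hxy
      · exact ⟨(x, y), ⟨⟨hy, hxy⟩, h⟩, .inl (.inl rfl)⟩
      · refine ⟨(y, y - x), ⟨by simp only; omega, ⟨p + q, -p, by simp only; linarith⟩⟩,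
          .inl (.inr (.inl ?_))⟩
        simp [rotVec]
    · refine ⟨(x - y, x), ⟨by simp only; omega, ⟨-q, p + q, by simp only; linarith⟩⟩,
        .inr (.inr (.inr ?_))⟩
      ext <;> simp only [rotVec, Prod.neg_mk] <;> ring
  rcases le_or_gt 0 x with hx | hx
  · exact key hv hx
  · have h1 : IsCoprime (-x) (-y) := by
      obtain ⟨p, q, h⟩ := hv
      exact ⟨-p, -q, by simp only at h; linarith⟩
    obtain ⟨c, hc, h2⟩ := key h1 (by omega)
    refine ⟨c, hc, ?_⟩
    have e : -((x, y) : ℤ × ℤ) = (-x, -y) := by simp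
    rw [e]
    rw [show -((-x, -y) : ℤ × ℤ) = (x, y) by simp] at h2
    exact h2.symm

theorem isMarkov_comp_rotVec {t : ℤ × ℤ → ℝ} (h : IsMarkov t) :
    IsMarkov fun v => t (rotVec v) := by
  constructor
  · intro v
    rw [rotVec_neg, h.even]
  · intro u w hd
    have := h.add_sub (rotVec u) (rotVec w) (by simp only [rotVec]; linarith)
    convert this using 3
    · ext <;> simp [rotVec]
      ring
    · ext <;> simp [rotVec]
      ring

theorem det3_shift (u v w : Fin 3 → ℝ) :
    det3 (fun i => u (i + 1)) (fun i => v (i + 1)) (fun i => w (i + 1)) = det3 u v w := by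
  simp only [det3, zero_add, Fin.reduceAdd]
  ring

theorem det3_rotate (u v w : Fin 3 → ℝ) : det3 u v w = det3 v w u := by
  simp only [det3]
  ring

namespace Arc

variable {a b : ℝ} {t : Fin 3 → ℤ × ℤ → ℝ} {u w z : ℤ × ℤ}

theorem rot (h : Arc a b t) : Arc a b (rotTrace t) := by
  have hs : ∀ k i : Fin 3, sideLengths a b (k + 1) (i + 1) = sideLengths a b k i := by
    intro k i
    simp [sideLengths]
  refine ⟨fun i => isMarkov_comp_rotVec (h.markov _), h.err, h.lt, fun i => ?_, fun i => ?_,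
    fun i => ?_⟩
  · have := h.one (i + 1)
    rw [← hs 0 i]
    simpa [rotTrace, rotVec] using this
  · have := h.infty (i + 1)
    rw [← hs 1 i]
    simpa [rotTrace, rotVec] using this
  · have := h.zero (i + 1)
    rw [← (h.markov _).even] at this
    have hs := hs 2 i
    simp only [Fin.reduceAdd] at hs
    rw [hs] at this
    simpa [rotTrace, rotVec] using this

theorem lengths_rot (t : Fin 3 → ℤ × ℤ → ℝ) (v : ℤ × ℤ) (i : Fin 3) :
    lengths (rotTrace t) v i = lengths t (rotVec v) (i + 1) := rfl

theorem coord_rot (a b : ℝ) (t : Fin 3 → ℤ × ℤ → ℝ) (v : ℤ × ℤ) (i : Fin 3) :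
    coord a b (rotTrace t) v i = coord a b t (rotVec v) (i + 1) := by
  simp only [coord, bary, lengths_rot, zero_add, Fin.reduceAdd]
  ring

theorem lengths_neg (h : Arc a b t) (v : ℤ × ℤ) : lengths t (-v) = lengths t v := by
  funext i
  rw [lengths, halfLength, (h.markov i).even]
  rfl

theorem coord_neg (h : Arc a b t) (v : ℤ × ℤ) : coord a b t (-v) = coord a b t v := by
  rw [coord, h.lengths_neg, coord]

theorem coord_infty (h : Arc a b t) : coord a b t (0, 1) = Pi.single 2 1 := by
  have h1 := h.rot.coord_one
  funext i
  have h2 := coord_rot a b t (1, 1) (i + 2)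
  have e : i + 2 + 1 = i := by rw [add_assoc]; simp
  have e' : rotVec (1, 1) = (0, 1) := by simp [rotVec]
  rw [h1, e, e'] at h2
  rw [← h2]
  fin_cases i <;> simp

/-- A property of primitive vectors that is compatible with the rotation needs to be checked on
the cone only. -/
theorem rot_induction {Φ : (Fin 3 → ℤ × ℤ → ℝ) → ℤ × ℤ → Prop}
    (hcone : ∀ t, Arc a b t → ∀ v ∈ FareyCone, Φ t v)
    (hrot : ∀ t v, Arc a b t → Φ (rotTrace t) v → Φ t (rotVec v))
    (hneg : ∀ t v, Arc a b t → Φ t (-v) → Φ t v) (h : Arc a b t) {v : ℤ × ℤ}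
    (hv : IsCoprime v.1 v.2) : Φ t v := by
  obtain ⟨c, hc, hvc⟩ := exists_mem_fareyCone hv
  have h0 : Φ t c := hcone t h c hc
  have h1 : Φ t (rotVec c) := hrot _ _ h (hcone _ h.rot c hc)
  have h2 : Φ t (rotVec (rotVec c)) :=
    hrot _ _ h (hrot _ _ h.rot (hcone _ h.rot.rot c hc))
  rcases hvc with (e | e | e) | (e | e | e)
  · rwa [e]
  · rwa [e]
  · rwa [e]
  · exact hneg _ _ h (by rwa [e])
  · exact hneg _ _ h (by rwa [e])
  · exact hneg _ _ h (by rwa [e])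

/-- All points lie in the slightly enlarged triangle bounded by six lines through the vertices. -/
theorem neg_mul_coord_le (h : Arc a b t) {v : ℤ × ℤ} (hv : IsCoprime v.1 v.2) {k l : Fin 3}
    (hkl : k ≠ l) : -arcError a * coord a b t v l ≤ coord a b t v k := by
  suffices ∀ k l : Fin 3, k ≠ l → -arcError a * coord a b t v l ≤ coord a b t v k from this k l hkl
  refine rot_induction (Φ := fun t v => ∀ k l : Fin 3, k ≠ l →
    -arcError a * coord a b t v l ≤ coord a b t v k) ?_ ?_ ?_ h hv
  · intro t h v hv k l hkl
    have hn := h.near_coord hv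
    have hε := arcError_pos a
    have hε' := h.err
    obtain ⟨n1, n2, n3, n4, n5, -, -, -⟩ := hn
    have m1 := mul_nonneg hε.le n4
    have m2 := mul_nonneg hε.le n5
    fin_cases k <;> fin_cases l <;> simp at hkl ⊢ <;> nlinarith
  · intro t v _ hΦ k l hkl
    have := hΦ (k + 2) (l + 2) (by simpa using hkl)
    rw [coord_rot, coord_rot] at this
    simpa [add_assoc] using this
  · intro t v h hΦ
    rwa [h.coord_neg] at hΦ

theorem half_le_sum_coord (h : Arc a b t) {v : ℤ × ℤ} (hv : IsCoprime v.1 v.2) :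
    1 / 2 ≤ coord a b t v 0 + coord a b t v 1 + coord a b t v 2 := by
  refine rot_induction (Φ := fun t v =>
    1 / 2 ≤ coord a b t v 0 + coord a b t v 1 + coord a b t v 2) ?_ ?_ ?_ h hv
  · intro t h v hv
    have hn := (h.near_coord hv).one_le_sum
    have : (1 : ℝ) ≤ v.1 := by exact_mod_cast FareyCone.fst_pos hv
    linarith
  · intro t v _ hΦ
    rw [coord_rot, coord_rot, coord_rot] at hΦ
    simp only [zero_add, Fin.reduceAdd] at hΦ
    linarith
  · intro t v h hΦ
    rwa [h.coord_neg] at hΦ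

theorem eq_cosh_lengths (h : Arc a b t) {v : ℤ × ℤ} (hv : IsCoprime v.1 v.2) (i : Fin 3) :
    t i v = 2 * Real.cosh (lengths t v i) ∧ 1 ≤ lengths t v i := by
  suffices ∀ i, t i v = 2 * Real.cosh (lengths t v i) ∧ 1 ≤ lengths t v i from this i
  refine rot_induction (Φ := fun t v =>
    ∀ i, t i v = 2 * Real.cosh (lengths t v i) ∧ 1 ≤ lengths t v i) ?_ ?_ ?_ h hv
  · intro t h v hv i
    rcases FareyCone.exists_edge hv with ⟨w, hw⟩ | ⟨w, hw⟩
    · exact ⟨(h.arcTrace i).eq_cosh_left hw, (h.arcTrace i).one_le_left hw⟩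
    · exact ⟨(h.arcTrace i).eq_cosh_right hw, (h.arcTrace i).one_le_right hw⟩
  · intro t v _ hΦ i
    have := hΦ (i + 2)
    rw [lengths_rot] at this
    simp only [rotTrace] at this
    simpa [add_assoc] using this
  · intro t v h hΦ i
    have := hΦ i
    rwa [h.lengths_neg, (h.markov i).even] at this

/-- Two vectors with positive first coordinate have slopes in a common one of the three arcs
`(-∞, 0]`, `[0, 1]` and `[1, ∞)`. -/
def SameArc (u w : ℤ × ℤ) : Prop :=
  (u.2 ≤ 0 ∧ w.2 ≤ 0) ∨ ((0 ≤ u.2 ∧ u.2 ≤ u.1) ∧ (0 ≤ w.2 ∧ w.2 ≤ w.1)) ∨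
    (u.1 ≤ u.2 ∧ w.1 ≤ w.2)

/-- The primitive vectors of finite slope, with positive first coordinate. -/
def FiniteSlope : Set (ℤ × ℤ) := {v | 0 < v.1 ∧ IsCoprime v.1 v.2}

/-- The relation of being in a common arc, with increasing slopes. -/
def ArcStep (u w : ℤ × ℤ) : Prop :=
  u ∈ FiniteSlope ∧ w ∈ FiniteSlope ∧ 0 < u.1 * w.2 - u.2 * w.1 ∧ SameArc u w

/-- Two finite slopes are joined by a chain of increasing slopes that stops at `0` and `1` if it
passes them. -/
theorem transGen_arcStep (hu : u ∈ FiniteSlope) (hw : w ∈ FiniteSlope)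
    (hd : 0 < u.1 * w.2 - u.2 * w.1) : Relation.TransGen ArcStep u w := by
  have hu1 := hu.1
  have hw1 := hw.1
  have m0 : ((1, 0) : ℤ × ℤ) ∈ FiniteSlope := ⟨by simp, isCoprime_one_left⟩
  have m1 : ((1, 1) : ℤ × ℤ) ∈ FiniteSlope := ⟨by simp, isCoprime_one_left⟩
  by_cases hs : SameArc u w
  · exact .single ⟨hu, hw, hd, hs⟩
  simp only [SameArc] at hs
  -- from slope `0` on
  have from0 : 0 < w.2 → Relation.TransGen ArcStep (1, 0) w := by
    intro h
    rcases le_or_gt w.2 w.1 with h1 | h1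
    · exact .single ⟨m0, hw, by simpa using h, .inr (.inl ⟨by simp, h.le, h1⟩)⟩
    · exact .head ⟨m0, m1, by simp, .inr (.inl (by simp))⟩
        (.single ⟨m1, hw, by simp only; linarith, .inr (.inr ⟨by simp, h1.le⟩)⟩)
  rcases lt_or_ge u.2 0 with h1 | h1
  · exact .head ⟨hu, m0, by simp only; linarith, .inl ⟨h1.le, by simp⟩⟩ (from0 (by omega))
  rcases lt_or_ge u.2 u.1 with h2 | h2
  · have h3 : w.1 < w.2 := by
      by_contra! hc
      have : w.2 < 0 := by omega
      nlinarith
    exact .head ⟨hu, m1, by simp only; linarith, .inr (.inl ⟨⟨h1, h2.le⟩, by simp⟩)⟩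
      (.single ⟨m1, hw, by simp only; linarith, .inr (.inr ⟨by simp, h3.le⟩)⟩)
  · exfalso
    have : w.2 < w.1 := by omega
    nlinarith

theorem mem_cone_zero (hu : u ∈ FiniteSlope) (h : 0 ≤ u.2 ∧ u.2 ≤ u.1) : u ∈ FareyCone :=
  ⟨h, hu.2⟩

/-- A vector of slope at least `1` as a rotate of a vector of the cone. -/
theorem exists_cone_one (a b : ℝ) (t : Fin 3 → ℤ × ℤ → ℝ) (hu : u ∈ FiniteSlope)
    (h : u.1 ≤ u.2) :
    (u.2, u.2 - u.1) ∈ FareyCone ∧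
      ∀ i, coord a b t u (i + 1) = coord a b (rotTrace t) (u.2, u.2 - u.1) i := by
  have h1 := hu.1
  obtain ⟨x, y, hxy⟩ := hu.2
  refine ⟨⟨by simp only; omega, ⟨x + y, -x, by simp only; linarith⟩⟩, fun i => ?_⟩
  rw [coord_rot]
  congr 1
  ext <;> simp [rotVec]

/-- A vector of slope at most `0` as a rotate of a vector of the cone. -/
theorem exists_cone_two (h' : Arc a b t) (hu : u ∈ FiniteSlope) (h : u.2 ≤ 0) :
    (u.1 - u.2, u.1) ∈ FareyCone ∧
      ∀ i, coord a b t u (i + 2) = coord a b (rotTrace (rotTrace t)) (u.1 - u.2, u.1) i := by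
  have h1 := hu.1
  obtain ⟨x, y, hxy⟩ := hu.2
  refine ⟨⟨by simp only; omega, ⟨-y, x + y, by simp only; linarith⟩⟩, fun i => ?_⟩
  rw [coord_rot, coord_rot, add_assoc, ← h'.coord_neg]
  congr 1
  ext <;> simp only [rotVec, Prod.fst_neg, Prod.snd_neg] <;> ring

theorem minor_single_one (u w : Fin 3 → ℝ) :
    det3 u w (Pi.single 1 1) = u 2 * w 0 - u 0 * w 2 := by
  simp [det3]
  ring

theorem minor_single_zero (u w : Fin 3 → ℝ) :
    det3 (Pi.single 0 1) u w = u 1 * w 2 - u 2 * w 1 := by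
  simp [det3]

theorem zero_add_one_pos (h : Arc a b t) (hu : u ∈ FiniteSlope) :
    0 < coord a b t u 0 + coord a b t u 1 := by
  have hε := arcError_pos a
  have hε' := h.err
  rcases le_or_gt u.2 0 with h0 | h0
  · obtain ⟨hc, he⟩ := h.exists_cone_two hu h0
    have hn := h.rot.rot.near_coord hc
    have e0 := he 1
    have e1 := he 2
    simp only [Fin.reduceAdd] at e0 e1
    have p := hn.one_pos hu.1
    have q := hn.le_one
    rw [e0, e1]
    nlinarith
  rcases le_or_gt u.2 u.1 with h1 | h1
  · have hn := h.near_coord (mem_cone_zero hu ⟨h0.le, h1⟩)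
    exact add_pos_of_nonneg_of_pos hn.zero_nonneg (hn.one_pos h0)
  · obtain ⟨hc, he⟩ := exists_cone_one a b t hu h1.le
    have hn := h.rot.near_coord hc
    have e0 := he 2
    have e1 := he 0
    simp only [Fin.reduceAdd, zero_add] at e0 e1
    have p := hn.zero_pos (by simp only; linarith [hu.1])
    have q := hn.le_zero
    rw [e0, e1]
    nlinarith

theorem minor_pos_of_arcStep (h : Arc a b t) (hs : ArcStep u w) :
    0 < coord a b t u 0 * coord a b t w 1 - coord a b t u 1 * coord a b t w 0 := by
  obtain ⟨hu, hw, hd, ⟨h1, h2⟩ | ⟨h1, h2⟩ | ⟨h1, h2⟩⟩ := hs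
  · obtain ⟨hc, he⟩ := h.exists_cone_two hu h1
    obtain ⟨hc', he'⟩ := h.exists_cone_two hw h2
    have e0 := he 1
    have e1 := he 2
    have f0 := he' 1
    have f1 := he' 2
    simp only [Fin.reduceAdd] at e0 e1 f0 f1
    rw [e0, e1, f0, f1]
    rcases eq_or_lt_of_le h1 with h3 | h3
    · exfalso
      rw [h3] at hd
      nlinarith [hu.1]
    · have := h.rot.rot.det3_pos FareyCone.one_zero_mem hc hc' (by simpa using hu.1)
        (by simp only; linarith)
      rw [h.rot.rot.coord_zero, minor_single_zero] at this
      exact this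
  · exact h.minor_pos (mem_cone_zero hu h1) (mem_cone_zero hw h2) hd
  · obtain ⟨hc, he⟩ := exists_cone_one a b t hu h1
    obtain ⟨hc', he'⟩ := exists_cone_one a b t hw h2
    have e0 := he 2
    have e1 := he 0
    have f0 := he' 2
    have f1 := he' 0
    simp only [Fin.reduceAdd, zero_add] at e0 e1 f0 f1
    rw [e0, e1, f0, f1]
    have := h.rot.det3_pos hc hc' FareyCone.one_one_mem (by simp only; linarith)
      (by simp only; linarith [hw.1])
    rw [h.rot.coord_one, minor_single_one] at this
    exact this

/-- Local convexity along chains of finite slopes. At the common end of two arcs, a vertex of the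
triangle, it holds because both adjacent points lie in the slightly enlarged triangle. -/
theorem det3_pos_of_arcStep (h : Arc a b t) (hs : ArcStep u w) (hs' : ArcStep w z) :
    0 < det3 (coord a b t u) (coord a b t w) (coord a b t z) := by
  have hε := arcError_pos a
  have hε' := h.err
  obtain ⟨hu, hw, hd, hs⟩ := hs
  obtain ⟨-, hz, hd', hs'⟩ := hs'
  have hu1 := hu.1
  have hw1 := hw.1
  have hz1 := hz.1
  by_cases h2 : u.2 ≤ 0 ∧ w.2 ≤ 0 ∧ z.2 ≤ 0
  · obtain ⟨hc, he⟩ := h.exists_cone_two hu h2.1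
    obtain ⟨hc', he'⟩ := h.exists_cone_two hw h2.2.1
    obtain ⟨hc'', he''⟩ := h.exists_cone_two hz h2.2.2
    have := h.rot.rot.det3_pos hc hc' hc'' (by simp only; linarith) (by simp only; linarith)
    rw [← funext he, ← funext he', ← funext he''] at this
    rw [← det3_shift, ← det3_shift]
    simpa [add_assoc] using this
  by_cases h1 : u.1 ≤ u.2 ∧ w.1 ≤ w.2 ∧ z.1 ≤ z.2
  · obtain ⟨hc, he⟩ := exists_cone_one a b t hu h1.1
    obtain ⟨hc', he'⟩ := exists_cone_one a b t hw h1.2.1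
    obtain ⟨hc'', he''⟩ := exists_cone_one a b t hz h1.2.2
    have := h.rot.det3_pos hc hc' hc'' (by simp only; linarith) (by simp only; linarith)
    rw [← funext he, ← funext he', ← funext he''] at this
    rw [← det3_shift]
    exact this
  by_cases h0 : (0 ≤ u.2 ∧ u.2 ≤ u.1) ∧ (0 ≤ w.2 ∧ w.2 ≤ w.1) ∧ (0 ≤ z.2 ∧ z.2 ≤ z.1)
  · exact h.det3_pos (mem_cone_zero hu h0.1) (mem_cone_zero hw h0.2.1) (mem_cone_zero hz h0.2.2)
      hd hd'
  -- the remaining cases are those where `w` is the common end of two arcs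
  have hw01 : (w.2 = 0 ∧ u.2 < 0 ∧ 0 < z.2 ∧ z.2 ≤ z.1) ∨
      (w.2 = w.1 ∧ 0 ≤ u.2 ∧ u.2 < u.1 ∧ z.1 < z.2) := by
    by_cases hw0 : w.2 = 0
    · left
      have hz2 : 0 < z.2 := by
        rw [hw0] at hd'
        by_contra! hc
        nlinarith
      have hu2 : u.2 < 0 := by
        rw [hw0] at hd
        by_contra! hc
        nlinarith
      refine ⟨hw0, hu2, hz2, ?_⟩
      simp only [SameArc] at hs'
      omega
    · right
      have hw2 : w.2 = w.1 := by
        simp only [SameArc] at hs hs'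
        omega
      have hz2 : z.1 < z.2 := by
        rw [hw2] at hd'
        by_contra! hc
        nlinarith
      have hu2 : u.2 < u.1 := by
        rw [hw2] at hd
        by_contra! hc
        nlinarith
      refine ⟨hw2, ?_, hu2, hz2⟩
      simp only [SameArc] at hs
      omega
  rcases hw01 with ⟨hw2, hu2, hz2, hz3⟩ | ⟨hw2, hu2, hu3, hz2⟩
  · have hwe : w = (1, 0) := by
      have := hw.2
      rw [hw2, isCoprime_zero_right, Int.isUnit_iff] at this
      ext <;> simp only <;> omega
    obtain ⟨hc, he⟩ := h.exists_cone_two hu hu2.le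
    have hn := h.rot.rot.near_coord hc
    have hn' := h.near_coord (mem_cone_zero hz ⟨hz2.le, hz3⟩)
    have e1 := he 2
    have e2 := he 0
    simp only [Fin.reduceAdd, zero_add] at e1 e2
    rw [hwe, h.coord_zero, det3_rotate, minor_single_zero, e1, e2]
    have p1 := hn.zero_pos (by simp only; linarith)
    have p2 := hn'.one_pos hz2
    have p3 := mul_le_mul (neg_le_neg hn'.le_one) (neg_le_neg hn.le_zero)
      (neg_nonneg.2 hn.two_le) (by nlinarith)
    have p4 := mul_pos p1 p2
    have p5 : arcError a * arcError a ≤ 1 / 16 := by nlinarith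
    have p6 := mul_le_mul_of_nonneg_right p5 p4.le
    nlinarith
  · have hwe : w = (1, 1) := by
      have := hw.2
      rw [hw2, isCoprime_self, Int.isUnit_iff] at this
      ext <;> simp only <;> omega
    obtain ⟨hc, he⟩ := exists_cone_one a b t hz hz2.le
    have hn := h.rot.near_coord hc
    have hn' := h.near_coord (mem_cone_zero hu ⟨hu2, hu3.le⟩)
    have e1 := he 2
    have e2 := he 1
    simp only [Fin.reduceAdd] at e1 e2
    rw [hwe, h.coord_one, det3_rotate, det3_rotate, minor_single_one, e1, e2]
    have p1 := hn.one_pos (by simp only; linarith)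
    have p2 := hn'.zero_pos hu3
    have p3 := mul_le_mul (neg_le_neg hn'.le_zero) (neg_le_neg hn.le_one)
      (neg_nonneg.2 hn.two_le) (by nlinarith)
    have p4 := mul_pos p1 p2
    have p5 : arcError a * arcError a ≤ 1 / 16 := by nlinarith
    have p6 := mul_le_mul_of_nonneg_right p5 p4.le
    nlinarith

/-- The minors that compare two points as seen from the third vertex of the triangle are
positive. -/
theorem minor_pos_of_det (h : Arc a b t) (hu : u ∈ FiniteSlope) (hw : w ∈ FiniteSlope)
    (hd : 0 < u.1 * w.2 - u.2 * w.1) :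
    0 < coord a b t u 0 * coord a b t w 1 - coord a b t u 1 * coord a b t w 0 :=
  (pos_of_transGen (fun hs => ⟨h.zero_add_one_pos hs.1, h.zero_add_one_pos hs.2.1⟩)
    (fun hs => h.minor_pos_of_arcStep hs) (fun hs hs' => h.det3_pos_of_arcStep hs hs')).1
    (transGen_arcStep hu hw hd)

/-- The points of increasing slopes are in convex position. -/
theorem det3_pos_of_det (h : Arc a b t) (hu : u ∈ FiniteSlope) (hw : w ∈ FiniteSlope)
    (hz : z ∈ FiniteSlope) (hd : 0 < u.1 * w.2 - u.2 * w.1) (hd' : 0 < w.1 * z.2 - w.2 * z.1) :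
    0 < det3 (coord a b t u) (coord a b t w) (coord a b t z) :=
  (pos_of_transGen (fun hs => ⟨h.zero_add_one_pos hs.1, h.zero_add_one_pos hs.2.1⟩)
    (fun hs => h.minor_pos_of_arcStep hs) (fun hs hs' => h.det3_pos_of_arcStep hs hs')).2
    (transGen_arcStep hu hw hd) (transGen_arcStep hw hz hd')

end Arc

/-! ### Supporting directions -/

theorem eq_of_det_eq_zero {u v : ℤ × ℤ} (hu : u ∈ Arc.FiniteSlope) (hv : v ∈ Arc.FiniteSlope)
    (h : u.1 * v.2 - u.2 * v.1 = 0) : u = v := by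
  have h1 : u.1 ∣ v.1 := hu.2.dvd_of_dvd_mul_left ⟨v.2, by linarith⟩
  have h2 : v.1 ∣ u.1 := hv.2.dvd_of_dvd_mul_left ⟨u.2, by linarith⟩
  have h3 : u.1 = v.1 := Int.dvd_antisymm hu.1.le hv.1.le h1 h2
  have h4 : v.1 * (v.2 - u.2) = 0 := by rw [h3] at h; linarith
  have h5 : v.2 - u.2 = 0 := by
    rcases mul_eq_zero.1 h4 with h | h
    · exact absurd h hv.1.ne'
    · exact h
  ext
  · exact h3
  · linarith

/-- A primitive vector is vertical or, up to sign, of finite slope. -/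
theorem finiteSlope_or {u : ℤ × ℤ} (hu : IsCoprime u.1 u.2) :
    (u ∈ Arc.FiniteSlope ∨ -u ∈ Arc.FiniteSlope) ∨ (u = (0, 1) ∨ -u = (0, 1)) := by
  rcases lt_trichotomy u.1 0 with h | h | h
  · exact .inl (.inr ⟨by simpa using h, by simpa using hu.neg_neg⟩)
  · right
    rw [h, isCoprime_zero_left, Int.isUnit_iff] at hu
    rcases hu with h2 | h2
    · left; ext <;> simp [h, h2]
    · right; ext <;> simp [h, h2]
  · exact .inl (.inl ⟨h, hu⟩)

namespace Arc

variable {a b : ℝ} {t : Fin 3 → ℤ × ℤ → ℝ} {u w v z : ℤ × ℤ}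

theorem det3_single_two (u w : Fin 3 → ℝ) :
    det3 u w (Pi.single 2 1) = u 0 * w 1 - u 1 * w 0 := by
  simp [det3]

/-- To test a functional on the points of all slopes it is enough to consider vectors of finite
slope and the vertical vector. -/
theorem forall_coprime (h : Arc a b t) {Ψ : (Fin 3 → ℝ) → Prop}
    (h1 : ∀ u ∈ FiniteSlope, Ψ (coord a b t u)) (h2 : Ψ (coord a b t (0, 1)))
    (hu : IsCoprime u.1 u.2) : Ψ (coord a b t u) := by
  rcases finiteSlope_or hu with (h3 | h3) | (h3 | h3)
  · exact h1 u h3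
  · rw [← h.coord_neg]; exact h1 _ h3
  · rwa [h3]
  · rwa [← h.coord_neg, h3]

open Filter Topology in
/-- Supporting directions at an interior slope: limits of secants from both sides. -/
theorem exists_support_interior (h : Arc a b t) {r s v : ℤ × ℤ} (h1 : FareyEdge r s)
    (h2 : FareyEdge s v) :
    ∃ α β : Fin 3 → ℝ, 0 < det3 (coord a b t s) α β ∧ ∀ u : ℤ × ℤ, IsCoprime u.1 u.2 →
      0 ≤ det3 (coord a b t s) α (coord a b t u) ∧ 0 ≤ det3 β (coord a b t s) (coord a b t u) := by
  obtain ⟨α, β, hα, hβ, hdet⟩ := h.exists_bary_limits h1 h2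
  have fin_of : ∀ {u w : ℤ × ℤ}, FareyEdge u w → u ∈ FiniteSlope ∧ w ∈ FiniteSlope := by
    intro u w hE
    obtain ⟨⟨c1, -, -⟩, c4, c5⟩ := hE.mem_cone
    have := hE.det
    exact ⟨⟨c1, ⟨w.2, -w.1, by linarith⟩⟩, ⟨by omega, ⟨-u.2, u.1, by linarith⟩⟩⟩
  have hs : s ∈ FiniteSlope := (fin_of h2).1
  refine ⟨α, β, hdet, fun u hu => ⟨?_, ?_⟩⟩
  · have hcont : Continuous fun z : Fin 3 → ℝ => det3 (coord a b t s) z (coord a b t u) := by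
      unfold det3; fun_prop
    have e : ∀ k : ℕ, det3 (coord a b t s)
        (bary a b (lengths t (v + k • s)) - (k : ℝ) • bary a b (lengths t s)) (coord a b t u) =
        det3 (coord a b t s) (coord a b t (v + k • s)) (coord a b t u) := by
      intro k
      simp only [det3, coord, Pi.sub_apply, Pi.smul_apply, smul_eq_mul]
      ring
    -- adding a multiple of the vector at `s` does not change the determinants
    refine ge_of_tendsto ((hcont.tendsto α).comp hα) ?_
    simp only [Function.comp, e]
    refine h.forall_coprime (Ψ := fun x => ∀ᶠ k : ℕ in atTop,
      0 ≤ det3 (coord a b t s) (coord a b t (v + k • s)) x) ?_ ?_ hu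
    · intro u hu
      rcases lt_trichotomy (s.1 * u.2 - s.2 * u.1) 0 with hd | hd | hd
      · refine .of_forall fun k => ?_
        have hk := h2.add_nsmul_left k
        rw [← det3_rotate]
        exact (h.det3_pos_of_det hu hs (fin_of hk).2 (by linarith) (by rw [hk.det]; simp)).le
      · rw [← eq_of_det_eq_zero hs hu hd]
        refine .of_forall fun k => le_of_eq ?_
        simp only [det3]
        ring
      · filter_upwards [eventually_ge_atTop (1 + (v.2 * u.1 - v.1 * u.2)).toNat] with k hk'
        have hk := h2.add_nsmul_left k
        refine (h.det3_pos_of_det hs (fin_of hk).2 hu (by rw [hk.det]; simp) ?_).le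
        have : 1 + (v.2 * u.1 - v.1 * u.2) ≤ k := Int.toNat_le.1 hk'
        simp only [Prod.fst_add, Prod.snd_add, Prod.smul_fst, Prod.smul_snd]
        simp only [nsmul_eq_mul]
        nlinarith
    · refine .of_forall fun k => ?_
      have hk := h2.add_nsmul_left k
      rw [h.coord_infty, det3_single_two]
      exact (h.minor_pos_of_det hs (fin_of hk).2 (by rw [hk.det]; simp)).le
  · have hcont : Continuous fun z : Fin 3 → ℝ => det3 z (coord a b t s) (coord a b t u) := by
      unfold det3; fun_prop
    have e : ∀ k : ℕ, det3 (bary a b (lengths t (r + k • s)) - (k : ℝ) • bary a b (lengths t s))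
        (coord a b t s) (coord a b t u) =
        det3 (coord a b t (r + k • s)) (coord a b t s) (coord a b t u) := by
      intro k
      simp only [det3, coord, Pi.sub_apply, Pi.smul_apply, smul_eq_mul]
      ring
    refine ge_of_tendsto ((hcont.tendsto β).comp hβ) ?_
    simp only [Function.comp, e]
    refine h.forall_coprime (Ψ := fun x => ∀ᶠ k : ℕ in atTop,
      0 ≤ det3 (coord a b t (r + k • s)) (coord a b t s) x) ?_ ?_ hu
    · intro u hu
      rcases lt_trichotomy (s.1 * u.2 - s.2 * u.1) 0 with hd | hd | hd
      · filter_upwards [eventually_ge_atTop (1 + (u.2 * r.1 - u.1 * r.2)).toNat] with k hk'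
        have hk := h1.add_nsmul_right k
        rw [← det3_rotate]
        refine (h.det3_pos_of_det hu (fin_of hk).1 hs ?_ (by rw [hk.det]; simp)).le
        have : 1 + (u.2 * r.1 - u.1 * r.2) ≤ k := Int.toNat_le.1 hk'
        simp only [Prod.fst_add, Prod.snd_add, Prod.smul_fst, Prod.smul_snd]
        simp only [nsmul_eq_mul]
        nlinarith
      · rw [← eq_of_det_eq_zero hs hu hd]
        refine .of_forall fun k => le_of_eq ?_
        simp only [det3]
        ring
      · refine .of_forall fun k => ?_
        have hk := h1.add_nsmul_right k
        exact (h.det3_pos_of_det (fin_of hk).1 hs hu (by rw [hk.det]; simp) hd).le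
    · refine .of_forall fun k => ?_
      have hk := h1.add_nsmul_right k
      rw [h.coord_infty, det3_single_two]
      exact (h.minor_pos_of_det (fin_of hk).1 hs (by rw [hk.det]; simp)).le

/-- Supporting directions at a vertex of the triangle: sides of the slightly enlarged triangle. -/
theorem exists_support_zero (h : Arc a b t) :
    ∃ α β : Fin 3 → ℝ, 0 < det3 (coord a b t (1, 0)) α β ∧ ∀ u : ℤ × ℤ, IsCoprime u.1 u.2 →
      0 ≤ det3 (coord a b t (1, 0)) α (coord a b t u) ∧
      0 ≤ det3 β (coord a b t (1, 0)) (coord a b t u) := by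
  have hε := arcError_pos a
  have hε' := h.err
  refine ⟨![0, 1, -arcError a], ![0, -arcError a, 1], ?_, fun u hu => ⟨?_, ?_⟩⟩
  · rw [h.coord_zero, minor_single_zero]
    simp
    nlinarith
  · have := h.neg_mul_coord_le hu (k := 2) (l := 1) (by simp)
    rw [h.coord_zero, minor_single_zero]
    simp
    linarith
  · have := h.neg_mul_coord_le hu (k := 1) (l := 2) (by simp)
    rw [h.coord_zero, det3_rotate, minor_single_zero]
    simp
    linarith

/-- Two supporting directions at the point of any slope: by the symmetry of order three, only
the interior slopes of one arc and one vertex of the triangle need to be considered. -/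
theorem exists_support (h : Arc a b t) (hv : IsCoprime v.1 v.2) :
    ∃ α β : Fin 3 → ℝ, 0 < det3 (coord a b t v) α β ∧ ∀ u : ℤ × ℤ, IsCoprime u.1 u.2 →
      0 ≤ det3 (coord a b t v) α (coord a b t u) ∧
      0 ≤ det3 β (coord a b t v) (coord a b t u) := by
  have hrot : ∀ t v, Arc a b t → (∃ α β : Fin 3 → ℝ, 0 < det3 (coord a b (rotTrace t) v) α β ∧
      ∀ u : ℤ × ℤ, IsCoprime u.1 u.2 →
      0 ≤ det3 (coord a b (rotTrace t) v) α (coord a b (rotTrace t) u) ∧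
      0 ≤ det3 β (coord a b (rotTrace t) v) (coord a b (rotTrace t) u)) →
      ∃ α β : Fin 3 → ℝ, 0 < det3 (coord a b t (rotVec v)) α β ∧ ∀ u : ℤ × ℤ,
      IsCoprime u.1 u.2 → 0 ≤ det3 (coord a b t (rotVec v)) α (coord a b t u) ∧
      0 ≤ det3 β (coord a b t (rotVec v)) (coord a b t u) := by
    rintro t v h ⟨α, β, h1, h2⟩
    have e : ∀ x : Fin 3 → ℝ, (fun i => (fun j => x (j + 2)) (i + 1)) = x := fun x => by
      funext i; simp [add_assoc]
    refine ⟨fun i => α (i + 2), fun i => β (i + 2), ?_, fun u hu => ?_⟩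
    · rw [← det3_shift, e, e, ← funext fun i => coord_rot a b t v i]
      exact h1
    · obtain ⟨u', hu', rfl⟩ := exists_rotVec_eq u hu
      obtain ⟨h3, h4⟩ := h2 u' hu'
      rw [← det3_shift, ← det3_shift (fun i => β (i + 2)), e, e,
        ← funext fun i => coord_rot a b t v i, ← funext fun i => coord_rot a b t u' i]
      exact ⟨h3, h4⟩
  refine rot_induction (Φ := fun t v => ∃ α β : Fin 3 → ℝ, 0 < det3 (coord a b t v) α β ∧
    ∀ u : ℤ × ℤ, IsCoprime u.1 u.2 → 0 ≤ det3 (coord a b t v) α (coord a b t u) ∧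
      0 ≤ det3 β (coord a b t v) (coord a b t u)) ?_ hrot ?_ h hv
  · intro t h v hv
    rcases eq_or_lt_of_le hv.1.1 with h0 | h0
    · have : v = (1, 0) := by
        have h3 := hv.2
        have := FareyCone.fst_pos hv
        rw [← h0, isCoprime_zero_right, Int.isUnit_iff] at h3
        ext <;> simp only <;> omega
      rw [this]
      exact h.exists_support_zero
    rcases eq_or_lt_of_le hv.1.2 with h1 | h1
    · have : v = rotVec (1, 0) := by
        have h3 := hv.2
        rw [h1, isCoprime_self, Int.isUnit_iff] at h3
        ext <;> simp [rotVec] <;> omega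
      rw [this]
      exact hrot _ _ h h.rot.exists_support_zero
    · obtain ⟨r, -, hr⟩ := Relation.TransGen.tail'_iff.1 (transGen_fareyEdge (u := (1, 0)) (w := v)
        (by simp) hv.1 isCoprime_one_left hv.2 (by simpa using h0))
      obtain ⟨s, hs, -⟩ := Relation.TransGen.head'_iff.1 (transGen_fareyEdge (u := v) (w := (1, 1))
        hv.1 (by simp) hv.2 isCoprime_one_left (by simp only; linarith))
      exact h.exists_support_interior hr hs
  · intro t v h hΦ
    rwa [h.coord_neg] at hΦ

end Arc

/-! ### Closed curves in convex position -/

/-- The convex hull of a compact set in a finite-dimensional space is compact. -/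
theorem IsCompact.isCompact_convexHull {E : Type*} [NormedAddCommGroup E] [NormedSpace ℝ E]
    [FiniteDimensional ℝ E] {s : Set E} (hs : IsCompact s) : IsCompact (convexHull ℝ s) := by
  rcases s.eq_empty_or_nonempty with rfl | ⟨p, hp⟩
  · simp
  set n := Module.finrank ℝ E + 1
  set F : (Fin n → ℝ) × (Fin n → E) → E := fun x => ∑ i, x.1 i • x.2 i with hF
  have hFc : Continuous F := by rw [hF]; fun_prop
  have hK : IsCompact (stdSimplex ℝ (Fin n) ×ˢ Set.univ.pi fun _ : Fin n => s) :=
    (isCompact_stdSimplex ℝ (Fin n)).prod (isCompact_univ_pi fun _ => hs)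
  suffices h : convexHull ℝ s = F '' (stdSimplex ℝ (Fin n) ×ˢ Set.univ.pi fun _ : Fin n => s) by
    rw [h]; exact hK.image hFc
  refine Set.Subset.antisymm (fun x hx => ?_) ?_
  · obtain ⟨ι, _, z, w, hz, hind, hw, hw1, rfl⟩ := eq_pos_convex_span_of_mem_convexHull hx
    have hcard : Fintype.card ι ≤ Fintype.card (Fin n) := by
      rw [Fintype.card_fin]
      exact hind.card_le_finrank_succ.trans
        (Nat.add_le_add_right (Submodule.finrank_le _) 1)
    obtain ⟨e⟩ := Function.Embedding.nonempty_of_card_le hcard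
    have hout : ∀ i ∉ Set.range e, Function.extend e w 0 i = 0 := fun i hi => by
      rw [Function.extend_apply' _ _ _ (by simpa using hi)]; rfl
    refine ⟨(Function.extend e w 0, Function.extend e z fun _ => p), ⟨⟨fun i => ?_, ?_⟩, ?_⟩, ?_⟩
    · by_cases hi : i ∈ Set.range e
      · obtain ⟨k, rfl⟩ := hi
        simp only [e.injective.extend_apply]
        exact (hw k).le
      · simp only [hout i hi, le_refl]
    · rw [← hw1]
      exact (Fintype.sum_of_injective e e.injective _ _ hout
        fun i => (e.injective.extend_apply _ _ _).symm).symm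
    · intro i _
      by_cases hi : i ∈ Set.range e
      · obtain ⟨k, rfl⟩ := hi
        simp only [e.injective.extend_apply]
        exact hz ⟨k, rfl⟩
      · simp only
        rw [Function.extend_apply' _ _ _ (by simpa using hi)]
        exact hp
    · refine (Fintype.sum_of_injective e e.injective _ _ (fun i hi => ?_) fun i => ?_).symm
      · simp only [hout i hi, zero_smul]
      · simp only [e.injective.extend_apply]
  · rintro _ ⟨⟨w, z⟩, ⟨⟨hw0, hw1⟩, hz⟩, rfl⟩
    exact (convex_convexHull ℝ s).sum_mem (fun i _ => hw0 i) hw1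
      fun i _ => subset_convexHull ℝ s (hz i trivial)

/-- Twice the signed area of a triangle. -/
def signedArea (p q r : Plane) : ℝ :=
  (q 0 - p 0) * (r 1 - p 1) - (q 1 - p 1) * (r 0 - p 0)

theorem plane_functional_apply (φ : Plane →L[ℝ] ℝ) (z : Plane) :
    φ z = φ (EuclideanSpace.single 0 1) * z 0 + φ (EuclideanSpace.single 1 1) * z 1 := by
  have : z = z 0 • EuclideanSpace.single 0 1 + z 1 • EuclideanSpace.single 1 1 := by
    ext i; fin_cases i <;> simp
  conv_lhs => rw [this]
  simp only [map_add, map_smul, smul_eq_mul]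
  ring

/-- The signed area over a segment of a level line of `φ` is a multiple of `φ`. -/
theorem exists_signedArea_eq {φ : Plane →L[ℝ] ℝ} (hφ : φ ≠ 0) {p q : Plane} (hpq : p ≠ q)
    (h : φ p = φ q) :
    ∃ c : ℝ, c ≠ 0 ∧ ∀ z, signedArea p q z = c * (φ p - φ z) := by
  have key := plane_functional_apply φ
  set c0 := φ (EuclideanSpace.single 0 1)
  set c1 := φ (EuclideanSpace.single 1 1)
  have hc : c0 ≠ 0 ∨ c1 ≠ 0 := by
    by_contra! hc
    refine hφ (ContinuousLinearMap.ext fun z => ?_)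
    rw [key, hc.1, hc.2]; simp
  have hd : c0 * (q 0 - p 0) + c1 * (q 1 - p 1) = 0 := by
    rw [key p, key q] at h; linarith
  have hne : q 0 - p 0 ≠ 0 ∨ q 1 - p 1 ≠ 0 := by
    by_contra! hc
    refine hpq ?_
    ext i; fin_cases i
    · exact (sub_eq_zero.1 hc.1).symm
    · exact (sub_eq_zero.1 hc.2).symm
  have hn : c0 ^ 2 + c1 ^ 2 ≠ 0 := by
    rcases hc with h | h <;> positivity
  refine ⟨(c0 * (q 1 - p 1) - c1 * (q 0 - p 0)) / (c0 ^ 2 + c1 ^ 2), ?_, fun z => ?_⟩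
  · refine div_ne_zero (fun h0 => ?_) hn
    have e0 : (c0 ^ 2 + c1 ^ 2) * (q 0 - p 0) = 0 := by linear_combination c0 * hd - c1 * h0
    have e1 : (c0 ^ 2 + c1 ^ 2) * (q 1 - p 1) = 0 := by linear_combination c1 * hd + c0 * h0
    rcases hne with h | h
    · exact (mul_ne_zero hn h) e0
    · exact (mul_ne_zero hn h) e1
  · rw [key p, key z, div_mul_eq_mul_div, eq_div_iff hn, signedArea]
    linear_combination (c0 * (z 1 - p 1) - c1 * (z 0 - p 0)) * hd

theorem signedArea_rotate (p q r : Plane) : signedArea p q r = signedArea q r p := by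
  unfold signedArea; ring

theorem signedArea_swap (p q r : Plane) : signedArea p q r = -signedArea q p r := by
  unfold signedArea; ring

/-- The points of a level line of a functional are collinear. -/
theorem signedArea_eq_zero {φ : Plane →L[ℝ] ℝ} (hφ : φ ≠ 0) {p q r : Plane} (h1 : φ p = φ q)
    (h2 : φ p = φ r) : signedArea p q r = 0 := by
  by_cases hpq : p = q
  · subst hpq; unfold signedArea; ring
  · obtain ⟨c, -, hc⟩ := exists_signedArea_eq hφ hpq h1
    rw [hc, h2]; ring

theorem Continuous.signedArea {X : Type*} [TopologicalSpace X] {f g h : X → Plane}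
    (hf : Continuous f) (hg : Continuous g) (hh : Continuous h) :
    Continuous fun x => signedArea (f x) (g x) (h x) := by
  have e : ∀ (k : X → Plane) (i : Fin 2), Continuous k → Continuous fun x => k x i :=
    fun k i hk => (EuclideanSpace.proj (𝕜 := ℝ) i).continuous.comp hk
  exact (((e g 0 hg).sub (e f 0 hf)).mul ((e h 1 hh).sub (e f 1 hf))).sub
    (((e g 1 hg).sub (e f 1 hf)).mul ((e h 0 hh).sub (e f 0 hf)))

/-- A proper convex combination attains an upper bound of its terms only if both of them do. -/
theorem eq_and_eq_of_le_combination {α β x y m : ℝ} (hα : 0 < α) (hβ : 0 < β) (hαβ : α + β = 1)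
    (hx : x ≤ m) (hy : y ≤ m) (h : m ≤ α * x + β * y) : x = m ∧ y = m := by
  have e : m = α * m + β * m := by rw [← add_mul, hαβ, one_mul]
  constructor
  · by_contra hne
    have h1 := mul_lt_mul_of_pos_left (lt_of_le_of_ne hx hne) hα
    have h2 := mul_le_mul_of_nonneg_left hy hβ.le
    linarith
  · by_contra hne
    have h1 := mul_lt_mul_of_pos_left (lt_of_le_of_ne hy hne) hβ
    have h2 := mul_le_mul_of_nonneg_left hx hα.le
    linarith

section Curve

variable {j : OnePoint ℝ → Plane}

/-- Convex position passes from rational to real parameters. -/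
theorem signedArea_nonneg_of_rat (hj : Continuous j)
    (h1 : ∀ r s t : ℚ, r < s → s < t → 0 < signedArea (j (r : ℝ)) (j (s : ℝ)) (j (t : ℝ)))
    {x y z : ℝ} (hxy : x < y) (hyz : y < z) :
    0 ≤ signedArea (j (x : ℝ)) (j (y : ℝ)) (j (z : ℝ)) := by
  have hc : Continuous fun v : ℝ × ℝ × ℝ =>
      signedArea (j (v.1 : ℝ)) (j (v.2.1 : ℝ)) (j (v.2.2 : ℝ)) := by
    have hcoe : Continuous fun x : ℝ => j (x : OnePoint ℝ) := hj.comp OnePoint.continuous_coe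
    exact (hcoe.comp continuous_fst).signedArea (hcoe.comp (continuous_fst.comp continuous_snd))
      (hcoe.comp (continuous_snd.comp continuous_snd))
  by_contra! hneg
  have hopen : IsOpen {v : ℝ × ℝ × ℝ | (v.1 < v.2.1 ∧ v.2.1 < v.2.2) ∧
      signedArea (j (v.1 : ℝ)) (j (v.2.1 : ℝ)) (j (v.2.2 : ℝ)) < 0} :=
    ((isOpen_lt continuous_fst (continuous_fst.comp continuous_snd)).inter
      (isOpen_lt (continuous_fst.comp continuous_snd)
        (continuous_snd.comp continuous_snd))).inter (isOpen_lt hc continuous_const)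
  have hd : DenseRange (Prod.map ((↑) : ℚ → ℝ) (Prod.map ((↑) : ℚ → ℝ) ((↑) : ℚ → ℝ))) :=
    Rat.denseRange_cast.prodMap (Rat.denseRange_cast.prodMap Rat.denseRange_cast)
  obtain ⟨⟨r, s, t⟩, ⟨h2, h3⟩, h4⟩ := hd.exists_mem_open hopen ⟨(x, y, z), ⟨hxy, hyz⟩, hneg⟩
  simp only [Prod.map_apply, Rat.cast_lt] at h2 h3 h4
  exact absurd (h1 r s t h2 h3) (by linarith)

theorem signedArea_infty_nonneg_of_rat (hj : Continuous j)
    (h1 : ∀ r s : ℚ, r < s → 0 < signedArea (j (r : ℝ)) (j (s : ℝ)) (j OnePoint.infty))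
    {x y : ℝ} (hxy : x < y) :
    0 ≤ signedArea (j (x : ℝ)) (j (y : ℝ)) (j OnePoint.infty) := by
  have hc : Continuous fun v : ℝ × ℝ =>
      signedArea (j (v.1 : ℝ)) (j (v.2 : ℝ)) (j OnePoint.infty) := by
    have hcoe : Continuous fun x : ℝ => j (x : OnePoint ℝ) := hj.comp OnePoint.continuous_coe
    exact (hcoe.comp continuous_fst).signedArea (hcoe.comp continuous_snd) continuous_const
  by_contra! hneg
  have hopen : IsOpen {v : ℝ × ℝ | v.1 < v.2 ∧
      signedArea (j (v.1 : ℝ)) (j (v.2 : ℝ)) (j OnePoint.infty) < 0} :=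
    (isOpen_lt continuous_fst continuous_snd).inter (isOpen_lt hc continuous_const)
  have hd : DenseRange (Prod.map ((↑) : ℚ → ℝ) ((↑) : ℚ → ℝ)) :=
    Rat.denseRange_cast.prodMap Rat.denseRange_cast
  obtain ⟨⟨r, s⟩, h2, h4⟩ := hd.exists_mem_open hopen ⟨(x, y), hxy, hneg⟩
  simp only [Prod.map_apply, Rat.cast_lt] at h2 h4
  exact absurd (h1 r s h2) (by linarith)

theorem range_subset_of_rat (hj : Continuous j) {A : Set Plane} (hA : IsClosed A)
    (h : ∀ r : ℚ, j (r : ℝ) ∈ A) : Set.range j ⊆ A := by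
  have hd : DenseRange fun r : ℚ => ((r : ℝ) : OnePoint ℝ) :=
    (OnePoint.denseRange_coe (X := ℝ)).comp Rat.denseRange_cast OnePoint.continuous_coe
  rintro _ ⟨x, rfl⟩
  refine (hA.preimage hj).closure_subset_iff.2 ?_ (hd x)
  rintro _ ⟨r, rfl⟩
  exact h r

/-- Two points of a level line of `φ` cannot both maximise `φ` on a curve that has strictly
convex arcs on both sides of the segment between them. -/
theorem eq_of_isMax_of_arcs {φ : Plane →L[ℝ] ℝ} (hφ : φ ≠ 0)
    (h1 : ∀ r s t : ℚ, r < s → s < t → 0 < signedArea (j (r : ℝ)) (j (s : ℝ)) (j (t : ℝ)))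
    {p q : Plane} (hpq : φ p = φ q) (hmax : ∀ y, φ (j y) ≤ φ p) {A B : Set ℚ}
    (hA : ∀ s ∈ A, signedArea p q (j (s : ℝ)) ≤ 0) (hB : ∀ s ∈ B, 0 ≤ signedArea p q (j (s : ℝ)))
    (hA3 : ∃ r ∈ A, ∃ s ∈ A, ∃ t ∈ A, r < s ∧ s < t)
    (hB3 : ∃ r ∈ B, ∃ s ∈ B, ∃ t ∈ B, r < s ∧ s < t) : p = q := by
  by_contra hne
  obtain ⟨c, hc, hcz⟩ := exists_signedArea_eq hφ hne hpq
  have key : ∀ D : Set ℚ, (∃ r ∈ D, ∃ s ∈ D, ∃ t ∈ D, r < s ∧ s < t) →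
      (∀ s ∈ D, φ (j (s : ℝ)) = φ p) → False := by
    rintro D ⟨r, hr, s, hs, t, ht, hrs, hst⟩ hD
    have h2 := h1 r s t hrs hst
    rw [signedArea_eq_zero hφ (by rw [hD r hr, hD s hs]) (by rw [hD r hr, hD t ht])] at h2
    exact lt_irrefl _ h2
  rcases lt_or_gt_of_ne hc with h | h
  · refine key B hB3 fun s hs => ?_
    have h2 := hB s hs
    rw [hcz] at h2
    have := hmax (s : ℝ)
    nlinarith
  · refine key A hA3 fun s hs => ?_
    have h2 := hA s hs
    rw [hcz] at h2
    have := hmax (s : ℝ)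
    nlinarith

theorem exists_rat_triple {x y : ℝ} (h : x < y) {A : Set ℚ}
    (hA : ∀ r : ℚ, x < r → (r : ℝ) < y → r ∈ A) :
    ∃ r ∈ A, ∃ s ∈ A, ∃ t ∈ A, r < s ∧ s < t := by
  obtain ⟨s, h1, h2⟩ := exists_rat_btwn h
  obtain ⟨r, h3, h4⟩ := exists_rat_btwn h1
  obtain ⟨t, h5, h6⟩ := exists_rat_btwn h2
  exact ⟨r, hA r h3 (h4.trans h2), s, hA s h1 h2, t, hA t (h1.trans h5) h6, by exact_mod_cast h4,
    by exact_mod_cast h5⟩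

/-- The curve has no two different points on a supporting line. -/
theorem eq_of_isMax (hj : Continuous j)
    (h1 : ∀ r s t : ℚ, r < s → s < t → 0 < signedArea (j (r : ℝ)) (j (s : ℝ)) (j (t : ℝ)))
    (h2 : ∀ r s : ℚ, r < s → 0 < signedArea (j (r : ℝ)) (j (s : ℝ)) (j OnePoint.infty))
    {φ : Plane →L[ℝ] ℝ} (hφ : φ ≠ 0) {x y : OnePoint ℝ} (hxy : φ (j x) = φ (j y))
    (hmax : ∀ z, φ (j z) ≤ φ (j x)) : j x = j y := by
  have fin : ∀ {x y : ℝ}, x < y → φ (j (x : ℝ)) = φ (j (y : ℝ)) →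
      (∀ z, φ (j z) ≤ φ (j (x : ℝ))) → j (x : ℝ) = j (y : ℝ) := by
    intro x y hlt hxy hmax
    refine eq_of_isMax_of_arcs hφ h1 hxy hmax (A := {r | x < r ∧ (r : ℝ) < y})
      (B := {r | y < r}) ?_ ?_ (exists_rat_triple hlt fun r h3 h4 => ⟨h3, h4⟩)
      (exists_rat_triple (lt_add_one y) fun r h3 _ => h3)
    · rintro s ⟨h3, h4⟩
      have := signedArea_nonneg_of_rat hj h1 h3 h4
      rw [← signedArea_rotate, signedArea_swap]
      linarith
    · intro s h3
      exact signedArea_nonneg_of_rat hj h1 hlt h3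
  have inf : ∀ {x : ℝ}, φ (j (x : ℝ)) = φ (j OnePoint.infty) →
      (∀ z, φ (j z) ≤ φ (j (x : ℝ))) → j (x : ℝ) = j OnePoint.infty := by
    intro x hxy hmax
    refine eq_of_isMax_of_arcs hφ h1 hxy hmax (A := {r | x < r})
      (B := {r | (r : ℝ) < x}) ?_ ?_ (exists_rat_triple (lt_add_one x) fun r h3 _ => h3)
      (exists_rat_triple (sub_one_lt x) fun r _ h3 => h3)
    · intro s h3
      have := signedArea_infty_nonneg_of_rat hj h2 h3
      rw [← signedArea_rotate, signedArea_swap]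
      linarith
    · intro s h3
      have := signedArea_infty_nonneg_of_rat hj h2 h3
      rwa [← signedArea_rotate]
  induction x using OnePoint.rec with
  | infty =>
    induction y using OnePoint.rec with
    | infty => rfl
    | coe y => exact (inf hxy.symm fun z => by rw [← hxy]; exact hmax z).symm
  | coe x =>
    induction y using OnePoint.rec with
    | infty => exact inf hxy hmax
    | coe y =>
      rcases lt_trichotomy x y with h | rfl | h
      · exact fin h hxy hmax
      · rfl
      · exact (fin h hxy.symm fun z => by rw [← hxy]; exact hmax z).symm

/-- A functional attains its maximum over the convex hull of the curve in exactly one point. -/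
theorem exists_unique_max (hj : Continuous j)
    (h1 : ∀ r s t : ℚ, r < s → s < t → 0 < signedArea (j (r : ℝ)) (j (s : ℝ)) (j (t : ℝ)))
    (h2 : ∀ r s : ℚ, r < s → 0 < signedArea (j (r : ℝ)) (j (s : ℝ)) (j OnePoint.infty))
    {φ : Plane →L[ℝ] ℝ} (hφ : φ ≠ 0) :
    ∃ x, ∀ z ∈ convexHull ℝ (Set.range j), φ z ≤ φ (j x) ∧ (φ z = φ (j x) → z = j x) := by
  obtain ⟨x, -, hx⟩ := isCompact_univ.exists_isMaxOn (Set.univ_nonempty (α := OnePoint ℝ))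
    (φ.continuous.comp hj).continuousOn
  have hmax : ∀ z, φ (j z) ≤ φ (j x) := fun z => hx (Set.mem_univ z)
  have hconv : Convex ℝ {z : Plane | φ z ≤ φ (j x) ∧ (φ z = φ (j x) → z = j x)} := by
    rintro z ⟨hz1, hz2⟩ w ⟨hw1, hw2⟩ α β hα hβ hαβ
    have e : φ (α • z + β • w) = α * φ z + β * φ w := by simp
    refine ⟨?_, fun h => ?_⟩
    · rw [e]
      have h3 := mul_le_mul_of_nonneg_left hz1 hα
      have h4 := mul_le_mul_of_nonneg_left hw1 hβ
      have h5 : α * φ (j x) + β * φ (j x) = φ (j x) := by rw [← add_mul, hαβ, one_mul]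
      linarith
    · rw [e] at h
      rcases hα.eq_or_lt with rfl | hα
      · rw [zero_add] at hαβ
        subst hαβ
        simp only [zero_mul, one_mul, zero_add] at h
        simp [hw2 h]
      rcases hβ.eq_or_lt with rfl | hβ
      · rw [add_zero] at hαβ
        subst hαβ
        simp only [zero_mul, one_mul, add_zero] at h
        simp [hz2 h]
      obtain ⟨hz3, hw3⟩ := eq_and_eq_of_le_combination hα hβ hαβ hz1 hw1 h.ge
      rw [hz2 hz3, hw2 hw3, ← add_smul, hαβ, one_smul]
  refine ⟨x, fun z hz => ?_⟩
  refine convexHull_min (s := Set.range j) ?_ hconv hz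
  rintro _ ⟨y, rfl⟩
  refine ⟨hmax y, fun h => (eq_of_isMax hj h1 h2 hφ h.symm hmax).symm⟩

theorem affineSpan_eq_top_of_signedArea_ne_zero {p q r : Plane} (h : signedArea p q r ≠ 0)
    {s : Set Plane} (hp : p ∈ s) (hq : q ∈ s) (hr : r ∈ s) : affineSpan ℝ s = ⊤ := by
  rw [eq_top_iff]
  intro z _
  set S := affineSpan ℝ s
  have hp' : p ∈ S := subset_affineSpan ℝ s hp
  have hq' : q -ᵥ p ∈ S.direction := AffineSubspace.vsub_mem_direction (subset_affineSpan ℝ s hq) hp'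
  have hr' : r -ᵥ p ∈ S.direction := AffineSubspace.vsub_mem_direction (subset_affineSpan ℝ s hr) hp'
  have e : z = ((signedArea p z r / signedArea p q r) • (q -ᵥ p) +
      (signedArea p q z / signedArea p q r) • (r -ᵥ p)) +ᵥ p := by
    have hi : ∀ i, z i = (signedArea p z r / signedArea p q r) * (q i - p i) +
        (signedArea p q z / signedArea p q r) * (r i - p i) + p i := by
      intro i
      rw [← sub_eq_iff_eq_add, div_mul_eq_mul_div, div_mul_eq_mul_div, ← add_div, eq_div_iff h]
      fin_cases i <;> simp only [signedArea, Fin.zero_eta, Fin.mk_one] <;> ring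
    ext i
    exact hi i
  rw [e]
  exact AffineSubspace.vadd_mem_of_mem_direction
    (S.direction.add_mem (S.direction.smul_mem _ hq') (S.direction.smul_mem _ hr')) hp'

/-- A closed curve in convex position, with a supporting line at the points of rational
parameter, is the boundary of its convex hull, and the convex hull is strictly convex. -/
theorem convexHull_range_of_curve (hj : Continuous j)
    (h1 : ∀ r s t : ℚ, r < s → s < t → 0 < signedArea (j (r : ℝ)) (j (s : ℝ)) (j (t : ℝ)))
    (h2 : ∀ r s : ℚ, r < s → 0 < signedArea (j (r : ℝ)) (j (s : ℝ)) (j OnePoint.infty))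
    (h3 : ∀ r : ℚ, ∃ φ : Plane →L[ℝ] ℝ, φ ≠ 0 ∧ ∀ y, φ (j y) ≤ φ (j (r : ℝ))) :
    IsCompact (convexHull ℝ (Set.range j)) ∧ (interior (convexHull ℝ (Set.range j))).Nonempty ∧
      StrictConvex ℝ (convexHull ℝ (Set.range j)) ∧
      Set.range j = frontier (convexHull ℝ (Set.range j)) := by
  set C := convexHull ℝ (Set.range j) with hC
  have hcomp : IsCompact C := (isCompact_range hj).isCompact_convexHull
  have hconv : Convex ℝ C := convex_convexHull ℝ _
  have hint : (interior C).Nonempty := by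
    rw [hC, interior_convexHull_nonempty_iff_affineSpan_eq_top]
    exact affineSpan_eq_top_of_signedArea_ne_zero (h1 0 1 2 (by norm_num) (by norm_num)).ne'
      ⟨_, rfl⟩ ⟨_, rfl⟩ ⟨_, rfl⟩
  have hsupp : ∀ z ∉ interior C, ∃ φ : Plane →L[ℝ] ℝ, φ ≠ 0 ∧ ∀ y ∈ C, φ y ≤ φ z := by
    intro z hz
    obtain ⟨φ, hφ⟩ := geometric_hahn_banach_open_point hconv.interior isOpen_interior hz
    refine ⟨φ, ?_, fun y hy => ?_⟩
    · rintro rfl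
      obtain ⟨y, hy⟩ := hint
      simpa using hφ y hy
    · have hy' : y ∈ closure (interior C) := by
        rw [hconv.closure_interior_eq_closure_of_nonempty_interior hint]
        exact subset_closure hy
      exact closure_minimal (fun y hy => (hφ y hy).le)
        (isClosed_le φ.continuous continuous_const) hy'
  refine ⟨hcomp, hint, ?_, ?_⟩
  · intro x hx y hy hxy α β hα hβ hαβ
    by_contra hz
    obtain ⟨φ, hφ, hle⟩ := hsupp _ hz
    obtain ⟨w, hw⟩ := exists_unique_max hj h1 h2 hφ
    have e : φ (α • x + β • y) = α * φ x + β * φ y := by simp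
    have hz' := hw _ (hconv hx hy hα.le hβ.le hαβ)
    have h4 := hle _ (subset_convexHull ℝ _ (Set.mem_range_self w))
    rw [e] at hz' h4
    obtain ⟨a1, a2⟩ := hw x hx
    obtain ⟨b1, b2⟩ := hw y hy
    obtain ⟨c1, c2⟩ := eq_and_eq_of_le_combination hα hβ hαβ a1 b1 h4
    exact hxy ((a2 c1).trans (b2 c2).symm)
  · refine Set.Subset.antisymm ?_ fun z hz => ?_
    · have hrat : ∀ r : ℚ, j (r : ℝ) ∈ frontier C := by
        intro r
        rw [hcomp.isClosed.frontier_eq]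
        refine ⟨subset_convexHull ℝ _ (Set.mem_range_self _), fun hi => ?_⟩
        obtain ⟨φ, hφ, hle⟩ := h3 r
        have hle' : ∀ y ∈ C, φ y ≤ φ (j (r : ℝ)) := fun y hy =>
          convexHull_min (s := Set.range j) (t := {y | φ y ≤ φ (j (r : ℝ))})
            (by rintro _ ⟨y, rfl⟩; exact hle y)
            (convex_halfSpace_le φ.isLinear _) hy
        obtain ⟨v, hv⟩ : ∃ v, φ v ≠ 0 := by
          by_contra! hc
          exact hφ (ContinuousLinearMap.ext fun z => by simp [hc z])
        have htend : Filter.Tendsto (fun c : ℝ => j (r : ℝ) + c • φ v • v) (nhds 0)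
            (nhds (j (r : ℝ))) := by
          have : Continuous fun c : ℝ => j (r : ℝ) + c • φ v • v := by fun_prop
          simpa using this.tendsto 0
        have hev := htend.eventually (isOpen_interior.mem_nhds hi)
        obtain ⟨c, hc, hc0⟩ := ((hev.filter_mono nhdsWithin_le_nhds).and
          (self_mem_nhdsWithin (s := Set.Ioi (0 : ℝ)))).exists
        have h5 := hle' _ (interior_subset hc)
        simp only [map_add, map_smul, smul_eq_mul] at h5
        have : 0 < c * (φ v * φ v) := mul_pos hc0 (mul_self_pos.2 hv)
        linarith
      exact range_subset_of_rat hj isClosed_frontier hrat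
    · rw [hcomp.isClosed.frontier_eq] at hz
      obtain ⟨φ, hφ, hle⟩ := hsupp z hz.2
      obtain ⟨w, hw⟩ := exists_unique_max hj h1 h2 hφ
      obtain ⟨a1, a2⟩ := hw z hz.1
      exact ⟨w, (a2 (le_antisymm a1 (hle _ (subset_convexHull ℝ _ (Set.mem_range_self w))))).symm⟩

end Curve

/-! ### Geometry of the triangle in the plane -/

theorem projPoint_apply_zero (v : Fin 3 → ℝ) :
    projPoint v 0 = (v 0 - (v 1 + v 2) / 2) / (v 0 + v 1 + v 2) := by
  simp [projPoint, corner, Fin.sum_univ_three]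
  ring

theorem projPoint_apply_one (v : Fin 3 → ℝ) :
    projPoint v 1 = √3 / 2 * (v 1 - v 2) / (v 0 + v 1 + v 2) := by
  simp [projPoint, corner, Fin.sum_univ_three]
  ring

theorem projPoint_smul {c : ℝ} (hc : c ≠ 0) (v : Fin 3 → ℝ) :
    projPoint (c • v) = projPoint v := by
  have e : c * v 0 + c * v 1 + c * v 2 = c * (v 0 + v 1 + v 2) := by ring
  ext i
  fin_cases i
  · simp only [Fin.zero_eta, projPoint_apply_zero, Pi.smul_apply, smul_eq_mul, e]
    rw [← mul_div_mul_left (v 0 - (v 1 + v 2) / 2) _ hc]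
    congr 1
    ring
  · simp only [Fin.mk_one, projPoint_apply_one, Pi.smul_apply, smul_eq_mul, e]
    rw [← mul_div_mul_left (√3 / 2 * (v 1 - v 2)) _ hc]
    congr 1
    ring

theorem signedArea_projPoint {u v w : Fin 3 → ℝ} (hu : u 0 + u 1 + u 2 ≠ 0)
    (hv : v 0 + v 1 + v 2 ≠ 0) (hw : w 0 + w 1 + w 2 ≠ 0) :
    signedArea (projPoint u) (projPoint v) (projPoint w) =
      3 * √3 / 2 * det3 u v w /
        ((u 0 + u 1 + u 2) * (v 0 + v 1 + v 2) * (w 0 + w 1 + w 2)) := by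
  have key : ∀ {p q r σ : ℝ}, p + q + r = σ → p = σ - q - r := fun h => by linarith
  rw [eq_div_iff (by positivity)]
  simp only [signedArea, projPoint_apply_zero, projPoint_apply_one, det3]
  obtain ⟨σ, hσ⟩ : ∃ σ, u 0 + u 1 + u 2 = σ := ⟨_, rfl⟩
  obtain ⟨τ, hτ⟩ : ∃ τ, v 0 + v 1 + v 2 = τ := ⟨_, rfl⟩
  obtain ⟨ω, hω⟩ : ∃ ω, w 0 + w 1 + w 2 = ω := ⟨_, rfl⟩
  rw [hσ] at hu; rw [hτ] at hv; rw [hω] at hw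
  rw [hσ, hτ, hω, key hσ, key hτ, key hω]
  field_simp
  ring

/-- The signed factor by which the triangle of vertices `projPoint (sideLengths a b k)` is
obtained from the triangle of the corners. -/
noncomputable def triScale (a b : ℝ) : ℝ := -(b - a) / (a + 2 * b)

theorem triScale_ne_zero {a b : ℝ} (hab : a ≠ b) (hb : a + 2 * b ≠ 0) : triScale a b ≠ 0 :=
  div_ne_zero (neg_ne_zero.2 (sub_ne_zero.2 hab.symm)) hb

theorem sum_bary {a b : ℝ} (hab : a ≠ b) (hb : a + 2 * b ≠ 0) (v : Fin 3 → ℝ) :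
    v 0 + v 1 + v 2 = (a + 2 * b) * (bary a b v 0 + bary a b v 1 + bary a b v 2) := by
  obtain ⟨h0, h1, h2⟩ := bary_spec hab hb v
  linarith

/-- Passing to the basis `sideLengths a b k` amounts to a homothety of the plane. -/
theorem projPoint_eq_triScale_smul {a b : ℝ} (hab : a ≠ b) (hb : a + 2 * b ≠ 0)
    (v : Fin 3 → ℝ) : projPoint v = triScale a b • projPoint (bary a b v) := by
  have hs := sum_bary hab hb v
  obtain ⟨h0, h1, h2⟩ := bary_spec hab hb v
  ext i
  fin_cases i
  · simp only [Fin.zero_eta, PiLp.smul_apply, projPoint_apply_zero, smul_eq_mul, triScale]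
    rw [hs, div_mul_div_comm]
    congr 1
    linarith
  · simp only [Fin.mk_one, PiLp.smul_apply, projPoint_apply_one, smul_eq_mul, triScale]
    rw [hs, div_mul_div_comm]
    congr 1
    rw [h1, h2]
    ring

theorem projPoint_single (k : Fin 3) : projPoint (Pi.single k 1) = corner k := by
  fin_cases k <;> simp [projPoint]

theorem projPoint_sideLengths {a b : ℝ} (hab : a ≠ b) (hb : a + 2 * b ≠ 0) (k : Fin 3) :
    projPoint (sideLengths a b k) = triScale a b • corner k := by
  rw [projPoint_eq_triScale_smul hab hb, bary_sideLengths hab hb, projPoint_single]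

/-- The normalised barycentric coordinates with respect to the triangle of vertices
`c • corner k`. -/
noncomputable def baryAt (c : ℝ) (y : Plane) : Fin 3 → ℝ :=
  fun k => 1 / 3 + 2 / 3 * c⁻¹ * (corner k 0 * y 0 + corner k 1 * y 1)

theorem sum_baryAt (c : ℝ) (y : Plane) : baryAt c y 0 + baryAt c y 1 + baryAt c y 2 = 1 := by
  simp [baryAt, corner]
  ring

theorem baryAt_combination (c : ℝ) (y z : Plane) {α β : ℝ} (h : α + β = 1) (k : Fin 3) :
    baryAt c (α • y + β • z) k = α * baryAt c y k + β * baryAt c z k := by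
  simp only [baryAt, PiLp.add_apply, PiLp.smul_apply, smul_eq_mul]
  linear_combination -(1 / 3) * h

theorem continuous_baryAt (c : ℝ) (k : Fin 3) : Continuous fun y => baryAt c y k := by
  have e : ∀ i : Fin 2, Continuous fun y : Plane => y i :=
    fun i => (EuclideanSpace.proj (𝕜 := ℝ) i).continuous
  exact continuous_const.add (continuous_const.mul
    ((continuous_const.mul (e 0)).add (continuous_const.mul (e 1))))

theorem eq_smul_sum_baryAt {c : ℝ} (hc : c ≠ 0) (y : Plane) :
    y = ∑ k, baryAt c y k • c • corner k := by
  have h3 : √3 * √3 = 3 := Real.mul_self_sqrt (by norm_num)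
  ext i
  fin_cases i
  · simp [baryAt, corner, Fin.sum_univ_three]
    field_simp
    ring
  · simp [baryAt, corner, Fin.sum_univ_three]
    field_simp
    linear_combination (-2 * y 1) * h3

theorem baryAt_smul_projPoint {c : ℝ} (hc : c ≠ 0) {x : Fin 3 → ℝ} (hx : x 0 + x 1 + x 2 ≠ 0)
    (k : Fin 3) : baryAt c (c • projPoint x) k = x k / (x 0 + x 1 + x 2) := by
  have h3 : √3 * √3 = 3 := Real.mul_self_sqrt (by norm_num)
  have key : ∀ {p q r σ : ℝ}, p + q + r = σ → p = σ - q - r := fun h => by linarith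
  simp only [baryAt, PiLp.smul_apply, projPoint_apply_zero, projPoint_apply_one, smul_eq_mul]
  obtain ⟨σ, hσ⟩ : ∃ σ, x 0 + x 1 + x 2 = σ := ⟨_, rfl⟩
  rw [hσ] at hx
  rw [hσ]
  fin_cases k
  · simp [corner]; field_simp; linarith
  · simp [corner]; field_simp; linear_combination (x 1 - x 2) * h3 - 2 * hσ
  · simp [corner]; field_simp; linear_combination -(x 1 - x 2) * h3 - 2 * hσ

/-- A slightly enlarged triangle: it is bounded by six lines through the vertices, close to the
sides. -/
def nearTriangle (c δ : ℝ) : Set Plane :=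
  {y | ∀ k l : Fin 3, k ≠ l → -δ * baryAt c y l ≤ baryAt c y k}

theorem convex_nearTriangle (c δ : ℝ) : Convex ℝ (nearTriangle c δ) := by
  intro y hy z hz α β hα hβ hαβ k l hkl
  rw [baryAt_combination c y z hαβ, baryAt_combination c y z hαβ]
  have h1 := mul_le_mul_of_nonneg_left (hy k l hkl) hα
  have h2 := mul_le_mul_of_nonneg_left (hz k l hkl) hβ
  linarith

theorem isClosed_nearTriangle (c δ : ℝ) : IsClosed (nearTriangle c δ) := by
  simp only [nearTriangle, Set.ofPred_forall]
  exact isClosed_iInter fun k => isClosed_iInter fun l => isClosed_iInter fun _ =>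
    isClosed_le (continuous_const.mul (continuous_baryAt c l)) (continuous_baryAt c k)

theorem sum_univ_of_distinct {G : Type*} [AddCommMonoid G] {i k l : Fin 3} (hik : i ≠ k)
    (hil : i ≠ l) (hkl : k ≠ l) (f : Fin 3 → G) : ∑ j, f j = f i + f k + f l := by
  have e : (Finset.univ : Finset (Fin 3)) = {i, k, l} := by decide +revert
  rw [e, Finset.sum_insert (by simp [hik, hil]), Finset.sum_pair hkl, add_assoc]

/-- A point of the slightly enlarged triangle has at most one negative coordinate, and moving it to
another coordinate gives a nearby point of the triangle. -/
theorem exists_mem_triangle_dist_le {c δ : ℝ} (hc : c ≠ 0) (hδ : 0 ≤ δ) (hδ' : δ ≤ 1) {y : Plane}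
    (hy : y ∈ nearTriangle c δ) :
    ∃ z ∈ convexHull ℝ (Set.range fun k => c • corner k),
      dist y z ≤ δ * Metric.diam (convexHull ℝ (Set.range fun k => c • corner k)) := by
  set T := convexHull ℝ (Set.range fun k => c • corner k) with hT
  have hv : ∀ k, c • corner k ∈ T := fun k => subset_convexHull ℝ _ ⟨k, rfl⟩
  have hbdd : Bornology.IsBounded T := by
    rw [hT, isBounded_convexHull]
    exact (Set.finite_range _).isBounded
  have hmem : ∀ x : Fin 3 → ℝ, (∀ k, 0 ≤ x k) → x 0 + x 1 + x 2 = 1 →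
      ∑ k, x k • c • corner k ∈ T := fun x hx hx1 =>
    (convex_convexHull ℝ _).sum_mem (fun k _ => hx k) (by rw [Fin.sum_univ_three]; exact hx1)
      fun k _ => hv k
  have hsum := sum_baryAt c y
  have hxy := eq_smul_sum_baryAt hc y
  set x := baryAt c y
  by_cases hpos : ∀ k, 0 ≤ x k
  · refine ⟨y, ?_, ?_⟩
    · rw [hxy]; exact hmem x hpos hsum
    · rw [dist_self]; exact mul_nonneg hδ Metric.diam_nonneg
  push Not at hpos
  -- the negative coordinate `k` is moved to another one
  obtain ⟨k, hk⟩ := hpos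
  obtain ⟨l, m, hkl, hkm, hlm⟩ : ∃ l m : Fin 3, k ≠ l ∧ k ≠ m ∧ l ≠ m := by
    clear * -
    decide +revert
  have hf := sum_univ_of_distinct (G := Plane) hkl hkm hlm
  have hf' := fun f : Fin 3 → ℝ =>
    (Fin.sum_univ_three f).symm.trans (sum_univ_of_distinct hkl hkm hlm f)
  have hs : x k + x l + x m = 1 := (hf' x).symm.trans hsum
  have h1 := hy k l hkl
  have h2 := hy k m hkm
  have h3 : 0 ≤ x l := by
    by_contra! hc
    have := mul_nonneg hδ (neg_nonneg.2 hc.le)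
    change -δ * x l ≤ x k at h1
    linarith
  have h4 : 0 ≤ x m := by
    by_contra! hc
    have := mul_nonneg hδ (neg_nonneg.2 hc.le)
    change -δ * x m ≤ x k at h2
    linarith
  change -δ * x l ≤ x k at h1
  change -δ * x m ≤ x k at h2
  have h5 : 0 ≤ x l + x k := by
    have := mul_le_mul_of_nonneg_right hδ' h3
    linarith
  have h6 : -x k ≤ δ := by nlinarith
  have hz := hmem (fun i => if i = k then 0 else if i = l then x l + x k else x i)
    (fun i => ?_) ?_
  · refine ⟨_, hz, ?_⟩
    have e : y - ∑ i, (if i = k then 0 else if i = l then x l + x k else x i) • c • corner i =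
        (-x k) • (c • corner l - c • corner k) := by
      conv_lhs => rw [hxy]
      rw [hf, hf]
      simp only [hkl.symm, hkm.symm, hlm.symm, if_true, if_false]
      module
    rw [dist_eq_norm, e, norm_smul, Real.norm_eq_abs, abs_of_nonneg (by linarith),
      ← dist_eq_norm]
    exact mul_le_mul h6 (Metric.dist_le_diam_of_mem hbdd (hv l) (hv k)) dist_nonneg hδ
  · split_ifs with h7 h8
    · exact le_rfl
    · exact h5
    · by_contra! h9
      have : i = m := by
        clear * - h7 h8 hkl hkm hlm
        omega
      rw [this] at h9
      linarith
  · have e := hf' fun i => if i = k then 0 else if i = l then x l + x k else x i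
    simp only [hkl.symm, hkm.symm, hlm.symm, if_true, if_false] at e
    rw [e]
    linarith

theorem hausdorffDist_triangle_le {c δ : ℝ} (hc : c ≠ 0) (hδ : 0 ≤ δ) (hδ' : δ ≤ 1)
    {C : Set Plane} (h1 : convexHull ℝ (Set.range fun k => c • corner k) ⊆ C)
    (h2 : C ⊆ nearTriangle c δ) :
    Metric.hausdorffDist C (convexHull ℝ (Set.range fun k => c • corner k)) ≤
      δ * Metric.diam (convexHull ℝ (Set.range fun k => c • corner k)) := by
  have h0 := mul_nonneg hδ (Metric.diam_nonneg
    (s := convexHull ℝ (Set.range fun k : Fin 3 => c • corner k)))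
  refine Metric.hausdorffDist_le_of_mem_dist h0 (fun y hy => ?_) fun y hy => ⟨y, h1 hy, ?_⟩
  · exact exists_mem_triangle_dist_le hc hδ hδ' (h2 hy)
  · rw [dist_self]; exact h0

/-- In the coordinates of a basis of two unit vectors at angle `π / 3`, a cone slightly larger than
the one that they span: the cosine of the angle of two of its vectors is at least
`1 / 2 - 2 * δ`. -/
theorem cos_cone_ge {δ p q p' q' : ℝ} (hδ : 0 ≤ δ) (hδ' : δ ≤ 1 / 4) (h1 : -δ * q ≤ p)
    (h2 : -δ * p ≤ q) (h1' : -δ * q' ≤ p') (h2' : -δ * p' ≤ q') :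
    (1 / 2 - 2 * δ) * (√(p ^ 2 + p * q + q ^ 2) * √(p' ^ 2 + p' * q' + q' ^ 2)) ≤
      p * p' + q * q' + (p * q' + q * p') / 2 := by
  have hd : 1 - δ ^ 2 ≠ 0 := by nlinarith
  have hd' : 0 < 1 - δ ^ 2 := by nlinarith
  -- coordinates with respect to the edges of the larger cone
  obtain ⟨α, hα, β, hβ, rfl, rfl⟩ : ∃ α, 0 ≤ α ∧ ∃ β, 0 ≤ β ∧ p = α - δ * β ∧ q = β - δ * α := by
    refine ⟨(p + δ * q) / (1 - δ ^ 2), div_nonneg (by linarith) hd'.le,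
      (q + δ * p) / (1 - δ ^ 2), div_nonneg (by linarith) hd'.le, ?_, ?_⟩ <;>
    · field_simp
      ring
  obtain ⟨α', hα', β', hβ', rfl, rfl⟩ :
      ∃ α, 0 ≤ α ∧ ∃ β, 0 ≤ β ∧ p' = α - δ * β ∧ q' = β - δ * α := by
    refine ⟨(p' + δ * q') / (1 - δ ^ 2), div_nonneg (by linarith) hd'.le,
      (q' + δ * p') / (1 - δ ^ 2), div_nonneg (by linarith) hd'.le, ?_, ?_⟩ <;>
    · field_simp
      ring
  clear h1 h2 h1' h2'
  obtain ⟨A, hA⟩ : ∃ A, A = 1 - δ + δ ^ 2 := ⟨_, rfl⟩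
  obtain ⟨B, hB⟩ : ∃ B, B = (1 - 4 * δ + δ ^ 2) / 2 := ⟨_, rfl⟩
  have hA0 : 3 / 4 ≤ A := by nlinarith [sq_nonneg (1 - 2 * δ)]
  have hB0 : 0 ≤ B := by rw [hB]; nlinarith
  have hBA : B ≤ A := by rw [hA, hB]; nlinarith
  have hκ : (1 / 2 - 2 * δ) * A ≤ B := by
    rw [hB]; nlinarith [mul_nonneg hδ (sub_nonneg.2 hA0)]
  have e : ∀ α β : ℝ, (α - δ * β) ^ 2 + (α - δ * β) * (β - δ * α) + (β - δ * α) ^ 2 =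
      A * (α ^ 2 + β ^ 2) + 2 * B * (α * β) := fun α β => by rw [hA, hB]; ring
  have e' : (α - δ * β) * (α' - δ * β') + (β - δ * α) * (β' - δ * α') +
      ((α - δ * β) * (β' - δ * α') + (β - δ * α) * (α' - δ * β')) / 2 =
      A * (α * α' + β * β') + B * (α * β' + β * α') := by rw [hA, hB]; ring
  rw [e, e, e', ← Real.sqrt_mul (by positivity)]
  set X := A * (α ^ 2 + β ^ 2) + 2 * B * (α * β)
  set X' := A * (α' ^ 2 + β' ^ 2) + 2 * B * (α' * β')
  set Y := A * (α * α' + β * β') + B * (α * β' + β * α')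
  have hA1 : 0 < A := by linarith
  have hY : 0 ≤ Y := by positivity
  have hX : A * (α ^ 2 + β ^ 2) ≤ X := le_add_of_nonneg_right (by positivity)
  have hX' : A * (α' ^ 2 + β' ^ 2) ≤ X' := le_add_of_nonneg_right (by positivity)
  have hXX : A ^ 2 * (α * β' - β * α') ^ 2 ≤ X * X' := by
    refine le_trans ?_ (mul_le_mul hX hX' (by positivity) (le_trans (by positivity) hX))
    have : 0 ≤ A ^ 2 * (α * α' + β * β') ^ 2 := by positivity
    linarith
  have hgram : A ^ 2 * Y ^ 2 - B ^ 2 * (X * X') =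
      (A ^ 2 - B ^ 2) * (X * X' - A ^ 2 * (α * β' - β * α') ^ 2) := by
    simp only [X, X', Y]; ring
  have hAB : 0 ≤ A ^ 2 - B ^ 2 := by nlinarith
  have h3 : B ^ 2 * (X * X') ≤ A ^ 2 * Y ^ 2 := by
    have := mul_nonneg hAB (sub_nonneg.2 hXX)
    linarith
  have h4 : B * √(X * X') ≤ A * Y := by
    have h5 := Real.sqrt_le_sqrt h3
    rw [Real.sqrt_mul (by positivity), Real.sqrt_sq hB0, ← mul_pow,
      Real.sqrt_sq (by positivity)] at h5
    exact h5
  have h6 : A * ((1 / 2 - 2 * δ) * √(X * X')) ≤ A * Y := by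
    refine le_trans ?_ h4
    have := mul_le_mul_of_nonneg_right hκ (Real.sqrt_nonneg (X * X'))
    linarith
  exact le_of_mul_le_mul_left h6 hA1

theorem inner_corner_sub {i k l : Fin 3} (hik : i ≠ k) (hil : i ≠ l) (hkl : k ≠ l) :
    inner ℝ (corner k - corner i) (corner l - corner i) = (3 / 2 : ℝ) := by
  have h3 : √3 * √3 = 3 := Real.mul_self_sqrt (by norm_num)
  fin_cases i <;> fin_cases k <;> fin_cases l <;> simp at hik hil hkl ⊢ <;>
    simp [corner, PiLp.inner_apply, Fin.sum_univ_two] <;> linarith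

theorem norm_corner_sub {i k : Fin 3} (hik : i ≠ k) : ‖corner k - corner i‖ = √3 := by
  have h3 : √3 * √3 = 3 := Real.mul_self_sqrt (by norm_num)
  rw [EuclideanSpace.norm_eq]
  congr 1
  fin_cases i <;> fin_cases k <;> simp at hik ⊢ <;>
    simp [corner] <;> nlinarith

theorem angle_triangle {c : ℝ} (hc : c ≠ 0) {i k l : Fin 3} (hik : i ≠ k) (hil : i ≠ l)
    (hkl : k ≠ l) :
    EuclideanGeometry.angle (c • corner k) (c • corner i) (c • corner l) =
      Real.arccos (1 / 2) := by
  have h3 : √3 * √3 = 3 := Real.mul_self_sqrt (by norm_num)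
  rw [EuclideanGeometry.angle, vsub_eq_sub, vsub_eq_sub, ← smul_sub, ← smul_sub,
    InnerProductGeometry.angle_smul_smul hc, InnerProductGeometry.angle,
    inner_corner_sub hik hil hkl, norm_corner_sub hik, norm_corner_sub hil, h3]
  norm_num

/-- The slightly enlarged triangle is contained in a slightly enlarged angle at each vertex. -/
theorem angle_nearTriangle_le {c δ : ℝ} (hc : c ≠ 0) (hδ : 0 ≤ δ) (hδ' : δ ≤ 1 / 4)
    {i k l : Fin 3} (hik : i ≠ k) (hil : i ≠ l) (hkl : k ≠ l) {x y : Plane}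
    (hx : x ∈ nearTriangle c δ) (hy : y ∈ nearTriangle c δ) (hxi : x ≠ c • corner i)
    (hyi : y ≠ c • corner i) :
    EuclideanGeometry.angle x (c • corner i) y ≤ Real.arccos (1 / 2 - 2 * δ) := by
  have key : ∀ z : Plane, z - c • corner i = baryAt c z k • c • (corner k - corner i) +
      baryAt c z l • c • (corner l - corner i) := by
    intro z
    have h1 := eq_smul_sum_baryAt hc z
    have h2 := sum_baryAt c z
    rw [← Fin.sum_univ_three, sum_univ_of_distinct hik hil hkl] at h2
    have h4 : baryAt c z i = 1 - baryAt c z k - baryAt c z l := by linarith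
    conv_lhs => rw [h1]
    rw [sum_univ_of_distinct hik hil hkl, h4]
    module
  set e := c • (corner k - corner i)
  set f := c • (corner l - corner i)
  have hee : inner ℝ e e = 3 * c ^ 2 := by
    rw [real_inner_self_eq_norm_sq, norm_smul, norm_corner_sub hik, mul_pow, Real.sq_sqrt
      (by norm_num), Real.norm_eq_abs, sq_abs]
    ring
  have hff : inner ℝ f f = 3 * c ^ 2 := by
    rw [real_inner_self_eq_norm_sq, norm_smul, norm_corner_sub hil, mul_pow, Real.sq_sqrt
      (by norm_num), Real.norm_eq_abs, sq_abs]
    ring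
  have hef : inner ℝ e f = 3 / 2 * c ^ 2 := by
    rw [real_inner_smul_left, real_inner_smul_right, inner_corner_sub hik hil hkl]
    ring
  have hin : ∀ p q p' q' : ℝ, inner ℝ (p • e + q • f) (p' • e + q' • f) =
      3 * c ^ 2 * (p * p' + q * q' + (p * q' + q * p') / 2) := by
    intro p q p' q'
    rw [inner_add_left, inner_add_right, inner_add_right]
    simp only [real_inner_smul_left, real_inner_smul_right, hee, hff, hef, real_inner_comm e f]
    ring
  have hnorm : ∀ p q : ℝ, ‖p • e + q • f‖ = √(3 * c ^ 2) * √(p ^ 2 + p * q + q ^ 2) := by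
    intro p q
    rw [norm_eq_sqrt_real_inner, hin, ← Real.sqrt_mul (by positivity)]
    congr 1
    ring
  rw [EuclideanGeometry.angle, vsub_eq_sub, vsub_eq_sub, InnerProductGeometry.angle]
  refine Real.arccos_le_arccos ?_
  rw [le_div_iff₀ (mul_pos (norm_pos_iff.2 (sub_ne_zero.2 hxi))
    (norm_pos_iff.2 (sub_ne_zero.2 hyi))), key x, key y, hin, hnorm, hnorm]
  have h1 := cos_cone_ge hδ hδ' (hx k l hkl) (hx l k hkl.symm) (hy k l hkl) (hy l k hkl.symm)
  have h2 := mul_le_mul_of_nonneg_left h1 (show 0 ≤ 3 * c ^ 2 by positivity)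
  have h3 : √(3 * c ^ 2) * √(3 * c ^ 2) = 3 * c ^ 2 := Real.mul_self_sqrt (by positivity)
  refine le_trans (le_of_eq ?_) h2
  rw [mul_mul_mul_comm, h3]
  ring

/-- The angle of the enlarged cone is close to `π / 3`, by continuity. -/
theorem exists_arccos_le {ε : ℝ} (hε : 0 < ε) :
    ∃ δ₀ > 0, ∀ δ, δ ≤ δ₀ → Real.arccos (1 / 2 - 2 * δ) ≤ Real.arccos (1 / 2) + ε := by
  have hcont : Continuous fun δ : ℝ => Real.arccos (1 / 2 - 2 * δ) :=
    Real.continuous_arccos.comp (by fun_prop)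
  have h0 : (fun δ : ℝ => Real.arccos (1 / 2 - 2 * δ)) 0 < Real.arccos (1 / 2) + ε := by
    simp only [mul_zero, sub_zero]; linarith
  have hev := (hcont.tendsto 0).eventually_lt_const h0
  obtain ⟨δ₀, hδ₀, h1⟩ := Metric.eventually_nhds_iff.1 hev
  refine ⟨δ₀ / 2, by positivity, fun δ hδ => ?_⟩
  refine le_trans (Real.arccos_le_arccos (by linarith : 1 / 2 - 2 * (δ₀ / 2) ≤ 1 / 2 - 2 * δ))
    (h1 (y := δ₀ / 2) ?_).le
  rw [Real.dist_eq, sub_zero, abs_of_pos (by positivity)]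
  linarith

/-- The functional of the plane whose values on `projPoint v` are, up to an additive constant, the
values of the functional `m` of the space at the normalised vector. -/
noncomputable def planeFunctional (m : Fin 3 → ℝ) : Plane →L[ℝ] ℝ :=
  (m 0 - (m 1 + m 2) / 2) • EuclideanSpace.proj 0 +
    (√3 / 2 * (m 1 - m 2)) • EuclideanSpace.proj 1

theorem planeFunctional_apply (m : Fin 3 → ℝ) (y : Plane) :
    planeFunctional m y = (m 0 - (m 1 + m 2) / 2) * y 0 + √3 / 2 * (m 1 - m 2) * y 1 := by
  simp [planeFunctional]

theorem planeFunctional_projPoint (m : Fin 3 → ℝ) {v : Fin 3 → ℝ} (hv : v 0 + v 1 + v 2 ≠ 0) :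
    planeFunctional m (projPoint v) =
      3 / 2 * ((m 0 * v 0 + m 1 * v 1 + m 2 * v 2) / (v 0 + v 1 + v 2)) -
        (m 0 + m 1 + m 2) / 2 := by
  have h3 : √3 * √3 = 3 := Real.mul_self_sqrt (by norm_num)
  rw [planeFunctional_apply, projPoint_apply_zero, projPoint_apply_one]
  obtain ⟨σ, hσ⟩ : ∃ σ, v 0 + v 1 + v 2 = σ := ⟨_, rfl⟩
  rw [hσ] at hv
  rw [hσ]
  field_simp
  linear_combination (m 1 - m 2) * (v 1 - v 2) * h3 - 2 * (m 0 + m 1 + m 2) * hσ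

/-- The functional `u ↦ -det3 v w u`. -/
def negMinors (v w : Fin 3 → ℝ) : Fin 3 → ℝ :=
  ![-(v 1 * w 2 - v 2 * w 1), -(v 2 * w 0 - v 0 * w 2), -(v 0 * w 1 - v 1 * w 0)]

theorem negMinors_apply (v w u : Fin 3 → ℝ) :
    negMinors v w 0 * u 0 + negMinors v w 1 * u 1 + negMinors v w 2 * u 2 = -det3 v w u := by
  simp only [negMinors, det3, Matrix.cons_val_zero, Matrix.cons_val_one, Matrix.cons_val]
  ring

theorem planeFunctional_negMinors_le {α β u v : Fin 3 → ℝ} (hv : 0 < v 0 + v 1 + v 2)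
    (hu : 0 < u 0 + u 1 + u 2) (h : 0 ≤ det3 α β u) (h0 : det3 α β v = 0) :
    planeFunctional (negMinors α β) (projPoint u) ≤
      planeFunctional (negMinors α β) (projPoint v) := by
  rw [planeFunctional_projPoint _ hu.ne', planeFunctional_projPoint _ hv.ne', negMinors_apply,
    negMinors_apply, h0]
  have := div_nonneg h hu.le
  rw [neg_div]
  simp only [neg_zero, zero_div, mul_zero]
  linarith

/-! ### The continuous extension -/

/-- A continuous map on `ℝ ∪ {∞}` glued from three arcs, parametrised by `[0, 1]`, with the end
points `0`, `1` and `∞`. -/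
theorem exists_continuous_onePoint {X : Type*} [TopologicalSpace X] {f g k : ℝ → X}
    (hf : Continuous f) (hg : Continuous g) (hk : Continuous k) (h1 : f 1 = g 0) (h0 : k 1 = f 0)
    (h2 : g 1 = k 0) :
    ∃ j : OnePoint ℝ → X, Continuous j ∧
      (∀ x : ℝ, 0 ≤ x → x ≤ 1 → j (x : OnePoint ℝ) = f x) ∧
      (∀ x : ℝ, 1 ≤ x → j (x : OnePoint ℝ) = g (1 - 1 / x)) ∧
      (∀ x : ℝ, x ≤ 0 → j (x : OnePoint ℝ) = k (1 / (1 - x))) ∧ j OnePoint.infty = g 1 := by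
  set F : ℝ → X := fun x => if x ≤ 0 then k (1 / max 1 (1 - x)) else
    if x ≤ 1 then f x else g (1 - 1 / max 1 x) with hF
  have hmax : ∀ y : ℝ, max 1 y ≠ 0 := fun y => (lt_of_lt_of_le one_pos (le_max_left 1 y)).ne'
  have hcont : Continuous F := by
    refine Continuous.if_le (hk.comp ?_) (Continuous.if_le hf (hg.comp ?_) continuous_id
      continuous_const ?_) continuous_id continuous_const ?_
    · exact continuous_const.div (by fun_prop) fun x => hmax _
    · exact continuous_const.sub (continuous_const.div (by fun_prop) fun x => hmax _)
    · rintro x rfl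
      simpa using h1
    · rintro x rfl
      simpa using h0
  have hneg : ∀ x : ℝ, x ≤ 0 → F x = k (1 / (1 - x)) := fun x hx => by
    simp only [hF, if_pos hx]
    rw [max_eq_right (by linarith)]
  have hpos : ∀ x : ℝ, 1 ≤ x → F x = g (1 - 1 / x) := fun x hx => by
    simp only [hF, if_neg (show ¬ x ≤ 0 by linarith), max_eq_right hx]
    split_ifs with h
    · rw [le_antisymm h hx]; simpa using h1
    · rfl
  refine ⟨fun x => x.elim (g 1) F, ?_, fun x hx hx' => ?_, fun x hx => hpos x hx,
    fun x hx => hneg x hx, rfl⟩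
  · rw [OnePoint.continuous_iff]
    refine ⟨?_, hcont⟩
    rw [Filter.coclosedCompact_eq_cocompact, cocompact_eq_atBot_atTop, Filter.tendsto_sup]
    constructor
    · have h3 : Filter.Tendsto (fun x : ℝ => 1 / (1 - x)) Filter.atBot (nhds 0) := by
        simp only [one_div]
        have h4 : Filter.Tendsto (fun x : ℝ => 1 + -x) Filter.atBot Filter.atTop :=
          Filter.tendsto_atTop_add_const_left _ _ Filter.tendsto_neg_atBot_atTop
        simp only [← sub_eq_add_neg] at h4
        exact tendsto_inv_atTop_zero.comp h4
      change Filter.Tendsto F _ (nhds (g 1))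
      rw [h2]
      refine ((hk.tendsto 0).comp h3).congr' ?_
      filter_upwards [Filter.eventually_le_atBot 0] with x hx using (hneg x hx).symm
    · have h3 : Filter.Tendsto (fun x : ℝ => 1 - 1 / x) Filter.atTop (nhds 1) := by
        simpa using (tendsto_const_nhds (x := (1 : ℝ))).sub (tendsto_inv_atTop_zero (𝕜 := ℝ))
      refine ((hg.tendsto 1).comp h3).congr' ?_
      filter_upwards [Filter.eventually_ge_atTop 1] with x hx using (hpos x hx).symm
  · change F x = f x
    simp only [hF, hx', if_true]
    split_ifs with h
    · rw [le_antisymm h hx]; simpa using h0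
    · rfl

theorem continuous_projPoint_comp {X : Type*} [TopologicalSpace X] {G : X → Fin 3 → ℝ}
    (hG : Continuous G) (h : ∀ x, G x 0 + G x 1 + G x 2 ≠ 0) :
    Continuous fun x => projPoint (G x) := by
  unfold projPoint
  have hi : ∀ i, Continuous fun x => G x i := fun i => (continuous_apply i).comp hG
  refine Continuous.smul (Continuous.inv₀ (continuous_finsetSum _ fun i _ => hi i) fun x => ?_)
    (continuous_finsetSum _ fun i _ => (hi i).smul continuous_const)
  rw [Fin.sum_univ_three]
  exact h x

namespace Arc

variable {a b : ℝ} {t : Fin 3 → ℤ × ℤ → ℝ} {u w v : ℤ × ℤ}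

theorem sum_lengths (h : Arc a b t) (v : ℤ × ℤ) :
    lengths t v 0 + lengths t v 1 + lengths t v 2 =
      (a + 2 * b) * (coord a b t v 0 + coord a b t v 1 + coord a b t v 2) :=
  sum_bary h.ne h.add_ne _

theorem sum_lengths_pos (h : Arc a b t) (hv : IsCoprime v.1 v.2) :
    0 < lengths t v 0 + lengths t v 1 + lengths t v 2 := by
  have h1 := h.half_le_sum_coord hv
  have h2 : 0 < a + 2 * b := by linarith [h.four_le, h.lt]
  rw [h.sum_lengths]
  exact mul_pos h2 (by linarith)

/-- The points of the slopes in `[0, 1]` extend to a continuous curve, since the half lengths divided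
by the denominators are Lipschitz functions of the slope. -/
theorem exists_param (h : Arc a b t) (k : Fin 3) :
    ∃ f : ℝ → Plane, Continuous f ∧ ∀ v ∈ FareyCone,
      f ((v.2 : ℝ) / v.1) = projPoint fun i => lengths t v (i + k) := by
  have hc : 0 < a + 2 * b := by linarith [h.four_le, h.lt]
  have hb : 0 ≤ b + 1 := by linarith [h.four_le, h.lt]
  classical
  set S : Set ℝ := {x | ∃ v ∈ FareyCone, (v.2 : ℝ) / v.1 = x} with hS
  set F : Fin 3 → ℝ → ℝ := fun i x =>
    if hx : x ∈ S then lengths t hx.choose i / hx.choose.1 else 0 with hF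
  have hFv : ∀ i, ∀ v ∈ FareyCone, F i ((v.2 : ℝ) / v.1) = lengths t v i / v.1 := by
    intro i v hv
    have hx : (v.2 : ℝ) / v.1 ∈ S := ⟨v, hv, rfl⟩
    have h1 := hx.choose_spec
    have hpos : (0 : ℝ) < v.1 := by exact_mod_cast FareyCone.fst_pos hv
    have hpos' : (0 : ℝ) < hx.choose.1 := by exact_mod_cast FareyCone.fst_pos h1.1
    have h2 : hx.choose = v := by
      refine eq_of_det_eq_zero ⟨FareyCone.fst_pos h1.1, h1.1.2⟩ ⟨FareyCone.fst_pos hv, hv.2⟩ ?_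
      have h3 := h1.2
      rw [div_eq_div_iff hpos'.ne' hpos.ne'] at h3
      have h4 : ((hx.choose.1 * v.2 - hx.choose.2 * v.1 : ℤ) : ℝ) = 0 := by
        push_cast
        linarith
      exact_mod_cast h4
    simp only [hF, dif_pos hx]
    rw [h2]
  have hle : ∀ i, ∀ u ∈ FareyCone, ∀ w ∈ FareyCone, (u.2 : ℝ) / u.1 < w.2 / w.1 →
      |F i ((w.2 : ℝ) / w.1) - F i ((u.2 : ℝ) / u.1)| ≤
        (b + 1) * ((w.2 : ℝ) / w.1 - (u.2 : ℝ) / u.1) := by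
    intro i u hu w hw hlt
    rw [hFv i u hu, hFv i w hw]
    refine h.abs_sub_le hu hw ?_ i
    have hpos : (0 : ℝ) < u.1 := by exact_mod_cast FareyCone.fst_pos hu
    have hpos' : (0 : ℝ) < w.1 := by exact_mod_cast FareyCone.fst_pos hw
    rw [div_lt_div_iff₀ hpos hpos'] at hlt
    have h4 : (0 : ℝ) < ((u.1 * w.2 - u.2 * w.1 : ℤ) : ℝ) := by
      push_cast
      linarith
    exact_mod_cast h4
  have hlip : ∀ i, LipschitzOnWith (b + 1).toNNReal (F i) S := by
    intro i
    refine LipschitzOnWith.of_dist_le_mul ?_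
    rintro _ ⟨u, hu, rfl⟩ _ ⟨w, hw, rfl⟩
    rw [Real.coe_toNNReal _ hb, Real.dist_eq, Real.dist_eq]
    rcases lt_trichotomy ((u.2 : ℝ) / u.1) (w.2 / w.1) with h1 | h1 | h1
    · rw [abs_sub_comm, abs_sub_comm ((u.2 : ℝ) / u.1), abs_of_pos (sub_pos.2 h1)]
      exact hle i u hu w hw h1
    · rw [h1]; simp
    · rw [abs_of_pos (sub_pos.2 h1)]
      exact hle i w hw u hu h1
  choose g hg hgS using fun i => (hlip i).extend_real
  have hgv : ∀ i, ∀ v ∈ FareyCone, g i ((v.2 : ℝ) / v.1) = lengths t v i / v.1 :=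
    fun i v hv => by rw [← hgS i ⟨v, hv, rfl⟩, hFv i v hv]
  have hgc : ∀ i, Continuous (g i) := fun i => (hg i).continuous
  have hsum : ∀ x : ℝ, 0 ≤ x → x ≤ 1 → (a + 2 * b) / 2 ≤ g 0 x + g 1 x + g 2 x := by
    have hcl : IsClosed {x : ℝ | (a + 2 * b) / 2 ≤ g 0 x + g 1 x + g 2 x} :=
      isClosed_le continuous_const (((hgc 0).add (hgc 1)).add (hgc 2))
    have hrat : Set.Ioo (0 : ℝ) 1 ∩ Set.range ((↑) : ℚ → ℝ) ⊆
        {x : ℝ | (a + 2 * b) / 2 ≤ g 0 x + g 1 x + g 2 x} := by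
      rintro _ ⟨⟨h1, h2⟩, r, rfl⟩
      have hv : ((r.den, r.num) : ℤ × ℤ) ∈ FareyCone := by
        have h1 : (0 : ℚ) < r := by exact_mod_cast h1
        have h2 : r < 1 := by exact_mod_cast h2
        refine ⟨⟨(Rat.num_pos.2 h1).le, ?_⟩, r.isCoprime_num_den.symm⟩
        have := Rat.num_lt_denom_iff.2 h2
        simp only
        omega
      have e : (r : ℝ) = (((r.den, r.num) : ℤ × ℤ).2 : ℝ) / (((r.den, r.num) : ℤ × ℤ).1 : ℤ) := by
        simp [Rat.cast_def]
      have hpos : (0 : ℝ) < (((r.den, r.num) : ℤ × ℤ).1 : ℤ) := by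
        exact_mod_cast FareyCone.fst_pos hv
      have hn := (h.near_coord hv).one_le_sum
      change (a + 2 * b) / 2 ≤ g 0 r + g 1 r + g 2 r
      rw [e, hgv 0 _ hv, hgv 1 _ hv, hgv 2 _ hv, ← add_div, ← add_div, le_div_iff₀ hpos,
        h.sum_lengths]
      have := mul_le_mul_of_nonneg_left hn hc.le
      linarith
    intro x hx hx'
    have h1 := closure_minimal hrat hcl
    have h2 := closure_minimal (Rat.denseRange_cast.open_subset_closure_inter
      (isOpen_Ioo (a := (0 : ℝ)) (b := 1))) isClosed_closure
    rw [closure_Ioo (by norm_num)] at h2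
    exact h1 (h2 ⟨hx, hx'⟩)
  have hcl : ∀ x : ℝ, 0 ≤ max 0 (min x 1) ∧ max 0 (min x 1) ≤ 1 := fun x =>
    ⟨le_max_left _ _, max_le zero_le_one (min_le_right _ _)⟩
  refine ⟨fun x => projPoint fun i => g (i + k) (max 0 (min x 1)), ?_, fun v hv => ?_⟩
  · refine continuous_projPoint_comp ?_ fun x => ?_
    · exact continuous_pi fun i => (hgc _).comp (by fun_prop)
    · have h1 := hsum _ (hcl x).1 (hcl x).2
      refine ne_of_gt ?_
      have h2 : 0 < g 0 (max 0 (min x 1)) + g 1 (max 0 (min x 1)) + g 2 (max 0 (min x 1)) := by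
        linarith
      fin_cases k <;> simp <;> linarith
  · have hpos : (0 : ℝ) < v.1 := by exact_mod_cast FareyCone.fst_pos hv
    have h1 : (0 : ℝ) ≤ v.2 := by exact_mod_cast hv.1.1
    have h2 : (v.2 : ℝ) ≤ v.1 := by exact_mod_cast hv.1.2
    have h3 : max 0 (min ((v.2 : ℝ) / v.1) 1) = (v.2 : ℝ) / v.1 := by
      rw [min_eq_left ((div_le_one hpos).2 h2), max_eq_right (div_nonneg h1 hpos.le)]
    simp only [h3, hgv _ v hv]
    rw [← projPoint_smul (inv_ne_zero hpos.ne') fun i => lengths t v (i + k)]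
    congr 1
    funext i
    rw [Pi.smul_apply, smul_eq_mul, div_eq_inv_mul]

/-- The points of all slopes extend to a continuous closed curve, which consists of three arcs that
correspond to each other under the symmetry of order three. -/
theorem exists_curve (h : Arc a b t) :
    ∃ j : OnePoint ℝ → Plane, Continuous j ∧
      (∀ v ∈ FiniteSlope, j (((v.2 : ℝ) / v.1 : ℝ) : OnePoint ℝ) = projPoint (lengths t v)) ∧
      j OnePoint.infty = projPoint (lengths t (0, 1)) := by
  obtain ⟨f, hf, hf'⟩ := h.exists_param 0
  obtain ⟨g, hg, hg'⟩ := h.rot.exists_param 2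
  obtain ⟨k, hk, hk'⟩ := h.rot.rot.exists_param 1
  have e1 : ∀ v : ℤ × ℤ, (fun i => lengths (rotTrace t) v (i + 2)) = lengths t (rotVec v) := by
    intro v
    funext i
    rw [lengths_rot, add_assoc]
    simp
  have e2 : ∀ v : ℤ × ℤ, (fun i => lengths (rotTrace (rotTrace t)) v (i + 1)) =
      lengths t (rotVec (rotVec v)) := by
    intro v
    funext i
    rw [lengths_rot, lengths_rot, add_assoc, add_assoc]
    simp
  simp only [add_zero] at hf'
  simp only [e1] at hg'
  simp only [e2] at hk'
  have m0 := FareyCone.one_zero_mem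
  have m1 := FareyCone.one_one_mem
  have g0 : g 0 = projPoint (lengths t (1, 1)) := by simpa [rotVec] using hg' _ m0
  have g1 : g 1 = projPoint (lengths t (0, 1)) := by simpa [rotVec] using hg' _ m1
  have k0 : k 0 = projPoint (lengths t (0, 1)) := by simpa [rotVec] using hk' _ m0
  have k1 : k 1 = projPoint (lengths t (1, 0)) := by
    have := hk' _ m1
    rw [← h.lengths_neg] at this
    simpa [rotVec] using this
  have f0 : f 0 = projPoint (lengths t (1, 0)) := by simpa using hf' _ m0
  have f1 : f 1 = projPoint (lengths t (1, 1)) := by simpa using hf' _ m1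
  obtain ⟨j, hj, j0, j1, j2, jinf⟩ := exists_continuous_onePoint hf hg hk (f1.trans g0.symm)
    (k1.trans f0.symm) (g1.trans k0.symm)
  refine ⟨j, hj, fun v hv => ?_, jinf.trans g1⟩
  have hpos : (0 : ℝ) < v.1 := by exact_mod_cast hv.1
  rcases le_or_gt v.2 0 with h0 | h0
  · have h0' : (v.2 : ℝ) ≤ 0 := by exact_mod_cast h0
    obtain ⟨hc, -⟩ := h.exists_cone_two hv h0
    have h3 := hk' _ hc
    have e : rotVec (rotVec (v.1 - v.2, v.1)) = -v := by
      ext <;> simp only [rotVec, Prod.fst_neg, Prod.snd_neg] <;> ring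
    rw [e, h.lengths_neg] at h3
    rw [j2 _ (div_nonpos_of_nonpos_of_nonneg h0' hpos.le), ← h3]
    congr 1
    have : (v.1 : ℝ) - v.2 ≠ 0 := by linarith
    push_cast
    field_simp
  rcases le_or_gt v.2 v.1 with h1 | h1
  · have h1' : (v.2 : ℝ) ≤ v.1 := by exact_mod_cast h1
    rw [j0 _ (div_nonneg (by exact_mod_cast h0.le) hpos.le) ((div_le_one hpos).2 h1'),
      hf' v ⟨⟨h0.le, h1⟩, hv.2⟩]
  · have h1' : (v.1 : ℝ) ≤ v.2 := by exact_mod_cast h1.le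
    have h0' : (0 : ℝ) < v.2 := by exact_mod_cast h0
    obtain ⟨hc, -⟩ := exists_cone_one a b t hv h1.le
    have h3 := hg' _ hc
    have e : rotVec (v.2, v.2 - v.1) = v := by
      ext <;> simp only [rotVec]
      ring
    rw [e] at h3
    rw [j1 _ ((one_le_div hpos).2 h1'), ← h3]
    congr 1
    push_cast
    field_simp

end Arc

/-! ### The convex region -/

/-- For `δ = 0` and the scale `1`, the enlarged triangle is the triangle of the corners. -/
theorem mem_projChamber_of_mem_nearTriangle {y : Plane} (hy : y ∈ nearTriangle 1 0) :
    y ∈ projChamber := by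
  have hs := sum_baryAt 1 y
  have he := eq_smul_sum_baryAt one_ne_zero y
  refine ⟨baryAt 1 y, fun i => ?_, ?_, ?_⟩
  · have := hy i (i + 1) (by fin_cases i <;> simp)
    simpa using this
  · intro h
    simp [h] at hs
  · rw [projPoint, Fin.sum_univ_three, hs, inv_one, one_smul]
    simpa using he

namespace Arc

variable {a b : ℝ} {t : Fin 3 → ℤ × ℤ → ℝ} {u w v : ℤ × ℤ}

theorem projPoint_lengths_mem_nearTriangle (h : Arc a b t) (hv : IsCoprime v.1 v.2) :
    projPoint (lengths t v) ∈ nearTriangle (triScale a b) (arcError a) := by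
  have h1 := h.half_le_sum_coord hv
  have hpos : 0 < coord a b t v 0 + coord a b t v 1 + coord a b t v 2 := by linarith
  intro k l hkl
  have e : projPoint (lengths t v) = triScale a b • projPoint (coord a b t v) :=
    projPoint_eq_triScale_smul h.ne h.add_ne _
  rw [e, baryAt_smul_projPoint (triScale_ne_zero h.ne h.add_ne) hpos.ne',
    baryAt_smul_projPoint (triScale_ne_zero h.ne h.add_ne) hpos.ne', ← mul_div_assoc]
  exact div_le_div_of_nonneg_right (h.neg_mul_coord_le hv hkl) hpos.le

theorem projPoint_lengths_mem_chamber (h : Arc a b t) (hv : IsCoprime v.1 v.2) :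
    projPoint (lengths t v) ∈ nearTriangle 1 0 := by
  have hpos := h.sum_lengths_pos hv
  intro k l _
  have h1 := baryAt_smul_projPoint one_ne_zero hpos.ne' k
  rw [one_smul] at h1
  rw [h1, neg_zero, zero_mul]
  have := (h.eq_cosh_lengths hv k).2
  exact div_nonneg (by linarith) hpos.le

theorem signedArea_pos (h : Arc a b t) (hu : IsCoprime u.1 u.2) (hw : IsCoprime w.1 w.2)
    (hv : IsCoprime v.1 v.2) (hd : 0 < det3 (coord a b t u) (coord a b t w) (coord a b t v)) :
    0 < signedArea (projPoint (lengths t u)) (projPoint (lengths t w))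
      (projPoint (lengths t v)) := by
  have h1 := h.sum_lengths_pos hu
  have h2 := h.sum_lengths_pos hw
  have h3 := h.sum_lengths_pos hv
  have hη : 0 < b - a := by linarith [h.lt]
  have hc : 0 < a + 2 * b := by linarith [h.four_le]
  rw [signedArea_projPoint h1.ne' h2.ne' h3.ne', det3_eq_bary h.ne h.add_ne]
  simp only [coord] at hd
  positivity

/-- Two independent supporting functionals at the point of a slope. -/
theorem exists_functionals (h : Arc a b t) (hv : IsCoprime v.1 v.2) :
    ∃ f g : Plane →L[ℝ] ℝ, LinearIndependent ℝ ![f, g] ∧ ∀ u : ℤ × ℤ, IsCoprime u.1 u.2 →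
      f (projPoint (lengths t u)) ≤ f (projPoint (lengths t v)) ∧
      g (projPoint (lengths t u)) ≤ g (projPoint (lengths t v)) := by
  obtain ⟨α, β, hd, hle⟩ := h.exists_support hv
  have hpos : ∀ {u : ℤ × ℤ}, IsCoprime u.1 u.2 →
      0 < coord a b t u 0 + coord a b t u 1 + coord a b t u 2 := fun hu => by
    have := h.half_le_sum_coord hu
    linarith
  set x := coord a b t v
  set c := triScale a b with hc
  have hc0 : c ≠ 0 := triScale_ne_zero h.ne h.add_ne
  have hscale : ∀ (m : Fin 3 → ℝ) (u : ℤ × ℤ), (c⁻¹ • planeFunctional m) (projPoint (lengths t u)) =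
      planeFunctional m (projPoint (coord a b t u)) := by
    intro m u
    rw [projPoint_eq_triScale_smul h.ne h.add_ne, ← hc, map_smul, smul_apply,
      smul_smul, mul_inv_cancel₀ hc0, one_smul, coord]
  refine ⟨c⁻¹ • planeFunctional (negMinors x α), c⁻¹ • planeFunctional (negMinors β x), ?_,
    fun u hu => ⟨?_, ?_⟩⟩
  · rw [LinearIndependent.pair_iff]
    intro p q hpq
    -- a functional of the plane that vanishes comes from a multiple of the sum of coordinates
    set k : Fin 3 → ℝ := fun i => p * negMinors x α i + q * negMinors β x i with hk
    have hzero : ∀ y : Plane, planeFunctional k y = 0 := by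
      intro y
      have h1 := congrArg (fun F : Plane →L[ℝ] ℝ => c * F y) hpq
      simp only [add_apply, smul_apply, smul_eq_mul,
        zero_apply, planeFunctional_apply, mul_zero] at h1
      rw [planeFunctional_apply]
      simp only [hk]
      field_simp at h1
      linarith
    have hs3 : √3 ≠ 0 := by positivity
    have k0 : k 0 - (k 1 + k 2) / 2 = 0 := by
      have := hzero (EuclideanSpace.single 0 1)
      simpa [planeFunctional_apply] using this
    have k1 : k 1 - k 2 = 0 := by
      have := hzero (EuclideanSpace.single 1 1)
      simpa [planeFunctional_apply] using this
    have happ : ∀ z : Fin 3 → ℝ, k 0 * z 0 + k 1 * z 1 + k 2 * z 2 =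
        -(p * det3 x α z + q * det3 β x z) := by
      intro z
      have e1 := negMinors_apply x α z
      have e2 := negMinors_apply β x z
      simp only [hk]
      linear_combination p * e1 + q * e2
    have kx := happ x
    have d1 : det3 x α x = 0 := by simp only [det3]; ring
    have d2 : det3 β x x = 0 := by simp only [det3]; ring
    have d3 : det3 x α α = 0 := by simp only [det3]; ring
    have d4 : det3 β x β = 0 := by simp only [det3]; ring
    have d5 : det3 β x α = det3 x α β := by simp only [det3]; ring
    have k2 : k 2 * (x 0 + x 1 + x 2) = 0 := by
      rw [d1, d2] at kx
      have e0 : k 0 = k 2 := by linarith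
      have e1 : k 1 = k 2 := by linarith
      rw [e0, e1] at kx
      linarith
    have k2' : k 2 = 0 := (mul_eq_zero.1 k2).resolve_right (hpos hv).ne'
    have k1' : k 1 = 0 := by linarith
    have k0' : k 0 = 0 := by linarith
    have hα := happ α
    have hβ := happ β
    rw [k0', k1', k2', d3, d5] at hα
    rw [k0', k1', k2', d4] at hβ
    constructor
    · refine (mul_eq_zero.1 (?_ : p * det3 x α β = 0)).resolve_right hd.ne'
      linarith
    · refine (mul_eq_zero.1 (?_ : q * det3 x α β = 0)).resolve_right hd.ne'
      linarith
  · rw [hscale, hscale]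
    exact planeFunctional_negMinors_le (hpos hv) (hpos hu) (hle u hu).1
      (by simp only [det3]; ring)
  · rw [hscale, hscale]
    exact planeFunctional_negMinors_le (hpos hv) (hpos hu) (hle u hu).2
      (by simp only [det3]; ring)

/-- The closed convex curve through the points of all slopes, and the region that it bounds. -/
theorem exists_region (h : Arc a b t) :
    ∃ (j : OnePoint ℝ → Plane) (C : Set Plane), Continuous j ∧
      (∀ v ∈ FiniteSlope, j (((v.2 : ℝ) / v.1 : ℝ) : OnePoint ℝ) = projPoint (lengths t v)) ∧
      j OnePoint.infty = projPoint (lengths t (0, 1)) ∧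
      C ⊆ projChamber ∧ IsCompact C ∧ (interior C).Nonempty ∧ StrictConvex ℝ C ∧
      Set.range j = frontier C ∧
      (∀ v : ℤ × ℤ, IsCoprime v.1 v.2 → IsAngularPoint C (projPoint (lengths t v))) ∧
      convexHull ℝ (Set.range fun k => triScale a b • corner k) ⊆ C ∧
      C ⊆ nearTriangle (triScale a b) (arcError a) := by
  obtain ⟨j, hj, hfin, hinf⟩ := h.exists_curve
  have hrat : ∀ r : ℚ, ((r.den, r.num) : ℤ × ℤ) ∈ FiniteSlope ∧
      j (r : ℝ) = projPoint (lengths t (r.den, r.num)) := by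
    intro r
    have hm : ((r.den, r.num) : ℤ × ℤ) ∈ FiniteSlope :=
      ⟨Int.natCast_pos.2 r.den_pos, r.isCoprime_num_den.symm⟩
    refine ⟨hm, ?_⟩
    rw [← hfin _ hm]
    simp [Rat.cast_def]
  have hdet : ∀ {r s : ℚ}, r < s → (0 : ℤ) < r.den * s.num - r.num * s.den := by
    intro r s hrs
    have := (Rat.lt_iff r s).1 hrs
    linarith
  have hinf' : IsCoprime ((0, 1) : ℤ × ℤ).1 ((0, 1) : ℤ × ℤ).2 := isCoprime_one_right
  have hmem : ∀ v : ℤ × ℤ, IsCoprime v.1 v.2 → projPoint (lengths t v) ∈ Set.range j := by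
    intro v hv
    rcases finiteSlope_or hv with (h3 | h3) | (h3 | h3)
    · exact ⟨_, hfin v h3⟩
    · exact ⟨_, (hfin _ h3).trans (by rw [h.lengths_neg])⟩
    · rw [h3]; exact ⟨_, hinf⟩
    · rw [← h.lengths_neg, h3]; exact ⟨_, hinf⟩
  have hsub : ∀ {A : Set Plane}, IsClosed A →
      (∀ v : ℤ × ℤ, IsCoprime v.1 v.2 → projPoint (lengths t v) ∈ A) → Set.range j ⊆ A :=
    fun hA h1 => range_subset_of_rat hj hA fun r => by
      rw [(hrat r).2]; exact h1 _ (hrat r).1.2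
  have hsupp : ∀ v : ℤ × ℤ, IsCoprime v.1 v.2 → ∃ f g : Plane →L[ℝ] ℝ,
      LinearIndependent ℝ ![f, g] ∧ ∀ y ∈ convexHull ℝ (Set.range j),
        f y ≤ f (projPoint (lengths t v)) ∧ g y ≤ g (projPoint (lengths t v)) := by
    intro v hv
    obtain ⟨f, g, hfg, hle⟩ := h.exists_functionals hv
    refine ⟨f, g, hfg, fun y hy => ⟨?_, ?_⟩⟩
    · exact convexHull_min (hsub (isClosed_le f.continuous continuous_const)
        fun u hu => (hle u hu).1) (convex_halfSpace_le f.isLinear _) hy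
    · exact convexHull_min (hsub (isClosed_le g.continuous continuous_const)
        fun u hu => (hle u hu).2) (convex_halfSpace_le g.isLinear _) hy
  obtain ⟨c1, c2, c3, c4⟩ := convexHull_range_of_curve hj
    (fun r s q hrs hsq => by
      rw [(hrat r).2, (hrat s).2, (hrat q).2]
      exact h.signedArea_pos (hrat r).1.2 (hrat s).1.2 (hrat q).1.2
        (h.det3_pos_of_det (hrat r).1 (hrat s).1 (hrat q).1 (hdet hrs) (hdet hsq)))
    (fun r s hrs => by
      rw [(hrat r).2, (hrat s).2, hinf]
      refine h.signedArea_pos (hrat r).1.2 (hrat s).1.2 hinf' ?_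
      rw [h.coord_infty, det3_single_two]
      exact h.minor_pos_of_det (hrat r).1 (hrat s).1 (hdet hrs))
    (fun r => by
      obtain ⟨f, g, hfg, hle⟩ := hsupp _ (hrat r).1.2
      refine ⟨f, hfg.ne_zero 0, fun y => ?_⟩
      rw [(hrat r).2]
      exact (hle _ (subset_convexHull ℝ _ (Set.mem_range_self y))).1)
  refine ⟨j, convexHull ℝ (Set.range j), hj, hfin, hinf, ?_, c1, c2, c3, c4, ?_, ?_, ?_⟩
  · exact (convexHull_min (hsub (isClosed_nearTriangle 1 0)
      fun v hv => h.projPoint_lengths_mem_chamber hv) (convex_nearTriangle 1 0)).trans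
      fun y hy => mem_projChamber_of_mem_nearTriangle hy
  · intro v hv
    exact ⟨subset_convexHull ℝ _ (hmem v hv), hsupp v hv⟩
  · refine convexHull_mono ?_
    rintro _ ⟨k, rfl⟩
    have key : ∀ v : ℤ × ℤ, IsCoprime v.1 v.2 → coord a b t v = Pi.single k 1 →
        triScale a b • corner k ∈ Set.range j := by
      intro v hv he
      have := hmem v hv
      rwa [projPoint_eq_triScale_smul h.ne h.add_ne, show bary a b (lengths t v) = _ from he,
        projPoint_single] at this
    fin_cases k
    · exact key (1, 0) isCoprime_one_left h.coord_zero
    · exact key (1, 1) isCoprime_one_left h.coord_one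
    · exact key (0, 1) isCoprime_one_right h.coord_infty
  · exact convexHull_min (hsub (isClosed_nearTriangle _ _)
      fun v hv => h.projPoint_lengths_mem_nearTriangle hv) (convex_nearTriangle _ _)

end Arc

/-- A representation of the free group lifts to `SL(2, ℝ)`, with nonnegative traces on the
generators. -/
theorem exists_lift (ρ : TorusGroup →* PSL2R) :
    ∃ φ : TorusGroup →* SL(2, ℝ), (∀ g, (QuotientGroup.mk (φ g) : PSL2R) = ρ g) ∧
      ∀ k, 0 ≤ sltr (φ (FreeGroup.of k)) := by
  have h1 : ∀ k, ∃ A : SL(2, ℝ), (QuotientGroup.mk A : PSL2R) = ρ (FreeGroup.of k) ∧ 0 ≤ sltr A := by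
    intro k
    obtain ⟨A, hA⟩ := QuotientGroup.mk_surjective (ρ (FreeGroup.of k))
    rcases le_or_gt 0 (sltr A) with h | h
    · exact ⟨A, hA, h⟩
    · refine ⟨-A, ?_, ?_⟩
      · rw [← hA, QuotientGroup.eq, Matrix.SpecialLinearGroup.mem_center_iff]
        exact ⟨-1, by simp, by ext i j; fin_cases i <;> fin_cases j <;> simp⟩
      · simp only [sltr, Matrix.SpecialLinearGroup.coe_neg, Matrix.neg_apply] at h ⊢
        linarith
  choose A hA hA' using h1
  refine ⟨FreeGroup.lift A, fun g => ?_, fun k => by rw [FreeGroup.lift_apply_of]; exact hA' k⟩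
  have : (QuotientGroup.mk' (Subgroup.center SL(2, ℝ))).comp (FreeGroup.lift A) = ρ := by
    ext k
    simp [hA]
  exact DFunLike.congr_fun this g

/-- The primitive vector of a slope. -/
def slopeVec (s : OnePoint ℚ) : ℤ × ℤ := s.elim (0, 1) fun r => (r.den, r.num)

theorem isCoprime_slopeVec (s : OnePoint ℚ) : IsCoprime (slopeVec s).1 (slopeVec s).2 := by
  induction s using OnePoint.rec with
  | infty => exact isCoprime_one_right
  | coe r => exact r.isCoprime_num_den.symm

theorem slopeOf_slopeVec (s : OnePoint ℚ) : slopeOf (slopeVec s) = s := by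
  induction s using OnePoint.rec with
  | infty => simp [slopeVec, slopeOf]
  | coe r => simp [slopeVec, slopeOf, Rat.num_div_den]

/-- The translation length determines the trace, once large negative traces are excluded. -/
theorem eq_of_sq_eq_of_neg_two_le {x h : ℝ} (hh : 0 < h) (hx : x ^ 2 = (2 * Real.cosh h) ^ 2)
    (hx' : -2 ≤ x) : x = 2 * Real.cosh h := by
  have h1 := Real.one_lt_cosh.2 hh.ne'
  rcases sq_eq_sq_iff_eq_or_eq_neg.1 hx with h2 | h2
  · exact h2
  · linarith

/-- The traces of a triple of holonomy representations with the prescribed translation lengths. -/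
theorem exists_arc {a b : ℝ} (ha : arcError a ≤ 1 / 4) (hab : a < b)
    (ρ : Fin 3 → TorusGroup →* PSL2R) (hρ : ∀ i, IsHolonomy (ρ i))
    (h0 : ∀ i, translationLength (ρ i (slopeCurve ((0 : ℚ) : OnePoint ℚ))) =
      2 * sideLengths a b 0 i)
    (h1 : ∀ i, translationLength (ρ i (slopeCurve ((1 : ℚ) : OnePoint ℚ))) =
      2 * sideLengths a b 1 i)
    (h2 : ∀ i, translationLength (ρ i (slopeCurve OnePoint.infty)) = 2 * sideLengths a b 2 i) :
    ∃ t : Fin 3 → ℤ × ℤ → ℝ, Arc a b t ∧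
      ∀ s, jordan ρ (slopeCurve s) = (2 : ℝ) • lengths t (slopeVec s) := by
  have h4 := four_le_of_arcError_le ha
  have hside : ∀ k i, 0 < sideLengths a b k i := by
    intro k i
    unfold sideLengths
    split_ifs <;> linarith
  choose φ hφ hφ' using fun i => exists_lift (ρ i)
  have c0 : slopeCurve ((0 : ℚ) : OnePoint ℚ) = FreeGroup.of 0 := by
    rw [slopeCurve_coe]
    simpa using slopeWord_one 0
  have c1 : slopeCurve ((1 : ℚ) : OnePoint ℚ) = FreeGroup.of 0 * FreeGroup.of 1 := by
    rw [slopeCurve_coe]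
    simpa using slopeWord_one 1
  have sq : ∀ i s k, translationLength (ρ i (slopeCurve s)) = 2 * sideLengths a b k i →
      sltr (φ i (slopeCurve s)) ^ 2 = (2 * Real.cosh (sideLengths a b k i)) ^ 2 := by
    intro i s k h
    exact tr_sq_eq_of_translationLength _ (hside k i) (by rw [hφ, h])
  have t0 : ∀ i, sltr (φ i (FreeGroup.of 0)) = 2 * Real.cosh (sideLengths a b 0 i) := fun i =>
    eq_of_sq_eq_of_neg_two_le (hside 0 i) (by rw [← c0]; exact sq i _ 0 (h0 i))
      (by linarith [hφ' i 0])
  have t2 : ∀ i, sltr (φ i (FreeGroup.of 1)) = 2 * Real.cosh (sideLengths a b 2 i) := fun i =>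
    eq_of_sq_eq_of_neg_two_le (hside 2 i) (by rw [← slopeCurve_infty]; exact sq i _ 2 (h2 i))
      (by linarith [hφ' i 1])
  have hgt : ∀ k i, 2 < 2 * Real.cosh (sideLengths a b k i) := fun k i => by
    have := Real.one_lt_cosh.2 (hside k i).ne'
    linarith
  have t1 : ∀ i, sltr (φ i (FreeGroup.of 0 * FreeGroup.of 1)) =
      2 * Real.cosh (sideLengths a b 1 i) := fun i =>
    eq_of_sq_eq_of_neg_two_le (hside 1 i) (by rw [← c1]; exact sq i _ 1 (h1 i))
      (neg_two_le_trace_mul_of_isHolonomy (hρ i) (φ i) (hφ i)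
        ((hgt 0 i).trans_eq (t0 i).symm) ((hgt 2 i).trans_eq (t2 i).symm))
  have harc : Arc a b fun i => slopeTrace (φ i) := by
    refine ⟨fun i => isMarkov_slopeTrace (φ i), ha, hab, fun i => ?_, fun i => ?_, fun i => ?_⟩
    · have : slopeOf (1, 0) = ((0 : ℚ) : OnePoint ℚ) := by simp [slopeOf]
      rw [slopeTrace, this, c0, t0]
    · have : slopeOf (1, 1) = ((1 : ℚ) : OnePoint ℚ) := by simp [slopeOf]
      rw [slopeTrace, this, c1, t1]
    · rw [slopeTrace_zero, t2]
  refine ⟨_, harc, fun s => ?_⟩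
  funext i
  obtain ⟨e1, e2⟩ := harc.eq_cosh_lengths (isCoprime_slopeVec s) i
  rw [slopeTrace, slopeOf_slopeVec] at e1
  rw [jordan, ← hφ i, translationLength_eq_two_mul _ (by linarith) (congrArg (· ^ 2) e1),
    Pi.smul_apply, smul_eq_mul]

theorem mainTheorem7 (ε : ℝ) (hε : 0 < ε) :
    ∃ M : ℝ, ∀ a b : ℝ, M ≤ a → a < b →
      ∀ ρ : Fin 3 → TorusGroup →* PSL2R, (∀ i, IsHolonomy (ρ i)) →
        (∀ i, translationLength (ρ i (slopeCurve ((0 : ℚ) : OnePoint ℚ))) =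
          2 * sideLengths a b 0 i) →
        (∀ i, translationLength (ρ i (slopeCurve ((1 : ℚ) : OnePoint ℚ))) =
          2 * sideLengths a b 1 i) →
        (∀ i, translationLength (ρ i (slopeCurve OnePoint.infty)) =
          2 * sideLengths a b 2 i) →
        ∃ (j : OnePoint ℝ → Plane) (C : Set Plane),
          -- `j` is a continuous extension of the map `p/q ↦ [jordan ρ (γ_{p/q})]`
          Continuous j ∧
          (∀ s : OnePoint ℚ,
            j (s.map (fun r : ℚ => (r : ℝ))) = projPoint (jordan ρ (slopeCurve s))) ∧
          -- its image is the boundary of a strictly convex region `C`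
          C ⊆ projChamber ∧ IsCompact C ∧ (interior C).Nonempty ∧ StrictConvex ℝ C ∧
          Set.range j = frontier C ∧
          -- every rational point is an angular point
          (∀ s : OnePoint ℚ, IsAngularPoint C (projPoint (jordan ρ (slopeCurve s)))) ∧
          -- `C` is close to the triangle, relatively to the size of the triangle
          Metric.hausdorffDist C
              (convexHull ℝ (Set.range fun k => projPoint (sideLengths a b k))) ≤
            ε * Metric.diam
              (convexHull ℝ (Set.range fun k => projPoint (sideLengths a b k))) ∧
          -- the angles of `C` at the vertices of the triangle are close to those of the triangle
          (∀ i k l : Fin 3, i ≠ k → i ≠ l → k ≠ l →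
            ∀ x ∈ C, ∀ y ∈ C,
              x ≠ projPoint (sideLengths a b i) → y ≠ projPoint (sideLengths a b i) →
              EuclideanGeometry.angle x (projPoint (sideLengths a b i)) y ≤
                EuclideanGeometry.angle (projPoint (sideLengths a b k))
                  (projPoint (sideLengths a b i)) (projPoint (sideLengths a b l)) + ε) := by
  obtain ⟨δ₀, hδ₀, hangle⟩ := exists_arccos_le hε
  -- `M` is such that `arcError a` is at most `m` for `a ≥ M`: below `1 / 4` for the estimates,
  -- below `ε` for the Hausdorff distance, and below `δ₀` for the angles
  set m := min (1 / 4) (min ε δ₀) with hm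
  have hm0 : 0 < m := lt_min (by norm_num) (lt_min hε hδ₀)
  have htend : Filter.Tendsto arcError Filter.atTop (nhds 0) := by
    have h1 : Filter.Tendsto (fun a : ℝ => 4 - a) Filter.atTop Filter.atBot := by
      have := Filter.tendsto_atBot_add_const_left Filter.atTop (4 : ℝ)
        Filter.tendsto_neg_atTop_atBot
      simpa only [← sub_eq_add_neg] using this
    change Filter.Tendsto (fun a : ℝ => 24576 * Real.exp (4 - a)) Filter.atTop (nhds 0)
    simpa using (Real.tendsto_exp_atBot.comp h1).const_mul 24576
  obtain ⟨M, hM⟩ := Filter.eventually_atTop.1 (htend.eventually_le_const hm0)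
  refine ⟨M, fun a b ha hab ρ hρ h0 h1 h2 => ?_⟩
  have herr := hM a ha
  have e1 : arcError a ≤ 1 / 4 := herr.trans (min_le_left _ _)
  have e2 : arcError a ≤ ε := herr.trans ((min_le_right _ _).trans (min_le_left _ _))
  have e3 : arcError a ≤ δ₀ := herr.trans ((min_le_right _ _).trans (min_le_right _ _))
  have e0 := (arcError_pos a).le
  obtain ⟨t, ht, hjordan⟩ := exists_arc e1 hab ρ hρ h0 h1 h2
  obtain ⟨j, C, hj, hfin, hinf, c1, c2, c3, c4, c5, c6, c7, c8⟩ := ht.exists_region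
  have hc := triScale_ne_zero ht.ne ht.add_ne
  have hpt : ∀ s, projPoint (jordan ρ (slopeCurve s)) = projPoint (lengths t (slopeVec s)) :=
    fun s => by rw [hjordan, projPoint_smul two_ne_zero]
  simp only [projPoint_sideLengths ht.ne ht.add_ne]
  refine ⟨j, C, hj, fun s => ?_, c1, c2, c3, c4, c5, fun s => ?_, ?_, ?_⟩
  · rw [hpt]
    induction s using OnePoint.rec with
    | infty => exact hinf
    | coe r =>
      have := hfin (r.den, r.num) ⟨Int.natCast_pos.2 r.den_pos, r.isCoprime_num_den.symm⟩
      rw [slopeVec, OnePoint.map_some, OnePoint.elim_some, ← this]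
      simp [Rat.cast_def]
  · rw [hpt]
    exact c6 _ (isCoprime_slopeVec s)
  · exact (hausdorffDist_triangle_le hc e0 (e1.trans (by norm_num)) c7 c8).trans
      (mul_le_mul_of_nonneg_right e2 Metric.diam_nonneg)
  · intro i k l hik hil hkl x hx y hy hxi hyi
    rw [angle_triangle hc hik hil hkl]
    exact (angle_nearTriangle_le hc e0 e1 hik hil hkl (c8 hx) (c8 hy) hxi hyi).trans
      (hangle _ e3)
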